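/- **Setting.** Let $\mathcal A$ be a simple arrangement of $n$ pseudolines $l_1,\dots,l_n$: graphs of continuous functions $\mathbb R\to\mathbb R$, any two of which meet in exactly one point and cross there, no three of which meet in a point, numbered from bottom to top at the far left. It is described by the lists $S_i$ of the pseudolines crossed by $l_i$ from left to right. ($\mathcal A$ need not be stretchable.) *The polygon.* Each $l_i$ is replaced by its channel $Ch(l_i)$, a thin convex region bounded by an upper and a lower chain that share the two endpoints of the channel; the break-points of the chains are the crossings of chains of different channels, so two channels have four common vertices. The crossings divide each channel into $n$ corridors. The union of the channels is a polygon with holes; the holes are its boundary cycles that contain no channel endpoint. On each boundary segment of a hole between two crossing points one further vertex is added. The holes are then opened one after the other: a pair of parallel, close cut edges is drawn across a corridor, from a boundary segment of a hole that is still closed to a segment of the current outer boundary on the opposite side of the corridor, until no hole is left; the four endpoints of the two cut edges become vertices. For any such choice of cuts let $\mathcal P$ be the resulting cyclic order of all vertices along the boundary of the resulting simple polygon, and let $\mathcal G_{int}$ be its internal visibility graph: two vertices are adjacent if and only if they belong to the same channel and no cut across this channel separates them. Both depend only on the lists $S_i$ and the cuts. *Blocking vertices.* Let $G$ be a graph with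 a Hamiltonian cycle $P$, and let $(a,b)$ be an ordered invisible pair (two distinct non-adjacent vertices). A vertex $o$ is a blocking vertex of $(a,b)$ if, on one of the two walks from $a$ to $b$ along $P$, $o$ lies strictly between $a$ and $b$ and all vertices from $a$ (included) to $o$ (excluded) are non-adjacent to all vertices from $o$ (excluded) to $b$ (included); the second of Ghosh's necessary conditions for visibility graphs asks for such a vertex for every invisible pair. A blocking vertex assignment of $(G,P)$ is a function that assigns to each ordered invisible pair $(a,b)$ a blocking vertex of $(a,b)$ that is adjacent to $a$. **Theorem.** For every such arrangement and every such choice of cuts, the boundary cycle $\mathcal P$ exists and is a Hamiltonian cycle of $\mathcal G_{int}$, and $(\mathcal G_{int},\mathcal P)$ has exactly one blocking vertex assignment. Moreover, there is one program (of a random access machine with unit costs, addition and subtraction) which, given $\mathcal G_{int}$ and $\mathcal P$ for any such arrangement and cuts, under any numbering of the vertices by $0,\dots,N-1$, outputs this assignment within a number of steps polynomial in the number $N$ of vertices. The program uses nothing about its input beyond Ghosh's second condition: for every graph on $N$ vertices given with a Hamiltonian cycle, it halts within the same polynomial bound, and it outputs, for each ordered invisible pair $(a,b)$ that has a blocking vertex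 adjacent to $a$, such a blocking vertex. -/

import Mathlib

/-! ## Graphs with a Hamiltonian cycle and blocking vertex assignments -/

section Blocking

variable {V : Type*}

/-- `P` is a Hamiltonian cycle of `G`: a cyclic sequence that runs through every vertex exactly once,
consecutive vertices being adjacent. -/
def IsHamiltonianCycle (G : SimpleGraph V) (P : Cycle V) : Prop :=
  P.Nodup ∧ (∀ v, v ∈ P) ∧ P.Chain G.Adj

/-- `o` blocks `(p, q)` on the walk from `p` to `q` in the direction of `P`: on this walk every vertex
from `p` (included) to `o` (excluded) is invisible to every vertex from `o` (excluded) to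
`q` (included). -/
def BlocksAlong (G : SimpleGraph V) (P : Cycle V) (p q o : V) : Prop :=
  ∃ A B C : List V,
    P = ((p :: A ++ o :: (B ++ q :: C) : List V) : Cycle V) ∧
      ∀ x ∈ p :: A, ∀ y ∈ B ++ [q], ¬ G.Adj x y

/-- `o` is a blocking vertex of `(p, q)`, on one of the two walks from `p` to `q` along `P`. -/
def IsBlockingVertex (G : SimpleGraph V) (P : Cycle V) (p q o : V) : Prop :=
  BlocksAlong G P p q o ∨ BlocksAlong G P.reverse p q o

/-- Ordered invisible pairs: two distinct vertices that are not adjacent. -/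
def InvisiblePair (G : SimpleGraph V) : Type _ :=
  {p : V × V // p.1 ≠ p.2 ∧ ¬ G.Adj p.1 p.2}

/-- A blocking vertex assignment gives each ordered invisible pair `(a, b)` a blocking vertex of the
pair that is visible from `a`. -/
def IsBlockingVertexAssignment (G : SimpleGraph V) (P : Cycle V) (β : InvisiblePair G → V) : Prop :=
  ∀ p : InvisiblePair G, G.Adj p.1.1 (β p) ∧ IsBlockingVertex G P p.1.1 p.1.2 (β p)

end Blocking

/-! ## Pseudoline arrangements -/

/-- `S` is the description of a simple arrangement of `n` pseudolines. The pseudolines are the graphs of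
continuous functions `f i : ℝ → ℝ`, numbered from bottom to top at the far left. Any two of them meet in
exactly one point, with abscissa `X i j`, and cross there; no three of them meet in a point. `S i` is
the list of the pseudolines crossed by the pseudoline `i`, from left to right. -/
def IsPseudolineArrangement {n : ℕ} (S : Fin n → List (Fin n)) : Prop :=
  ∃ (f : Fin n → ℝ → ℝ) (X : Fin n → Fin n → ℝ),
    (∀ i, Continuous (f i)) ∧
    (∀ i j, X i j = X j i) ∧
    (∀ i j, i < j → ∀ t,
      (t < X i j → f i t < f j t) ∧ (t = X i j → f i t = f j t) ∧ (X i j < t → f j t < f i t)) ∧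
    (∀ i j k, i ≠ j → i ≠ k → j ≠ k → X i j ≠ X i k) ∧
    (∀ i j, j ∈ S i ↔ j ≠ i) ∧
    (∀ i, (S i).Pairwise fun j k => X i j < X i k)

/-! ## The polygon of an arrangement

The channel of the pseudoline `i` is a thin convex region around `i`, bounded by an upper chain `(i, true)`
and a lower chain `(i, false)` which join the two endpoints of the channel. The break-points of the
chains are the points where chains of different channels cross. The crossings divide the channel into
`n` corridors `(i, k)`, `k = 0, …, n - 1`, from left to right; a side `(i, k, u)` is the part of the
chain `(i, u)` that bounds the corridor `(i, k)`. The polygon with holes is the union of the channels,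
and its boundary consists of the sides. -/

/-- Names for the points that can be vertices of the polygon. -/
inductive Point (n : ℕ) : Type
  /-- the left endpoint of the channel `i` -/
  | leftEnd (i : Fin n) : Point n
  /-- the right endpoint of the channel `i` -/
  | rightEnd (i : Fin n) : Point n
  /-- the common point of the chains `(i, u)` and `(j, v)`, used for `i < j` -/
  | cross (i : Fin n) (u : Bool) (j : Fin n) (v : Bool) : Point n
  /-- the additional point on the side `(i, k, u)` of a hole -/
  | mid (i k : Fin n) (u : Bool) : Point n
  /-- the endpoint on the side `(i, k, u)` of the left (`r = false`) or right (`r = true`) one of the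
  two parallel cut edges across the corridor `(i, k)` -/
  | cut (i k : Fin n) (u r : Bool) : Point n

/-- The common point of the chains `(i, u)` and `(j, v)`, where `i ≠ j`. -/
def crossPoint {n : ℕ} (i : Fin n) (u : Bool) (j : Fin n) (v : Bool) : Point n :=
  if i < j then .cross i u j v else .cross j v i u

/-- The left end of the side `(i, k, u)`: the endpoint of the channel if `k = 0`; otherwise the
point where `(i, u)` leaves the channel `j` crossed just before the corridor. From left to right, `i` passes
`j` from below to above if `i < j`, and then it leaves through the upper chain of `j`. -/
def leftPoint {n : ℕ} (S : Fin n → List (Fin n)) (i k : Fin n) (u : Bool) : Point n :=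
  match k.val with
  | 0 => .leftEnd i
  | m + 1 =>
    match (S i)[m]? with
    | none => .leftEnd i
    | some j => crossPoint i u j (decide (i < j))

/-- The right end of the side `(i, k, u)`: the point where `(i, u)` enters the channel `j` crossed just
after the corridor, or the right endpoint of the channel if there is no such `j`. -/
def rightPoint {n : ℕ} (S : Fin n → List (Fin n)) (i k : Fin n) (u : Bool) : Point n :=
  match (S i)[k.val]? with
  | none => .rightEnd i
  | some j => crossPoint i u j (decide (j < i))

/-- Sides `(i, k, u)`. -/
abbrev Side (n : ℕ) : Type := Fin n × Fin n × Bool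

/-- `x` is one of the two ends of the side `s`. -/
def IsEndOf {n : ℕ} (S : Fin n → List (Fin n)) (x : Point n) (s : Side n) : Prop :=
  x = leftPoint S s.1 s.2.1 s.2.2 ∨ x = rightPoint S s.1 s.2.1 s.2.2

/-- `s` and `t` lie on the same boundary cycle of the polygon with holes: they are joined by a
sequence of sides in which consecutive sides have a common end. -/
def SameBoundary {n : ℕ} (S : Fin n → List (Fin n)) (s t : Side n) : Prop :=
  Relation.ReflTransGen (fun a b => ∃ x, IsEndOf S x a ∧ IsEndOf S x b) s t

/-- The side `s` lies on a hole, that is, on a boundary cycle that contains no endpoint of a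
channel (all these endpoints lie on the outer boundary). -/
def OnHole {n : ℕ} (S : Fin n → List (Fin n)) (s : Side n) : Prop :=
  ∀ t, SameBoundary S s t → ∀ i, ¬ IsEndOf S (.leftEnd i) t ∧ ¬ IsEndOf S (.rightEnd i) t

/-- A choice of cuts: the corridors that are cut, the last one first, and for each side, whether the
cut meets it to the right of the additional point (which matters only on a cut side of a hole). -/
structure Cuts (n : ℕ) where
  corridors : List (Fin n × Fin n)
  rightOfMid : Fin n → Fin n → Bool → Bool

/-- `CutsReach S l O`: one can cut the corridors in `l` one after the other, starting with the
last entry of `l`, so that each cut leads from a side on the current outer boundary to the opposite side,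
which lies on a hole that is still closed; `O` is the set of the sides that are then on the
outer boundary. -/
inductive CutsReach {n : ℕ} (S : Fin n → List (Fin n)) :
    List (Fin n × Fin n) → Set (Side n) → Prop
  | start : CutsReach S [] {s | ¬ OnHole S s}
  | step (l : List (Fin n × Fin n)) (O : Set (Side n)) (i k : Fin n) (u : Bool) :
      CutsReach S l O → (i, k, u) ∈ O → (i, k, !u) ∉ O →
        CutsReach S ((i, k) :: l) (O ∪ {s | SameBoundary S (i, k, !u) s})

/-- The cuts open all holes, each exactly once. -/
def Cuts.OpenAllHoles {n : ℕ} (K : Cuts n) (S : Fin n → List (Fin n)) : Prop :=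
  CutsReach S K.corridors Set.univ

open Classical in
/-- The vertices, from left to right, of the side `(i, k, u)` of a corridor without a cut. -/
noncomputable def wholeSide {n : ℕ} (S : Fin n → List (Fin n)) (i k : Fin n) (u : Bool) :
    List (Point n) :=
  leftPoint S i k u :: ((if OnHole S (i, k, u) then [.mid i k u] else []) ++ [rightPoint S i k u])

open Classical in
/-- The vertices, from left to right, of the part of the side `(i, k, u)` on the left of the cut. -/
noncomputable def leftPart {n : ℕ} (S : Fin n → List (Fin n)) (K : Cuts n) (i k : Fin n) (u : Bool) :
    List (Point n) :=
  leftPoint S i k u ::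
    ((if OnHole S (i, k, u) ∧ K.rightOfMid i k u = true then [.mid i k u] else []) ++ [.cut i k u false])

open Classical in
/-- The vertices, from left to right, of the part of the side `(i, k, u)` on the right of the cut. -/
noncomputable def rightPart {n : ℕ} (S : Fin n → List (Fin n)) (K : Cuts n) (i k : Fin n) (u : Bool) :
    List (Point n) :=
  .cut i k u true ::
    ((if OnHole S (i, k, u) ∧ K.rightOfMid i k u = false then [.mid i k u] else []) ++
      [rightPoint S i k u])

open Classical in
/-- The one or two parts of the side `(i, k, u)` on the boundary of the simple polygon. -/
noncomputable def sideParts {n : ℕ} (S : Fin n → List (Fin n)) (K : Cuts n) (i k : Fin n) (u : Bool) :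
    List (List (Point n)) :=
  if (i, k) ∈ K.corridors then [leftPart S K i k u, rightPart S K i k u] else [wholeSide S i k u]

/-- The vertices of the simple polygon obtained from the arrangement `S` and the cuts `K`. -/
def PolygonVertex {n : ℕ} (S : Fin n → List (Fin n)) (K : Cuts n) : Type :=
  {x : Point n // ∃ i k u, ∃ L ∈ sideParts S K i k u, x ∈ L}

/-- `y` follows `x` on the boundary of the simple polygon, with the polygon on the left. Upper sides
are run through from right to left and lower sides from left to right, and the boundary crosses a
corridor along each cut edge. -/
inductive BoundaryStep {n : ℕ} (S : Fin n → List (Fin n)) (K : Cuts n) : Point n → Point n → Prop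
  | lower (i k : Fin n) (L : List (Point n)) (x y : Point n) :
      L ∈ sideParts S K i k false → [x, y] <:+: L → BoundaryStep S K x y
  | upper (i k : Fin n) (L : List (Point n)) (x y : Point n) :
      L ∈ sideParts S K i k true → [y, x] <:+: L → BoundaryStep S K x y
  | cutLeft (i k : Fin n) : (i, k) ∈ K.corridors →
      BoundaryStep S K (.cut i k false false) (.cut i k true false)
  | cutRight (i k : Fin n) : (i, k) ∈ K.corridors →
      BoundaryStep S K (.cut i k true true) (.cut i k false true)

/-- `P` is the cyclic order of the vertices along the boundary of the simple polygon. -/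
def IsBoundaryCycle {n : ℕ} (S : Fin n → List (Fin n)) (K : Cuts n) (P : Cycle (PolygonVertex S K)) :
    Prop :=
  P.Nodup ∧ (∀ v, v ∈ P) ∧ P.Chain fun x y => BoundaryStep S K x.1 y.1

/-- The point `x` is a vertex of the channel `i`. -/
def OnChannel {n : ℕ} (S : Fin n → List (Fin n)) (K : Cuts n) (i : Fin n) (x : Point n) : Prop :=
  ∃ k u, ∃ L ∈ sideParts S K i k u, x ∈ L

/-- The vertex `x` of the channel `i` lies on the left of the cut across the corridor `(i, k)`. -/
def LeftOfCut {n : ℕ} (S : Fin n → List (Fin n)) (K : Cuts n) (i k : Fin n) (x : Point n) : Prop :=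
  (∃ k' u, k' < k ∧ ∃ L ∈ sideParts S K i k' u, x ∈ L) ∨ ∃ u, x ∈ leftPart S K i k u

/-- The internal visibility graph: two vertices see each other if and only if they belong to the same
channel and no cut across this channel separates them. -/
def internalVisibility {n : ℕ} (S : Fin n → List (Fin n)) (K : Cuts n) :
    SimpleGraph (PolygonVertex S K) where
  Adj x y := x ≠ y ∧ ∃ i, OnChannel S K i x.1 ∧ OnChannel S K i y.1 ∧
    ∀ k, (i, k) ∈ K.corridors → (LeftOfCut S K i k x.1 ↔ LeftOfCut S K i k y.1)
  symm := ⟨fun _ _ ⟨hne, i, hx, hy, h⟩ => ⟨hne.symm, i, hy, hx, fun k hk => (h k hk).symm⟩⟩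
  loopless := ⟨fun _ h => h.1 rfl⟩

/-! ## A random access machine with unit costs

Registers and memory cells hold natural numbers. There is no multiplication, so that `t` steps lengthen
the numbers by at most `t` bits, and polynomial time is the same as for Turing machines. -/

/-- The state of the machine. -/
structure RamState where
  reg : ℕ → ℕ
  mem : ℕ → ℕ

/-- Programs. -/
inductive RamProgram : Type
  /-- `reg r := c` -/
  | const (r c : ℕ) : RamProgram
  /-- `reg r := reg a + reg b` -/
  | add (r a b : ℕ) : RamProgram
  /-- `reg r := reg a - reg b`, truncated at zero -/
  | sub (r a b : ℕ) : RamProgram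
  /-- `reg r := mem (reg a)` -/
  | load (r a : ℕ) : RamProgram
  /-- `mem (reg a) := reg r` -/
  | store (a r : ℕ) : RamProgram
  /-- `p` and then `q` -/
  | seq (p q : RamProgram) : RamProgram
  /-- `p` if `reg r` is not zero, and `q` otherwise -/
  | ifPos (r : ℕ) (p q : RamProgram) : RamProgram
  /-- repeat `p` as long as `reg r` is not zero -/
  | whilePos (r : ℕ) (p : RamProgram) : RamProgram

/-- `RamProgram.Runs Q s t s'`: started in the state `s`, the program `Q` halts after exactly `t` steps,
in the state `s'`. Every elementary instruction and every test costs one step. -/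
inductive RamProgram.Runs : RamProgram → RamState → ℕ → RamState → Prop
  | const (r c : ℕ) (s : RamState) :
      Runs (.const r c) s 1 { s with reg := Function.update s.reg r c }
  | add (r a b : ℕ) (s : RamState) :
      Runs (.add r a b) s 1 { s with reg := Function.update s.reg r (s.reg a + s.reg b) }
  | sub (r a b : ℕ) (s : RamState) :
      Runs (.sub r a b) s 1 { s with reg := Function.update s.reg r (s.reg a - s.reg b) }
  | load (r a : ℕ) (s : RamState) :
      Runs (.load r a) s 1 { s with reg := Function.update s.reg r (s.mem (s.reg a)) }
  | store (a r : ℕ) (s : RamState) :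
      Runs (.store a r) s 1 { s with mem := Function.update s.mem (s.reg a) (s.reg r) }
  | seq (p q : RamProgram) (s s₁ s₂ : RamState) (t₁ t₂ : ℕ) :
      Runs p s t₁ s₁ → Runs q s₁ t₂ s₂ → Runs (.seq p q) s (t₁ + t₂) s₂
  | ifTrue (r : ℕ) (p q : RamProgram) (s s₁ : RamState) (t : ℕ) :
      s.reg r ≠ 0 → Runs p s t s₁ → Runs (.ifPos r p q) s (t + 1) s₁
  | ifFalse (r : ℕ) (p q : RamProgram) (s s₁ : RamState) (t : ℕ) :
      s.reg r = 0 → Runs q s t s₁ → Runs (.ifPos r p q) s (t + 1) s₁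
  | whileStop (r : ℕ) (p : RamProgram) (s : RamState) :
      s.reg r = 0 → Runs (.whilePos r p) s 1 s
  | whileStep (r : ℕ) (p : RamProgram) (s s₁ s₂ : RamState) (t₁ t₂ : ℕ) :
      s.reg r ≠ 0 → Runs p s t₁ s₁ → Runs (.whilePos r p) s₁ t₂ s₂ →
        Runs (.whilePos r p) s (t₁ + t₂ + 1) s₂

open Classical in
/-- The initial state for a graph with vertices `0, …, N - 1` and the list `c` of its vertices in the
order of a Hamiltonian cycle. Register `0` holds `N` and the other registers hold `0`. The memory holds
the list, followed by the adjacency matrix row by row, and zeros from there on. -/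
noncomputable def inputState {N : ℕ} (G : SimpleGraph (Fin N)) (c : List (Fin N)) : RamState where
  reg r := if r = 0 then N else 0
  mem x :=
    if x < N then (c.map Fin.val).getD x 0
    else if ∃ a b : Fin N, a.val = (x - N) / N ∧ b.val = (x - N) % N ∧ G.Adj a b then 1 else 0

/-- The memory cell for the entry `(a, b)` of the output, an `N × N` table that follows the input. -/
def outputCell {N : ℕ} (a b : Fin N) : ℕ := N + N * N + (a.val * N + b.val)


/-!
Color the edges of the boundary with two colors that change at crossings only. Around a crossing
with an even number of changes, the corridors whose two sides differ in color form a flow modulo 2.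
The total flow below a side of a corridor is constant along every boundary cycle of the union of the
channels; it is zero on the outer one, and opening the holes one after the other carries the zero to
all of them, as there is no flow across a cut. Hence the two sides of every corridor agree in color.
If moreover no color changes at all, the coloring is constant: on a hole the changes add up to zero,
and the side through which the hole was opened last is the only one that could contribute. Applied
to the orbit of a vertex, this shows that the boundary is a single cycle.

A door is an end of a corridor at a crossing, and its two corners cut the boundary into a pocket
behind the door and the rest. With one color on each of the two parts, the agreement of opposite
sides shows that the channels join the pocket to the rest through the door only. The four doors
around a crossing cut the boundary into four pockets. For an invisible pair `(a, b)` and a direction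
on the boundary, a blocking vertex that `a` sees can only be the last vertex before `b` that `a`
sees. In both directions this is a corner of the same crossing, and its pockets show that it blocks
in exactly one of the two directions.

A program that tries all triples of positions on the cycle, and tests each for a blocking vertex by
the definition, finds blocking vertices in polynomial time in every graph. Uniqueness makes its
output the assignment.
-/

/-- The pseudoline `a` runs below `l` just before the time `t`, where `X i j` is the time at which
the pseudolines `i` and `j` cross. -/
def BelowAt {n : ℕ} {τ : Type*} [LinearOrder τ] (X : Fin n → Fin n → τ) (a l : Fin n) (t : τ) :
    Prop :=
  if a < l then t ≤ X a l else X a l < t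

/-- The combinatorial content of a pseudoline arrangement: the crossing of `i` and `j` takes place
at the time `X i j`, and lines that cross each other are then on the same side of every other
line. -/
structure CrossingTimes {n : ℕ} {τ : Type*} [LinearOrder τ] (S : Fin n → List (Fin n))
    (X : Fin n → Fin n → τ) : Prop where
  symm : ∀ i j, X i j = X j i
  ne : ∀ i j k, i ≠ j → i ≠ k → j ≠ k → X i j ≠ X i k
  mem : ∀ i j, j ∈ S i ↔ j ≠ i
  sorted : ∀ i, (S i).Pairwise fun j k => X i j < X i k
  sameSide : ∀ a b l, a ≠ b → a ≠ l → b ≠ l → (BelowAt X a l (X a b) ↔ BelowAt X b l (X a b))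

theorem IsPseudolineArrangement.exists_real_crossingTimes {n : ℕ} {S : Fin n → List (Fin n)}
    (h : IsPseudolineArrangement S) : ∃ X : Fin n → Fin n → ℝ, CrossingTimes S X := by
  obtain ⟨f, X, -, hsymm, hf, hne, hmem, hsorted⟩ := h
  refine ⟨X, hsymm, hne, hmem, hsorted, fun a b l hab hal hbl => ?_⟩
  have meet : f a (X a b) = f b (X a b) := by
    rcases lt_or_gt_of_ne hab with h | h
    · exact (hf a b h _).2.1 rfl
    · exact ((hf b a h _).2.1 (hsymm a b)).symm
  have belowAt_iff : ∀ c, c ≠ l → X a b ≠ X c l →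
      (BelowAt X c l (X a b) ↔ f c (X a b) < f l (X a b)) := by
    intro c hcl hX
    rcases lt_or_gt_of_ne hcl with h | h
    · obtain ⟨before, -, after⟩ := hf c l h (X a b)
      rw [BelowAt, if_pos h]
      rcases lt_or_gt_of_ne hX with hX | hX
      · exact iff_of_true hX.le (before hX)
      · exact iff_of_false hX.not_ge (after hX).not_gt
    · obtain ⟨before, -, after⟩ := hf l c h (X a b)
      rw [hsymm l c] at before after
      rw [BelowAt, if_neg h.not_gt]
      rcases lt_or_gt_of_ne hX with hX | hX
      · exact iff_of_false hX.not_gt (before hX).not_gt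
      · exact iff_of_true hX (after hX)
  rw [belowAt_iff a hal (hne a b l hab hal hbl),
    belowAt_iff b hbl (hsymm a b ▸ hne b a l hab.symm hbl hal), meet]

theorem strictMonoOn_card_filter_lt {α : Type*} [LinearOrder α] (T : Finset α) :
    StrictMonoOn (fun x => (T.filter (· < x)).card) T := by
  intro x hx y _ hxy
  refine Finset.card_lt_card ((Finset.ssubset_iff_of_subset fun z hz => ?_).2 ⟨x, ?_, ?_⟩)
  · rw [Finset.mem_filter] at hz ⊢
    exact ⟨hz.1, hz.2.trans hxy⟩
  · exact Finset.mem_filter.2 ⟨hx, hxy⟩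
  · simp

theorem CrossingTimes.comp_strictMonoOn {n : ℕ} {σ τ : Type*} [LinearOrder σ] [LinearOrder τ]
    {S : Fin n → List (Fin n)} {X : Fin n → Fin n → σ} (A : CrossingTimes S X) {r : σ → τ}
    {T : Set σ} (hr : StrictMonoOn r T) (hT : ∀ i j, X i j ∈ T) :
    CrossingTimes S fun i j => r (X i j) where
  symm i j := by rw [A.symm]
  ne i j k hij hik hjk := hr.injOn.ne (hT _ _) (hT _ _) (A.ne i j k hij hik hjk)
  mem := A.mem
  sorted i := (A.sorted i).imp fun h => hr (hT _ _) (hT _ _) h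
  sameSide a b l hab hal hbl := by
    simpa only [BelowAt, hr.lt_iff_lt (hT _ _) (hT _ _), hr.le_iff_le (hT _ _) (hT _ _)]
      using A.sameSide a b l hab hal hbl

theorem IsPseudolineArrangement.exists_crossingTimes {n : ℕ} {S : Fin n → List (Fin n)}
    (h : IsPseudolineArrangement S) : ∃ X : Fin n → Fin n → ℕ, CrossingTimes S X := by
  obtain ⟨X, A⟩ := h.exists_real_crossingTimes
  exact ⟨_, A.comp_strictMonoOn
    (strictMonoOn_card_filter_lt (Finset.univ.image fun p : Fin n × Fin n => X p.1 p.2))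
    fun i j => by simp⟩

/-- The corridor of the line `i` just before the time `t`. -/
def corridorAt {n : ℕ} (S : Fin n → List (Fin n)) (X : Fin n → Fin n → ℕ) (i : Fin n) (t : ℕ) : ℕ :=
  (S i).countP fun l => X i l < t

namespace CrossingTimes

variable {n : ℕ} {S : Fin n → List (Fin n)} {X : Fin n → Fin n → ℕ}

theorem nodup (A : CrossingTimes S X) (i : Fin n) : (S i).Nodup :=
  (A.sorted i).imp fun h he => (he ▸ h).ne rfl

theorem length (A : CrossingTimes S X) (i : Fin n) : (S i).length = n - 1 := by
  have : (S i).toFinset = Finset.univ.erase i := by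
    ext j; simp [A.mem]
  rw [← List.toFinset_card_of_nodup (A.nodup i), this,
    Finset.card_erase_of_mem (Finset.mem_univ _), Finset.card_univ, Fintype.card_fin]

theorem corridorAt_getElem (A : CrossingTimes S X) {i j : Fin n} {m : ℕ}
    (h : (S i)[m]? = some j) :
    corridorAt S X i (X i j) = m ∧ corridorAt S X i (X i j + 1) = m + 1 := by
  obtain ⟨hm, hj⟩ := List.getElem?_eq_some_iff.1 h
  have split : S i = (S i).take m ++ j :: (S i).drop (m + 1) := by
    rw [← hj, List.getElem_cons_drop, List.take_append_drop]
  have sorted := A.sorted i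
  rw [split, List.pairwise_append, List.pairwise_cons] at sorted
  obtain ⟨-, ⟨later, -⟩, earlier⟩ := sorted
  have count_take : ∀ t, X i j ≤ t → ((S i).take m).countP (fun l => X i l < t) = m := by
    intro t ht
    have length_take : ((S i).take m).length = m := List.length_take_of_le hm.le
    conv_rhs => rw [← length_take]
    rw [List.countP_eq_length]
    intro a ha
    simpa only [decide_eq_true_eq] using (earlier a ha j List.mem_cons_self).trans_le ht
  have count_drop : ∀ t, t ≤ X i j + 1 →
      ((S i).drop (m + 1)).countP (fun l => X i l < t) = 0 := by
    intro t ht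
    rw [List.countP_eq_zero]
    intro a ha
    have := later a ha
    rw [decide_eq_true_eq]
    omega
  have count (t : ℕ) : corridorAt S X i t = ((S i).take m).countP (fun l => X i l < t) +
      (j :: (S i).drop (m + 1)).countP (fun l => X i l < t) := by
    rw [← List.countP_append, ← split, corridorAt]
  constructor
  · rw [count, List.countP_cons, count_take _ le_rfl, count_drop _ (by omega)]
    simp
  · rw [count, List.countP_cons, count_take _ (by omega), count_drop _ le_rfl]
    simp

theorem getElem_corridorAt (A : CrossingTimes S X) {i j : Fin n} (h : j ≠ i) :
    (S i)[corridorAt S X i (X i j)]? = some j := by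
  obtain ⟨m, hm⟩ := List.mem_iff_getElem?.1 ((A.mem i j).2 h)
  rwa [(A.corridorAt_getElem hm).1]

theorem corridorAt_succ (A : CrossingTimes S X) {i j : Fin n} (h : j ≠ i) :
    corridorAt S X i (X i j + 1) = corridorAt S X i (X i j) + 1 :=
  (A.corridorAt_getElem (A.getElem_corridorAt h)).2

theorem corridorAt_lt (A : CrossingTimes S X) {i j : Fin n} (h : j ≠ i) :
    corridorAt S X i (X i j) + 1 < n := by
  obtain ⟨hm, -⟩ := List.getElem?_eq_some_iff.1 (A.getElem_corridorAt h)
  rw [A.length] at hm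
  omega

theorem corridorAt_succ_of_forall_ne (A : CrossingTimes S X) {i : Fin n} {t : ℕ}
    (h : ∀ l, l ≠ i → X i l ≠ t) : corridorAt S X i (t + 1) = corridorAt S X i t := by
  refine List.countP_congr fun l hl => ?_
  have := h l ((A.mem i l).1 hl)
  simp only [decide_eq_true_eq]
  omega

theorem corridorAt_zero (i : Fin n) : corridorAt S X i 0 = 0 := by simp [corridorAt]

theorem corridorAt_of_forall_lt (A : CrossingTimes S X) {i : Fin n} {t : ℕ}
    (h : ∀ l, X i l < t) : corridorAt S X i t = n - 1 := by
  rw [← A.length i, corridorAt, List.countP_eq_length]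
  simpa only [decide_eq_true_eq] using fun l _ => h l

theorem corridorAt_mono (i : Fin n) : Monotone (corridorAt S X i) := fun s t h =>
  List.countP_mono_left fun l _ hl => by
    simp only [decide_eq_true_eq] at hl ⊢
    omega

theorem belowAt_iff_not_belowAt (A : CrossingTimes S X) {a l : Fin n} (h : a ≠ l) (t : ℕ) :
    BelowAt X a l t ↔ ¬ BelowAt X l a t := by
  unfold BelowAt
  rw [A.symm l a]
  rcases lt_or_gt_of_ne h with h' | h'
  · rw [if_pos h', if_neg h'.not_gt]; omega
  · rw [if_pos h', if_neg h'.not_gt]; omega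

theorem belowAt_succ {a l : Fin n} {t : ℕ} (h : X a l ≠ t) :
    BelowAt X a l (t + 1) ↔ BelowAt X a l t := by
  unfold BelowAt
  split_ifs <;> omega

theorem time_ne (A : CrossingTimes S X) {a b l : Fin n} (hab : a ≠ b) (hla : l ≠ a)
    (hlb : l ≠ b) : X l a ≠ X a b ∧ X l b ≠ X a b := by
  rw [A.symm l a, A.symm l b]
  exact ⟨A.ne a l b hla.symm hab hlb, A.symm a b ▸ A.ne b l a hlb.symm hab.symm hla⟩

section Flow

variable {M : Type*} [AddCommGroup M] {h : Fin n → ℕ → M}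

/-- A flow on the corridors, with the value `h i k` on the corridor `k` of the line `i`, which is
conserved at every crossing. -/
def IsFlow (S : Fin n → List (Fin n)) (X : Fin n → Fin n → ℕ) (h : Fin n → ℕ → M) : Prop :=
  ∀ i j, i ≠ j → h i (corridorAt S X i (X i j) + 1) + h j (corridorAt S X j (X i j) + 1) =
    h i (corridorAt S X i (X i j)) + h j (corridorAt S X j (X i j))

open Classical in
/-- The line that crosses `a` at the time `t`, or `a` itself if there is none. -/
noncomputable def partner (X : Fin n → Fin n → ℕ) (t : ℕ) (a : Fin n) : Fin n :=
  if e : ∃ b, a ≠ b ∧ X a b = t then e.choose else a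

theorem partner_eq (A : CrossingTimes S X) {a b : Fin n} {t : ℕ} (hab : a ≠ b) (hX : X a b = t) :
    partner X t a = b := by
  have e : ∃ b, a ≠ b ∧ X a b = t := ⟨b, hab, hX⟩
  rw [partner, dif_pos e]
  by_contra hne
  exact A.ne a b e.choose hab e.choose_spec.1 (Ne.symm hne) (hX.trans e.choose_spec.2.symm)

theorem partner_cases (A : CrossingTimes S X) (t : ℕ) (a : Fin n) :
    (∃ b, a ≠ b ∧ X a b = t ∧ partner X t a = b ∧ partner X t b = a) ∨
      (∀ b, b ≠ a → X a b ≠ t) ∧ partner X t a = a := by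
  by_cases e : ∃ b, a ≠ b ∧ X a b = t
  · obtain ⟨b, hab, hX⟩ := e
    exact Or.inl ⟨b, hab, hX, A.partner_eq hab hX, A.partner_eq hab.symm (A.symm b a ▸ hX)⟩
  · exact Or.inr ⟨fun b hb hX => e ⟨b, hb.symm, hX⟩, dif_neg e⟩

theorem sum_flow_succ (A : CrossingTimes S X) (hh : IsFlow S X h) (t : ℕ) (B : Finset (Fin n))
    (hB : ∀ a ∈ B, ∀ b, a ≠ b → X a b = t → b ∈ B) :
    ∑ j ∈ B, h j (corridorAt S X j (t + 1)) = ∑ j ∈ B, h j (corridorAt S X j t) := by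
  rw [← sub_eq_zero, ← Finset.sum_sub_distrib]
  have unchanged : ∀ a, (∀ b, b ≠ a → X a b ≠ t) →
      h a (corridorAt S X a (t + 1)) - h a (corridorAt S X a t) = 0 := fun a ha => by
    rw [A.corridorAt_succ_of_forall_ne ha, sub_self]
  refine Finset.sum_involution (fun a _ => partner X t a) ?_ ?_ ?_ ?_
  · intro a _
    rcases A.partner_cases t a with ⟨b, hab, rfl, hb, -⟩ | ⟨ha, ha'⟩
    · have succ_b := A.corridorAt_succ hab
      rw [A.symm b a] at succ_b
      rw [hb, A.corridorAt_succ hab.symm, succ_b, sub_add_sub_comm, hh a b hab, sub_self]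
    · rw [ha', unchanged a ha, add_zero]
  · intro a _ hne
    rcases A.partner_cases t a with ⟨b, hab, -, hb, -⟩ | ⟨ha, -⟩
    · exact hb ▸ hab.symm
    · exact absurd (unchanged a ha) hne
  · intro a ha
    rcases A.partner_cases t a with ⟨b, hab, hX, hb, -⟩ | ⟨-, ha'⟩
    · exact hb ▸ hB a ha b hab hX
    · exact ha'.symm ▸ ha
  · intro a _
    rcases A.partner_cases t a with ⟨b, -, -, hb, ha⟩ | ⟨-, ha⟩
    · rw [hb, ha]
    · rw [ha, ha]

open Classical in
/-- The lines below `i` just before the time `t`. -/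
noncomputable def linesBelow (X : Fin n → Fin n → ℕ) (i : Fin n) (t : ℕ) : Finset (Fin n) :=
  Finset.univ.filter fun j => j ≠ i ∧ BelowAt X j i t

theorem mem_linesBelow {i j : Fin n} {t : ℕ} :
    j ∈ linesBelow X i t ↔ j ≠ i ∧ BelowAt X j i t := by
  simp only [linesBelow, Finset.mem_filter, Finset.mem_univ, true_and]

/-- The total flow below `i` just before the time `t`. -/
noncomputable def flowBelow (S : Fin n → List (Fin n)) (X : Fin n → Fin n → ℕ)
    (h : Fin n → ℕ → M) (i : Fin n) (t : ℕ) : M :=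
  ∑ j ∈ linesBelow X i t, h j (corridorAt S X j t)

theorem mem_linesBelow_of_cross (A : CrossingTimes S X) {i a b : Fin n}
    (ha : a ∈ linesBelow X i (X a b)) (hab : a ≠ b) (hb : b ≠ i) : b ∈ linesBelow X i (X a b) := by
  rw [mem_linesBelow] at ha ⊢
  exact ⟨hb, (A.sameSide a b i hab ha.1 hb).1 ha.2⟩

theorem flowBelow_succ (A : CrossingTimes S X) (hh : IsFlow S X h)
    {i : Fin n} {t : ℕ} (ht : ∀ l, l ≠ i → X i l ≠ t) :
    flowBelow S X h i (t + 1) = flowBelow S X h i t := by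
  have hset : linesBelow X i (t + 1) = linesBelow X i t := by
    ext j
    rw [mem_linesBelow, mem_linesBelow]
    exact and_congr_right fun hj => belowAt_succ (A.symm j i ▸ ht j hj)
  rw [flowBelow, flowBelow, hset]
  refine A.sum_flow_succ hh t _ fun a ha b hab hX => ?_
  subst hX
  refine A.mem_linesBelow_of_cross ha hab ?_
  rintro rfl
  exact ht a hab (A.symm b a)

theorem flowBelow_eq_of_corridorAt_eq (A : CrossingTimes S X) (hh : IsFlow S X h)
    {i : Fin n} {s t : ℕ} (hst : corridorAt S X i s = corridorAt S X i t) :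
    flowBelow S X h i s = flowBelow S X h i t := by
  wlog hle : s ≤ t generalizing s t
  · exact (this hst.symm (le_of_not_ge hle)).symm
  induction t, hle using Nat.le_induction with
  | base => rfl
  | succ m hm ih =>
    have before := corridorAt_mono (S := S) (X := X) i hm
    have after := corridorAt_mono (S := S) (X := X) i m.le_succ
    rw [Nat.succ_eq_add_one] at after
    rw [ih (by omega)]
    refine (A.flowBelow_succ hh fun l hl hX => ?_).symm
    have := A.corridorAt_succ hl
    rw [hX] at this
    omega

theorem linesBelow_snd (A : CrossingTimes S X) {a b : Fin n} (hab : a < b) :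
    linesBelow X b (X a b) = insert a (linesBelow X a (X a b)) := by
  ext l
  rw [Finset.mem_insert, mem_linesBelow, mem_linesBelow]
  by_cases hla : l = a
  · subst hla; simp [BelowAt, hab, hab.ne]
  by_cases hlb : l = b
  · subst hlb; simp [BelowAt, hab.not_gt, hab.ne', A.symm l a]
  · rw [A.belowAt_iff_not_belowAt hlb, A.belowAt_iff_not_belowAt hla,
      A.sameSide a b l hab.ne (Ne.symm hla) (Ne.symm hlb)]
    simp only [ne_eq, hla, hlb, not_false_eq_true, true_and, false_or]

theorem linesBelow_snd_succ (A : CrossingTimes S X) {a b : Fin n} (hab : a < b) :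
    linesBelow X b (X a b + 1) = linesBelow X a (X a b) := by
  ext l
  rw [mem_linesBelow, mem_linesBelow]
  by_cases hla : l = a
  · subst hla; simp [BelowAt, hab]
  by_cases hlb : l = b
  · subst hlb; simp [BelowAt, hab.not_gt, A.symm l a]
  · rw [belowAt_succ (A.time_ne hab.ne hla hlb).2, A.belowAt_iff_not_belowAt hlb,
      A.belowAt_iff_not_belowAt hla, A.sameSide a b l hab.ne (Ne.symm hla) (Ne.symm hlb)]
    simp only [ne_eq, hla, hlb, not_false_eq_true, true_and]

theorem linesBelow_fst_succ (A : CrossingTimes S X) {a b : Fin n} (hab : a < b) :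
    linesBelow X a (X a b + 1) = insert b (linesBelow X a (X a b)) := by
  ext l
  rw [Finset.mem_insert, mem_linesBelow, mem_linesBelow]
  by_cases hla : l = a
  · subst hla; simp [hab.ne]
  by_cases hlb : l = b
  · subst hlb; simp [BelowAt, hab.not_gt, hab.ne', A.symm l a]
  · rw [belowAt_succ (A.time_ne hab.ne hla hlb).1]
    simp only [ne_eq, hla, hlb, not_false_eq_true, true_and, false_or]

theorem snd_notMem_linesBelow_fst (A : CrossingTimes S X) {a b : Fin n} (hab : a < b) :
    b ∉ linesBelow X a (X a b) := by
  rw [mem_linesBelow, BelowAt, if_neg hab.not_gt, A.symm b a]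
  exact fun h => lt_irrefl _ h.2

theorem flowBelow_snd (A : CrossingTimes S X) (h : Fin n → ℕ → M) {a b : Fin n} (hab : a < b) :
    flowBelow S X h b (X a b) = flowBelow S X h a (X a b) + h a (corridorAt S X a (X a b)) := by
  classical
  rw [flowBelow, flowBelow, A.linesBelow_snd hab,
    Finset.sum_insert fun ha => (mem_linesBelow.1 ha).1 rfl, add_comm]

theorem flowBelow_fst_succ (A : CrossingTimes S X) (h : Fin n → ℕ → M) {a b : Fin n}
    (hab : a < b) :
    flowBelow S X h a (X a b + 1) =
      flowBelow S X h b (X a b + 1) + h b (corridorAt S X b (X a b) + 1) := by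
  classical
  have succ_b := A.corridorAt_succ hab.ne
  rw [A.symm b a] at succ_b
  rw [flowBelow, flowBelow, A.linesBelow_snd_succ hab, A.linesBelow_fst_succ hab,
    Finset.sum_insert (A.snd_notMem_linesBelow_fst hab), succ_b, add_comm]

theorem flowBelow_snd_succ (A : CrossingTimes S X) (hh : IsFlow S X h) {a b : Fin n}
    (hab : a < b) : flowBelow S X h b (X a b + 1) = flowBelow S X h a (X a b) := by
  rw [flowBelow, flowBelow, A.linesBelow_snd_succ hab]
  refine A.sum_flow_succ hh _ _ fun c hc d hcd hX => ?_
  have hca : c ≠ a := (mem_linesBelow.1 hc).1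
  have hcb : c ≠ b := fun h => A.snd_notMem_linesBelow_fst hab (h ▸ hc)
  rw [← hX] at hc ⊢
  refine A.mem_linesBelow_of_cross hc hcd ?_
  rintro rfl
  exact (A.time_ne hab.ne hca hcb).1 hX

end Flow

end CrossingTimes

/-! ## Sides of the corridors -/

/-- The left (`r = false`) or right (`r = true`) end of the side `(i, k, u)`. -/
def sidePoint {n : ℕ} (S : Fin n → List (Fin n)) (i : Fin n) (k : ℕ) (u r : Bool) : Point n :=
  if r then
    match (S i)[k]? with
    | none => .rightEnd i
    | some j => crossPoint i u j (decide (j < i))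
  else
    match k with
    | 0 => .leftEnd i
    | m + 1 =>
      match (S i)[m]? with
      | none => .leftEnd i
      | some j => crossPoint i u j (decide (i < j))

theorem leftPoint_eq {n : ℕ} (S : Fin n → List (Fin n)) (i k : Fin n) (u : Bool) :
    leftPoint S i k u = sidePoint S i k u false := by
  obtain ⟨_ | _, _⟩ := k
  · rfl
  · rfl

theorem rightPoint_eq {n : ℕ} (S : Fin n → List (Fin n)) (i k : Fin n) (u : Bool) :
    rightPoint S i k u = sidePoint S i k u true := rfl

theorem isEndOf_iff {n : ℕ} (S : Fin n → List (Fin n)) (x : Point n) (s : Side n) :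
    IsEndOf S x s ↔ ∃ r, x = sidePoint S s.1 s.2.1 s.2.2 r := by
  rw [IsEndOf, leftPoint_eq, rightPoint_eq, Bool.exists_bool]

namespace CrossingTimes

variable {n : ℕ} {S : Fin n → List (Fin n)} {X : Fin n → Fin n → ℕ}

theorem sidePoint_fst (A : CrossingTimes S X) {a b : Fin n} (hab : a < b) (p q : Bool) :
    sidePoint S a (corridorAt S X a (X a b) + q.toNat) p (!q) = .cross a p b q := by
  have h := A.getElem_corridorAt hab.ne'
  cases q <;> simp [sidePoint, h, crossPoint, hab, hab.not_gt]

theorem sidePoint_snd (A : CrossingTimes S X) {a b : Fin n} (hab : a < b) (p q : Bool) :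
    sidePoint S b (corridorAt S X b (X a b) + (!p).toNat) q p = .cross a p b q := by
  have h := A.getElem_corridorAt hab.ne
  rw [A.symm] at h
  cases p <;> simp [sidePoint, h, crossPoint, hab, hab.not_gt]

theorem corridorAt_fst_lt (A : CrossingTimes S X) {a b : Fin n} (hab : a < b) (q : Bool) :
    corridorAt S X a (X a b) + q.toNat < n := by
  have := A.corridorAt_lt hab.ne'
  cases q <;> simp <;> omega

theorem corridorAt_snd_lt (A : CrossingTimes S X) {a b : Fin n} (hab : a < b) (p : Bool) :
    corridorAt S X b (X a b) + (!p).toNat < n := by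
  have := A.corridorAt_lt hab.ne
  rw [A.symm] at this
  cases p <;> simp <;> omega

theorem sidePoint_false_cases (A : CrossingTimes S X) {i : Fin n} {k : ℕ} (hk : k < n)
    (u : Bool) :
    (k = 0 ∧ sidePoint S i k u false = .leftEnd i) ∨
      ∃ j, j ≠ i ∧ k = corridorAt S X i (X i j) + 1 ∧
        sidePoint S i k u false = crossPoint i u j (decide (i < j)) := by
  rcases k with _ | m
  · exact Or.inl ⟨rfl, rfl⟩
  · have hm : m < (S i).length := by rw [A.length]; omega
    have hj : (S i)[m]? = some (S i)[m] := List.getElem?_eq_getElem hm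
    exact Or.inr ⟨(S i)[m], (A.mem i _).1 (List.getElem_mem hm),
      by rw [(A.corridorAt_getElem hj).1], by simp [sidePoint, hj]⟩

theorem sidePoint_true_cases (A : CrossingTimes S X) {i : Fin n} {k : ℕ} (hk : k < n)
    (u : Bool) :
    (k = n - 1 ∧ sidePoint S i k u true = .rightEnd i) ∨
      ∃ j, j ≠ i ∧ k = corridorAt S X i (X i j) ∧
        sidePoint S i k u true = crossPoint i u j (decide (j < i)) := by
  have length_eq := A.length i
  rcases hj : (S i)[k]? with _ | j
  · have := List.getElem?_eq_none_iff.1 hj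
    exact Or.inl ⟨by omega, by simp [sidePoint, hj]⟩
  · exact Or.inr ⟨j, (A.mem i j).1 (List.mem_of_getElem? hj), (A.corridorAt_getElem hj).1.symm,
      by simp [sidePoint, hj]⟩

theorem sidePoint_cases (A : CrossingTimes S X) {i : Fin n} {k : ℕ} (hk : k < n) (u r : Bool) :
    (r = false ∧ k = 0 ∧ sidePoint S i k u r = .leftEnd i) ∨
    (r = true ∧ k = n - 1 ∧ sidePoint S i k u r = .rightEnd i) ∨
    (∃ b q, i < b ∧ r = !q ∧ k = corridorAt S X i (X i b) + q.toNat ∧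
      sidePoint S i k u r = .cross i u b q) ∨
    (∃ a p, a < i ∧ r = p ∧ k = corridorAt S X i (X a i) + (!p).toNat ∧
      sidePoint S i k u r = .cross a p i u) := by
  cases r with
  | false =>
    rcases A.sidePoint_false_cases (i := i) hk u with ⟨rfl, h⟩ | ⟨j, hj, hk, h⟩
    · exact Or.inl ⟨rfl, rfl, h⟩
    rcases lt_or_gt_of_ne hj with hji | hij
    · exact Or.inr (Or.inr (Or.inr ⟨j, false, hji, rfl, by rw [A.symm j i, hk]; rfl,
        by simp [h, crossPoint, hji.not_gt]⟩))
    · exact Or.inr (Or.inr (Or.inl ⟨j, true, hij, rfl, hk, by simp [h, crossPoint, hij]⟩))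
  | true =>
    rcases A.sidePoint_true_cases (i := i) hk u with ⟨rfl, h⟩ | ⟨j, hj, hk, h⟩
    · exact Or.inr (Or.inl ⟨rfl, rfl, h⟩)
    rcases lt_or_gt_of_ne hj with hji | hij
    · exact Or.inr (Or.inr (Or.inr ⟨j, true, hji, rfl, by rw [A.symm j i, hk]; rfl,
        by simp [h, crossPoint, hji, hji.not_gt]⟩))
    · exact Or.inr (Or.inr (Or.inl ⟨j, false, hij, rfl, hk,
        by simp [h, crossPoint, hij, hij.not_gt]⟩))

theorem sidePoint_eq_leftEnd (A : CrossingTimes S X) {i a : Fin n} {k : ℕ} (hk : k < n)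
    {u r : Bool} (h : sidePoint S i k u r = .leftEnd a) : i = a ∧ k = 0 ∧ r = false := by
  rcases A.sidePoint_cases (i := i) hk u r with
    ⟨hr, h0, h'⟩ | ⟨-, -, h'⟩ | ⟨b, q, -, -, -, h'⟩ | ⟨a, p, -, -, -, h'⟩
  · exact ⟨Point.leftEnd.inj (h'.symm.trans h), h0, hr⟩
  all_goals cases h'.symm.trans h

theorem sidePoint_eq_rightEnd (A : CrossingTimes S X) {i a : Fin n} {k : ℕ} (hk : k < n)
    {u r : Bool} (h : sidePoint S i k u r = .rightEnd a) : i = a ∧ k = n - 1 ∧ r = true := by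
  rcases A.sidePoint_cases (i := i) hk u r with
    ⟨-, -, h'⟩ | ⟨hr, hn, h'⟩ | ⟨b, q, -, -, -, h'⟩ | ⟨a, p, -, -, -, h'⟩
  case inr.inl => exact ⟨Point.rightEnd.inj (h'.symm.trans h), hn, hr⟩
  all_goals cases h'.symm.trans h

theorem sidePoint_eq_cross (A : CrossingTimes S X) {i a b : Fin n} {k : ℕ} (hk : k < n)
    {u r p q : Bool} (h : sidePoint S i k u r = .cross a p b q) : a < b ∧
      ((i = a ∧ u = p ∧ r = (!q) ∧ k = corridorAt S X a (X a b) + q.toNat) ∨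
        (i = b ∧ u = q ∧ r = p ∧ k = corridorAt S X b (X a b) + (!p).toNat)) := by
  rcases A.sidePoint_cases (i := i) hk u r with
    ⟨-, -, h'⟩ | ⟨-, -, h'⟩ | ⟨b', q', hib, hr, hk', h'⟩ | ⟨a', p', hai, hr, hk', h'⟩
  · cases h'.symm.trans h
  · cases h'.symm.trans h
  · obtain ⟨rfl, rfl, rfl, rfl⟩ := Point.cross.inj (h'.symm.trans h)
    exact ⟨hib, Or.inl ⟨rfl, rfl, hr, hk'⟩⟩
  · obtain ⟨rfl, rfl, rfl, rfl⟩ := Point.cross.inj (h'.symm.trans h)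
    exact ⟨hai, Or.inr ⟨rfl, rfl, hr, hk'⟩⟩

/-- On the oriented boundary, a side begins at its end `r` if `u = r` and ends there otherwise. -/
theorem sidePoint_inj (A : CrossingTimes S X) {i j : Fin n} {k l : ℕ} (hk : k < n) (hl : l < n)
    {u r v s : Bool} (h : sidePoint S i k u r = sidePoint S j l v s) (hd : (u == r) = (v == s)) :
    i = j ∧ k = l ∧ u = v ∧ r = s := by
  rcases A.sidePoint_cases (i := i) hk u r with
    ⟨rfl, h0, h'⟩ | ⟨rfl, hn, h'⟩ | ⟨b, q, -, rfl, hk', h'⟩ | ⟨a, p, -, rfl, hk', h'⟩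
  · obtain ⟨rfl, h0', rfl⟩ := A.sidePoint_eq_leftEnd hl (h.symm.trans h')
    exact ⟨rfl, h0.trans h0'.symm, by simpa using hd, rfl⟩
  · obtain ⟨rfl, hn', rfl⟩ := A.sidePoint_eq_rightEnd hl (h.symm.trans h')
    exact ⟨rfl, hn.trans hn'.symm, by simpa using hd, rfl⟩
  · obtain ⟨-, ⟨rfl, rfl, rfl, hl'⟩ | ⟨rfl, rfl, rfl, -⟩⟩ :=
      A.sidePoint_eq_cross hl (h.symm.trans h')
    · exact ⟨rfl, hk'.trans hl'.symm, rfl, rfl⟩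
    · cases s <;> cases v <;> cases hd
  · obtain ⟨-, ⟨rfl, rfl, rfl, -⟩ | ⟨rfl, rfl, rfl, hl'⟩⟩ :=
      A.sidePoint_eq_cross hl (h.symm.trans h')
    · cases u <;> cases v <;> cases hd
    · exact ⟨rfl, hk'.trans hl'.symm, rfl, rfl⟩

theorem exists_sidePoint_eq (A : CrossingTimes S X) {i : Fin n} {k : ℕ} (hk : k < n)
    (u r : Bool) :
    ∃ j l v s, l < n ∧ sidePoint S j l v s = sidePoint S i k u r ∧ (v == s) = !(u == r) := by
  rcases A.sidePoint_cases (i := i) hk u r with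
    ⟨rfl, rfl, -⟩ | ⟨rfl, rfl, -⟩ | ⟨b, q, hib, rfl, -, h⟩ | ⟨a, p, hai, rfl, -, h⟩
  · exact ⟨i, 0, !u, false, hk, rfl, by cases u <;> rfl⟩
  · have : (S i)[n - 1]? = none := List.getElem?_eq_none_iff.2 (A.length i).le
    exact ⟨i, n - 1, !u, true, hk, by simp [sidePoint, this], by cases u <;> rfl⟩
  · exact ⟨b, _, q, u, A.corridorAt_snd_lt hib u, (A.sidePoint_snd hib u q).trans h.symm,
      by cases u <;> cases q <;> rfl⟩
  · exact ⟨a, _, r, !u, A.corridorAt_fst_lt hai u, (A.sidePoint_fst hai r u).trans h.symm,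
      by cases u <;> cases r <;> rfl⟩

theorem exists_corridorAt_eq (A : CrossingTimes S X) (i : Fin n) {k : ℕ} (hk : k < n) :
    ∃ t, corridorAt S X i t = k := by
  cases k with
  | zero => exact ⟨0, corridorAt_zero i⟩
  | succ m =>
    have hm : m < (S i).length := by rw [A.length]; omega
    exact ⟨_, (A.corridorAt_getElem (List.getElem?_eq_getElem hm)).2⟩

theorem exists_forall_corridorAt_eq (A : CrossingTimes S X) :
    ∃ t, ∀ i, corridorAt S X i t = n - 1 := by
  refine ⟨(Finset.univ.sup fun p : Fin n × Fin n => X p.1 p.2) + 1, fun i =>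
    A.corridorAt_of_forall_lt fun l => Nat.lt_succ_of_le ?_⟩
  exact Finset.le_sup (f := fun p : Fin n × Fin n => X p.1 p.2) (Finset.mem_univ (i, l))

section Potential

variable {M : Type*} [AddCommGroup M] {h : Fin n → ℕ → M}

/-- The potential of a flow on the side `(i, k, u)`: the total flow below the side. -/
noncomputable def sidePotential (A : CrossingTimes S X) (h : Fin n → ℕ → M) (s : Side n) : M :=
  flowBelow S X h s.1 (A.exists_corridorAt_eq s.1 s.2.1.2).choose +
    if s.2.2 then h s.1 s.2.1 else 0

theorem sidePotential_eq (A : CrossingTimes S X) (hh : IsFlow S X h) {i k : Fin n} (u : Bool)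
    {t : ℕ} (ht : corridorAt S X i t = k) :
    A.sidePotential h (i, k, u) = flowBelow S X h i t + if u then h i k else 0 := by
  have := (A.exists_corridorAt_eq i k.2).choose_spec
  rw [sidePotential, A.flowBelow_eq_of_corridorAt_eq hh (this.trans ht.symm)]

theorem sidePotential_true (A : CrossingTimes S X) (h : Fin n → ℕ → M) (i k : Fin n) :
    A.sidePotential h (i, k, true) = A.sidePotential h (i, k, false) + h i k := by
  simp [sidePotential]

theorem sidePotential_cross (A : CrossingTimes S X) (hh : IsFlow S X h) {a b k l : Fin n}
    (hab : a < b) (p q : Bool) (hk : (k : ℕ) = corridorAt S X a (X a b) + q.toNat)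
    (hl : (l : ℕ) = corridorAt S X b (X a b) + (!p).toNat) :
    A.sidePotential h (a, k, p) = A.sidePotential h (b, l, q) := by
  have succ_a := A.corridorAt_succ hab.ne'
  have succ_b := A.corridorAt_succ hab.ne
  rw [A.symm b a] at succ_b
  rw [A.sidePotential_eq hh p (t := X a b + q.toNat) (by cases q <;> simp [hk, succ_a]),
    A.sidePotential_eq hh q (t := X a b + (!p).toNat) (by cases p <;> simp [hl, succ_b]), hk, hl]
  have snd := A.flowBelow_snd h hab
  have fst_succ := A.flowBelow_fst_succ h hab
  have snd_succ := A.flowBelow_snd_succ hh hab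
  cases p <;> cases q <;> simp only [Bool.toNat_true, Bool.toNat_false, add_zero, Bool.not_true,
    Bool.not_false, if_true, if_false, Bool.false_eq_true]
  · exact snd_succ.symm
  · exact fst_succ
  · exact snd.symm
  · rw [fst_succ, snd_succ, snd, add_assoc, add_assoc, add_comm (h b _), hh a b hab.ne]

theorem sidePotential_eq_zero_of_end (A : CrossingTimes S X) (hh : IsFlow S X h)
    (first : ∀ i, h i 0 = 0) (last : ∀ i, h i (n - 1) = 0) {s : Side n} {i : Fin n}
    (hs : IsEndOf S (.leftEnd i) s ∨ IsEndOf S (.rightEnd i) s) : A.sidePotential h s = 0 := by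
  obtain ⟨j, k, u⟩ := s
  rw [isEndOf_iff, isEndOf_iff] at hs
  rcases hs with ⟨r, hr⟩ | ⟨r, hr⟩
  · obtain ⟨rfl, hk, rfl⟩ := A.sidePoint_eq_leftEnd k.2 hr.symm
    rw [A.sidePotential_eq hh u (t := 0) (by rw [corridorAt_zero, hk]), hk, first]
    simp [flowBelow, corridorAt_zero, first]
  · obtain ⟨rfl, hk, rfl⟩ := A.sidePoint_eq_rightEnd k.2 hr.symm
    obtain ⟨t, ht⟩ := A.exists_forall_corridorAt_eq
    rw [A.sidePotential_eq hh u (t := t) (by rw [ht, hk]), hk, last]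
    simp [flowBelow, ht, last]

theorem sidePotential_eq_of_common_end (A : CrossingTimes S X) (hh : IsFlow S X h)
    (first : ∀ i, h i 0 = 0) (last : ∀ i, h i (n - 1) = 0) {s t : Side n} {x : Point n}
    (hs : IsEndOf S x s) (ht : IsEndOf S x t) : A.sidePotential h s = A.sidePotential h t := by
  obtain ⟨i, k, u⟩ := s
  obtain ⟨j, l, v⟩ := t
  obtain ⟨r, hr⟩ := (isEndOf_iff S x _).1 hs
  obtain ⟨r', hr'⟩ := (isEndOf_iff S x _).1 ht
  dsimp only at hr hr'
  rcases A.sidePoint_cases (i := i) k.2 u r with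
    ⟨-, -, h'⟩ | ⟨-, -, h'⟩ | ⟨b, q, hib, -, hk, h'⟩ | ⟨a, p, hai, -, hk, h'⟩
  · rw [hr, h'] at hs ht
    rw [A.sidePotential_eq_zero_of_end hh first last (Or.inl hs),
      A.sidePotential_eq_zero_of_end hh first last (Or.inl ht)]
  · rw [hr, h'] at hs ht
    rw [A.sidePotential_eq_zero_of_end hh first last (Or.inr hs),
      A.sidePotential_eq_zero_of_end hh first last (Or.inr ht)]
  · obtain ⟨-, ⟨rfl, rfl, -, hl⟩ | ⟨rfl, rfl, -, hl⟩⟩ :=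
      A.sidePoint_eq_cross l.2 (hr'.symm.trans (hr.trans h'))
    · rw [Fin.ext (hk.trans hl.symm)]
    · exact A.sidePotential_cross hh hib _ _ hk hl
  · obtain ⟨-, ⟨rfl, rfl, -, hl⟩ | ⟨rfl, rfl, -, hl⟩⟩ :=
      A.sidePoint_eq_cross l.2 (hr'.symm.trans (hr.trans h'))
    · exact (A.sidePotential_cross hh hai _ _ hl hk).symm
    · rw [Fin.ext (hk.trans hl.symm)]

theorem sidePotential_eq_of_sameBoundary (A : CrossingTimes S X) (hh : IsFlow S X h)
    (first : ∀ i, h i 0 = 0) (last : ∀ i, h i (n - 1) = 0) {s t : Side n}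
    (hst : SameBoundary S s t) : A.sidePotential h s = A.sidePotential h t := by
  induction hst with
  | refl => rfl
  | tail _ common_end ih =>
    obtain ⟨x, hx, hx'⟩ := common_end
    exact ih.trans (A.sidePotential_eq_of_common_end hh first last hx hx')

theorem sidePotential_eq_zero (A : CrossingTimes S X) (hh : IsFlow S X h)
    (first : ∀ i, h i 0 = 0) (last : ∀ i, h i (n - 1) = 0)
    {l : List (Fin n × Fin n)} {O : Set (Side n)} (hO : CutsReach S l O)
    (hl : ∀ i k : Fin n, (i, k) ∈ l → h i k = 0) : ∀ s ∈ O, A.sidePotential h s = 0 := by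
  induction hO with
  | start =>
    intro s hs
    simp only [Set.mem_ofPred_eq, OnHole, not_forall] at hs
    obtain ⟨t, hst, i, hi⟩ := hs
    rw [A.sidePotential_eq_of_sameBoundary hh first last hst]
    exact A.sidePotential_eq_zero_of_end hh first last (i := i) (not_and_or.1 hi |>.imp
      not_not.1 not_not.1)
  | step l O i k u _ hu _ ih =>
    have ih := ih fun i k h => hl i k (List.mem_cons_of_mem _ h)
    rintro s (hs | hs)
    · exact ih s hs
    · have := A.sidePotential_true h i k
      rw [hl i k List.mem_cons_self, add_zero] at this
      rw [← A.sidePotential_eq_of_sameBoundary hh first last hs]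
      cases u
      · exact this.trans (ih _ hu)
      · exact this.symm.trans (ih _ hu)

theorem flow_eq_zero (A : CrossingTimes S X) (hh : IsFlow S X h)
    (first : ∀ i, h i 0 = 0) (last : ∀ i, h i (n - 1) = 0) {K : Cuts n} (hK : K.OpenAllHoles S)
    (hl : ∀ i k : Fin n, (i, k) ∈ K.corridors → h i k = 0) (i k : Fin n) : h i k = 0 := by
  have potential_eq_zero := A.sidePotential_eq_zero hh first last hK hl
  simpa only [potential_eq_zero _ (Set.mem_univ _), zero_add] using
    (A.sidePotential_true h i k).symm

end Potential

end CrossingTimes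

/-! ## Successive vertices on the boundary -/

theorem pair_infix_pair {α : Type*} {x y a b : α} : [x, y] <:+: [a, b] ↔ x = a ∧ y = b := by
  simp [List.infix_cons_iff]

theorem pair_infix_triple {α : Type*} {x y a b c : α} :
    [x, y] <:+: [a, b, c] ↔ (x = a ∧ y = b) ∨ (x = b ∧ y = c) := by
  simp [List.infix_cons_iff]

section Steps

variable {n : ℕ} (S : Fin n → List (Fin n)) (K : Cuts n)

open Classical in
/-- The part of the side `(i, k, u)` on the left (`r = false`) or on the right (`r = true`) of the
cut; the whole side if there is no cut. -/
noncomputable def sidePart (i k : Fin n) (u r : Bool) : List (Point n) :=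
  if (i, k) ∈ K.corridors then (if r then rightPart S K i k u else leftPart S K i k u)
  else wholeSide S i k u

theorem mem_sideParts_iff {i k : Fin n} {u : Bool} {L : List (Point n)} :
    L ∈ sideParts S K i k u ↔ ∃ r, L = sidePart S K i k u r := by
  unfold sideParts sidePart
  split_ifs <;> simp

/-- The additional point of the side `(i, k, u)` exists and belongs to its part `r`. -/
def HasMid (i k : Fin n) (u r : Bool) : Prop :=
  OnHole S (i, k, u) ∧ ((i, k) ∈ K.corridors → K.rightOfMid i k u = !r)

open Classical in
/-- The left (`e = false`) or right (`e = true`) end of the part `r` of the side `(i, k, u)`. -/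
noncomputable def partEnd (i k : Fin n) (u r e : Bool) : Point n :=
  if (i, k) ∈ K.corridors ∧ r ≠ e then .cut i k u r else sidePoint S i k u e

/-- `y` follows `x` on the part `r` of the side `(i, k, u)`, which the boundary of the simple
polygon runs through from its end `u` to its end `!u`. -/
def PartStep (i k : Fin n) (u r : Bool) (x y : Point n) : Prop :=
  (HasMid S K i k u r ∧ x = partEnd S K i k u r u ∧ y = .mid i k u) ∨
    (HasMid S K i k u r ∧ x = .mid i k u ∧ y = partEnd S K i k u r (!u)) ∨
      (¬ HasMid S K i k u r ∧ x = partEnd S K i k u r u ∧ y = partEnd S K i k u r (!u))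

variable {S K}

open Classical in
theorem sidePart_eq (i k : Fin n) (u r : Bool) :
    sidePart S K i k u r = partEnd S K i k u r false ::
      ((if HasMid S K i k u r then [.mid i k u] else []) ++ [partEnd S K i k u r true]) := by
  unfold sidePart partEnd HasMid
  by_cases h : (i, k) ∈ K.corridors
  · cases r <;> simp [h, leftPart, rightPart, leftPoint_eq, rightPoint_eq]
  · simp [h, wholeSide, leftPoint_eq, rightPoint_eq]

theorem mem_sidePart_iff {i k : Fin n} {u r : Bool} {x : Point n} :
    x ∈ sidePart S K i k u r ↔
      (HasMid S K i k u r ∧ x = .mid i k u) ∨ ∃ e, x = partEnd S K i k u r e := by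
  classical
  rw [sidePart_eq, Bool.exists_bool]
  by_cases h : HasMid S K i k u r
  · simp only [h, if_true, List.mem_cons, List.mem_append, List.not_mem_nil, or_false, true_and]
    tauto
  · simp only [h, if_false, List.mem_cons, List.nil_append, List.not_mem_nil, or_false, false_and,
      false_or]

theorem infix_sidePart_lower_iff {i k : Fin n} {r : Bool} {x y : Point n} :
    [x, y] <:+: sidePart S K i k false r ↔ PartStep S K i k false r x y := by
  rw [sidePart_eq, PartStep, Bool.not_false]
  by_cases h : HasMid S K i k false r
  · simp only [h, if_true, List.cons_append, List.nil_append, pair_infix_triple, true_and,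
      not_true_eq_false, false_and, or_false]
  · simp only [h, if_false, List.nil_append, pair_infix_pair, false_and, false_or,
      not_false_eq_true, true_and]

theorem infix_sidePart_upper_iff {i k : Fin n} {r : Bool} {x y : Point n} :
    [y, x] <:+: sidePart S K i k true r ↔ PartStep S K i k true r x y := by
  rw [sidePart_eq, PartStep, Bool.not_true]
  by_cases h : HasMid S K i k true r
  · simp only [h, if_true, List.cons_append, List.nil_append, pair_infix_triple, true_and,
      not_true_eq_false, false_and, or_false]
    tauto
  · simp only [h, if_false, List.nil_append, pair_infix_pair, false_and, false_or,
      not_false_eq_true, true_and]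
    exact and_comm

theorem PartStep.boundaryStep {i k : Fin n} {u r : Bool} {x y : Point n}
    (h : PartStep S K i k u r x y) : BoundaryStep S K x y := by
  have mem : sidePart S K i k u r ∈ sideParts S K i k u := (mem_sideParts_iff S K).2 ⟨r, rfl⟩
  cases u
  · exact .lower i k _ x y mem (infix_sidePart_lower_iff.2 h)
  · exact .upper i k _ x y mem (infix_sidePart_upper_iff.2 h)

theorem boundaryStep_cut {i k : Fin n} (h : (i, k) ∈ K.corridors) (r : Bool) :
    BoundaryStep S K (.cut i k r r) (.cut i k (!r) r) := by
  cases r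
  · exact .cutLeft i k h
  · exact .cutRight i k h

theorem BoundaryStep.cases {x y : Point n} (h : BoundaryStep S K x y) :
    (∃ i k u r, PartStep S K i k u r x y) ∨
      ∃ i k r, (i, k) ∈ K.corridors ∧ x = .cut i k r r ∧ y = .cut i k (!r) r := by
  cases h with
  | lower i k L _ _ hL hxy =>
    obtain ⟨r, rfl⟩ := (mem_sideParts_iff S K).1 hL
    exact Or.inl ⟨i, k, false, r, infix_sidePart_lower_iff.1 hxy⟩
  | upper i k L _ _ hL hxy =>
    obtain ⟨r, rfl⟩ := (mem_sideParts_iff S K).1 hL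
    exact Or.inl ⟨i, k, true, r, infix_sidePart_upper_iff.1 hxy⟩
  | cutLeft i k h => exact Or.inr ⟨i, k, false, h, rfl, rfl⟩
  | cutRight i k h => exact Or.inr ⟨i, k, true, h, rfl, rfl⟩

/-- `x` is a vertex of the simple polygon. -/
def IsVertex (S : Fin n → List (Fin n)) (K : Cuts n) (x : Point n) : Prop :=
  ∃ i k u, ∃ L ∈ sideParts S K i k u, x ∈ L

theorem isVertex_iff {x : Point n} :
    IsVertex S K x ↔ ∃ i k u r, x ∈ sidePart S K i k u r := by
  simp only [IsVertex, mem_sideParts_iff]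
  constructor
  · rintro ⟨i, k, u, L, ⟨r, rfl⟩, hx⟩
    exact ⟨i, k, u, r, hx⟩
  · rintro ⟨i, k, u, r, hx⟩
    exact ⟨i, k, u, _, ⟨r, rfl⟩, hx⟩

theorem partEnd_mem (i k : Fin n) (u r e : Bool) :
    partEnd S K i k u r e ∈ sidePart S K i k u r :=
  mem_sidePart_iff.2 (Or.inr ⟨e, rfl⟩)

theorem mid_mem {i k : Fin n} {u r : Bool} (h : HasMid S K i k u r) :
    .mid i k u ∈ sidePart S K i k u r :=
  mem_sidePart_iff.2 (Or.inl ⟨h, rfl⟩)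

theorem cut_mem {i k : Fin n} (h : (i, k) ∈ K.corridors) (u r : Bool) :
    .cut i k u r ∈ sidePart S K i k u r := by
  simpa [partEnd, h] using partEnd_mem (S := S) (K := K) i k u r (!r)

theorem PartStep.mem {i k : Fin n} {u r : Bool} {x y : Point n} (h : PartStep S K i k u r x y) :
    x ∈ sidePart S K i k u r ∧ y ∈ sidePart S K i k u r := by
  rcases h with ⟨h, rfl, rfl⟩ | ⟨h, rfl, rfl⟩ | ⟨-, rfl, rfl⟩
  · exact ⟨partEnd_mem i k u r _, mid_mem h⟩
  · exact ⟨mid_mem h, partEnd_mem i k u r _⟩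
  · exact ⟨partEnd_mem i k u r _, partEnd_mem i k u r _⟩

theorem BoundaryStep.isVertex {x y : Point n} (h : BoundaryStep S K x y) :
    IsVertex S K x ∧ IsVertex S K y := by
  rcases h.cases with ⟨i, k, u, r, hr⟩ | ⟨i, k, r, hc, rfl, rfl⟩
  · exact ⟨isVertex_iff.2 ⟨i, k, u, r, hr.mem.1⟩, isVertex_iff.2 ⟨i, k, u, r, hr.mem.2⟩⟩
  · exact ⟨isVertex_iff.2 ⟨i, k, r, r, cut_mem hc _ _⟩,
      isVertex_iff.2 ⟨i, k, !r, r, cut_mem hc _ _⟩⟩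

theorem exists_partStep_of_start (i k : Fin n) (u r : Bool) :
    ∃ y, PartStep S K i k u r (partEnd S K i k u r u) y := by
  by_cases h : HasMid S K i k u r
  · exact ⟨_, Or.inl ⟨h, rfl, rfl⟩⟩
  · exact ⟨_, Or.inr (Or.inr ⟨h, rfl, rfl⟩)⟩

theorem exists_partStep_of_end (i k : Fin n) (u r : Bool) :
    ∃ y, PartStep S K i k u r y (partEnd S K i k u r (!u)) := by
  by_cases h : HasMid S K i k u r
  · exact ⟨_, Or.inr (Or.inl ⟨h, rfl, rfl⟩)⟩
  · exact ⟨_, Or.inr (Or.inr ⟨h, rfl, rfl⟩)⟩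

theorem partEnd_self (i k : Fin n) (u r : Bool) :
    partEnd S K i k u r r = sidePoint S i k u r := by
  simp [partEnd]

theorem partEnd_cases (i k : Fin n) (u r e : Bool) :
    ((i, k) ∈ K.corridors ∧ r = !e ∧ partEnd S K i k u r e = .cut i k u (!e)) ∨
      (((i, k) ∈ K.corridors → r = e) ∧ partEnd S K i k u r e = sidePoint S i k u e) := by
  by_cases h : (i, k) ∈ K.corridors ∧ r ≠ e
  · obtain rfl : r = !e := Bool.eq_not.2 h.2
    exact Or.inl ⟨h.1, rfl, if_pos h⟩
  · exact Or.inr ⟨fun h' => not_not.1 fun hne => h ⟨h', hne⟩, if_neg h⟩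

theorem partEnd_congr {i k : Fin n} {u r s e : Bool} (h : (i, k) ∈ K.corridors → r = s) :
    partEnd S K i k u r e = partEnd S K i k u s e := by
  by_cases hc : (i, k) ∈ K.corridors
  · rw [h hc]
  · simp [partEnd, hc]

theorem hasMid_congr {i k : Fin n} {u r s : Bool} (h : (i, k) ∈ K.corridors → r = s) :
    HasMid S K i k u r ↔ HasMid S K i k u s := by
  by_cases hc : (i, k) ∈ K.corridors
  · rw [h hc]
  · simp [HasMid, hc]

end Steps

namespace CrossingTimes

variable {n : ℕ} {S : Fin n → List (Fin n)} {X : Fin n → Fin n → ℕ} {K : Cuts n}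

theorem sidePoint_ne_mid (A : CrossingTimes S X) {i a b : Fin n} {k : ℕ} (hk : k < n)
    (u r v : Bool) : sidePoint S i k u r ≠ .mid a b v := by
  rcases A.sidePoint_cases (i := i) hk u r with
    ⟨-, -, h⟩ | ⟨-, -, h⟩ | ⟨_, _, -, -, -, h⟩ | ⟨_, _, -, -, -, h⟩
  all_goals rw [h]; exact nofun

theorem sidePoint_ne_cut (A : CrossingTimes S X) {i a b : Fin n} {k : ℕ} (hk : k < n)
    (u r v s : Bool) : sidePoint S i k u r ≠ .cut a b v s := by
  rcases A.sidePoint_cases (i := i) hk u r with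
    ⟨-, -, h⟩ | ⟨-, -, h⟩ | ⟨_, _, -, -, -, h⟩ | ⟨_, _, -, -, -, h⟩
  all_goals rw [h]; exact nofun

theorem partEnd_ne_mid (A : CrossingTimes S X) {i k a b : Fin n} (u r e v : Bool) :
    partEnd S K i k u r e ≠ .mid a b v := by
  rcases partEnd_cases (S := S) (K := K) i k u r e with ⟨-, -, h⟩ | ⟨-, h⟩
  · rw [h]; exact nofun
  · rw [h]; exact A.sidePoint_ne_mid k.2 _ _ _

theorem partEnd_start_ne_cut (A : CrossingTimes S X) {i k a b : Fin n} (u r s : Bool) :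
    partEnd S K i k u r u ≠ .cut a b s s := by
  rcases partEnd_cases (S := S) (K := K) i k u r u with ⟨-, -, h⟩ | ⟨-, h⟩
  · rw [h]
    intro heq
    obtain ⟨-, -, rfl, hu⟩ := Point.cut.inj heq
    exact Bool.not_ne_self u hu
  · rw [h]; exact A.sidePoint_ne_cut k.2 _ _ _ _

theorem partEnd_start_inj (A : CrossingTimes S X) {i j k l : Fin n} {u r v s : Bool}
    (h : partEnd S K i k u r u = partEnd S K j l v s v) :
    i = j ∧ k = l ∧ u = v ∧ ((i, k) ∈ K.corridors → r = s) := by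
  rcases partEnd_cases (S := S) (K := K) i k u r u with ⟨-, hr, hx⟩ | ⟨hr, hx⟩ <;>
    rcases partEnd_cases (S := S) (K := K) j l v s v with ⟨-, hs, hy⟩ | ⟨hs, hy⟩ <;>
    rw [hx, hy] at h
  · obtain ⟨rfl, rfl, rfl, -⟩ := Point.cut.inj h
    exact ⟨rfl, rfl, rfl, fun _ => hr.trans hs.symm⟩
  · exact absurd h.symm (A.sidePoint_ne_cut l.2 _ _ _ _)
  · exact absurd h (A.sidePoint_ne_cut k.2 _ _ _ _)
  · obtain ⟨rfl, hkl, rfl, -⟩ := A.sidePoint_inj k.2 l.2 h (by simp)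
    obtain rfl := Fin.ext hkl
    exact ⟨rfl, rfl, rfl, fun hc => (hr hc).trans (hs hc).symm⟩

theorem partStep_unique (A : CrossingTimes S X) {i j k l : Fin n} {u r v s : Bool}
    {x y z : Point n} (hy : PartStep S K i k u r x y) (hz : PartStep S K j l v s x z) :
    y = z := by
  rcases hy with ⟨hmid, rfl, rfl⟩ | ⟨hmid, rfl, rfl⟩ | ⟨hmid, rfl, rfl⟩ <;>
    rcases hz with ⟨hmid', hx, rfl⟩ | ⟨hmid', hx, rfl⟩ | ⟨hmid', hx, rfl⟩
  · obtain ⟨rfl, rfl, rfl, -⟩ := A.partEnd_start_inj hx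
    rfl
  · exact absurd hx (A.partEnd_ne_mid _ _ _ _)
  · obtain ⟨rfl, rfl, rfl, hrs⟩ := A.partEnd_start_inj hx
    exact absurd ((hasMid_congr hrs).1 hmid) hmid'
  · exact absurd hx.symm (A.partEnd_ne_mid _ _ _ _)
  · obtain ⟨rfl, rfl, rfl⟩ := Point.mid.inj hx
    exact partEnd_congr fun hc => Bool.not_inj ((hmid.2 hc).symm.trans (hmid'.2 hc))
  · exact absurd hx.symm (A.partEnd_ne_mid _ _ _ _)
  · obtain ⟨rfl, rfl, rfl, hrs⟩ := A.partEnd_start_inj hx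
    exact absurd ((hasMid_congr hrs).2 hmid') hmid
  · exact absurd hx (A.partEnd_ne_mid _ _ _ _)
  · obtain ⟨rfl, rfl, rfl, hrs⟩ := A.partEnd_start_inj hx
    exact partEnd_congr hrs

theorem not_partStep_cut (A : CrossingTimes S X) {i j k l : Fin n} {u r s : Bool} {y : Point n} :
    ¬ PartStep S K i k u r (.cut j l s s) y := by
  rintro (⟨-, h, -⟩ | ⟨-, h, -⟩ | ⟨-, h, -⟩)
  · exact A.partEnd_start_ne_cut _ _ _ h.symm
  · exact nomatch h
  · exact A.partEnd_start_ne_cut _ _ _ h.symm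

theorem boundaryStep_unique (A : CrossingTimes S X) {x y z : Point n} (hy : BoundaryStep S K x y)
    (hz : BoundaryStep S K x z) : y = z := by
  rcases hy.cases with ⟨i, k, u, r, hy⟩ | ⟨i, k, r, -, rfl, rfl⟩ <;>
    rcases hz.cases with ⟨j, l, v, s, hz⟩ | ⟨j, l, s, -, hx, rfl⟩
  · exact A.partStep_unique hy hz
  · exact absurd (hx ▸ hy) A.not_partStep_cut
  · exact absurd hz A.not_partStep_cut
  · obtain ⟨rfl, rfl, rfl, -⟩ := Point.cut.inj hx
    rfl

theorem exists_boundaryStep_of_end (A : CrossingTimes S X) (i k : Fin n) (u r : Bool) :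
    ∃ y, BoundaryStep S K (partEnd S K i k u r (!u)) y := by
  rcases partEnd_cases (S := S) (K := K) i k u r (!u) with ⟨hc, -, h⟩ | ⟨-, h⟩
  · rw [h, Bool.not_not]
    exact ⟨_, boundaryStep_cut hc u⟩
  · obtain ⟨j, l, v, s, hl, hjl, hvs⟩ := A.exists_sidePoint_eq (i := i) k.2 u (!u)
    obtain rfl : v = s := by simpa using hvs
    obtain ⟨y, hy⟩ := exists_partStep_of_start (S := S) (K := K) j ⟨l, hl⟩ v v
    rw [partEnd_self] at hy
    exact ⟨y, h ▸ hjl ▸ hy.boundaryStep⟩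

theorem exists_boundaryStep_to_start (A : CrossingTimes S X) (i k : Fin n) (u r : Bool) :
    ∃ y, BoundaryStep S K y (partEnd S K i k u r u) := by
  rcases partEnd_cases (S := S) (K := K) i k u r u with ⟨hc, -, h⟩ | ⟨-, h⟩
  · have step := boundaryStep_cut (S := S) hc (!u)
    rw [Bool.not_not] at step
    exact ⟨_, h ▸ step⟩
  · obtain ⟨j, l, v, s, hl, hjl, hvs⟩ := A.exists_sidePoint_eq (i := i) k.2 u u
    obtain rfl : s = !v := Bool.eq_not.2 fun h => by simp [h] at hvs
    obtain ⟨y, hy⟩ := exists_partStep_of_end (S := S) (K := K) j ⟨l, hl⟩ v (!v)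
    rw [partEnd_self] at hy
    exact ⟨y, h ▸ hjl ▸ hy.boundaryStep⟩

theorem exists_succ (A : CrossingTimes S X) {x : Point n} (hx : IsVertex S K x) :
    ∃ y, BoundaryStep S K x y := by
  obtain ⟨i, k, u, r, hx⟩ := isVertex_iff.1 hx
  rcases mem_sidePart_iff.1 hx with ⟨h, rfl⟩ | ⟨e, rfl⟩
  · exact ⟨_, PartStep.boundaryStep (Or.inr (Or.inl ⟨h, rfl, rfl⟩))⟩
  · rcases Bool.eq_or_eq_not e u with rfl | rfl
    · exact (exists_partStep_of_start i k e r).imp fun _ => PartStep.boundaryStep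
    · exact A.exists_boundaryStep_of_end i k u r

theorem exists_pred (A : CrossingTimes S X) {x : Point n} (hx : IsVertex S K x) :
    ∃ y, BoundaryStep S K y x := by
  obtain ⟨i, k, u, r, hx⟩ := isVertex_iff.1 hx
  rcases mem_sidePart_iff.1 hx with ⟨h, rfl⟩ | ⟨e, rfl⟩
  · exact ⟨_, PartStep.boundaryStep (Or.inl ⟨h, rfl, rfl⟩)⟩
  · rcases Bool.eq_or_eq_not e u with rfl | rfl
    · exact A.exists_boundaryStep_to_start i k e r
    · exact (exists_partStep_of_end i k u r).imp fun _ => PartStep.boundaryStep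

end CrossingTimes

/-! ## Colorings of the boundary -/

/-- A coloring of the edges of the boundary, given by the color `E x` of the edge that leaves the
vertex `x` and the color `F x` of the edge that enters it. The color changes at crossings only. -/
structure BoundaryColoring {n : ℕ} (S : Fin n → List (Fin n)) (K : Cuts n) (E F : Point n → Prop) :
    Prop where
  step : ∀ x y, BoundaryStep S K x y → (E x ↔ F y)
  mid : ∀ i k u, E (.mid i k u) ↔ F (.mid i k u)
  cut : ∀ i k u r, E (.cut i k u r) ↔ F (.cut i k u r)
  leftEnd : ∀ i, E (.leftEnd i) ↔ F (.leftEnd i)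
  rightEnd : ∀ i, E (.rightEnd i) ↔ F (.rightEnd i)

namespace BoundaryColoring

section Values

variable {n : ℕ} (S : Fin n → List (Fin n)) (E F : Point n → Prop)

/-- The color of the side `(i, k, u)` near its end `r`. The boundary leaves this end along the side
if `u = r`, and enters it otherwise. -/
def endColor (i : Fin n) (k : ℕ) (u r : Bool) : Prop :=
  if u = r then E (sidePoint S i k u r) else F (sidePoint S i k u r)

open Classical in
/-- `endColor` as an element of `ZMod 2`. -/
noncomputable def endValue (i : Fin n) (k : ℕ) (u r : Bool) : ZMod 2 :=
  if endColor S E F i k u r then 1 else 0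

/-- The flow that is `1` on the corridors whose two sides have different colors. -/
noncomputable def colorFlow (i : Fin n) (k : ℕ) : ZMod 2 :=
  endValue S E F i k false false + endValue S E F i k true false

open Classical in
/-- `1` if the color changes at `x`, and `0` otherwise. -/
noncomputable def change (x : Point n) : ZMod 2 := if E x ↔ F x then 0 else 1

variable {S E F}

theorem endValue_eq_iff {i j : Fin n} {k l : ℕ} {u v r s : Bool} :
    endValue S E F i k u r = endValue S E F j l v s ↔
      (endColor S E F i k u r ↔ endColor S E F j l v s) := by
  unfold endValue
  split_ifs <;> simp [*]

theorem endColor_self {i : Fin n} {k : ℕ} {u r : Bool} :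
    endColor S E E i k u r ↔ E (sidePoint S i k u r) := by
  simp [endColor]

end Values

variable {n : ℕ} {S : Fin n → List (Fin n)} {X : Fin n → Fin n → ℕ} {K : Cuts n}
  {E F : Point n → Prop}

theorem along (C : BoundaryColoring S K E F) (i k : Fin n) (u r : Bool) :
    E (partEnd S K i k u r u) ↔ F (partEnd S K i k u r (!u)) := by
  by_cases h : HasMid S K i k u r
  · rw [C.step _ _ (PartStep.boundaryStep (Or.inl ⟨h, rfl, rfl⟩)), ← C.mid,
      C.step _ _ (PartStep.boundaryStep (Or.inr (Or.inl ⟨h, rfl, rfl⟩)))]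
  · exact C.step _ _ (PartStep.boundaryStep (Or.inr (Or.inr ⟨h, rfl, rfl⟩)))

theorem endColor_iff (C : BoundaryColoring S K E F) (i k : Fin n) (u r : Bool) :
    endColor S E F i k u r ↔ E (partEnd S K i k u r u) := by
  unfold endColor
  rcases Bool.eq_or_eq_not r u with rfl | rfl
  · rw [if_pos rfl, partEnd_self]
  · rw [if_neg (Bool.not_ne_self u).symm, C.along, partEnd_self]

theorem iff_endColor (C : BoundaryColoring S K E F) {i k : Fin n} {u r : Bool} {x : Point n}
    (hx : x ∈ sidePart S K i k u r) (hEF : E x ↔ F x) : E x ↔ endColor S E F i k u r := by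
  rw [C.endColor_iff]
  rcases mem_sidePart_iff.1 hx with ⟨h, rfl⟩ | ⟨e, rfl⟩
  · rw [C.mid, C.step _ _ (PartStep.boundaryStep (Or.inl ⟨h, rfl, rfl⟩))]
  · rcases Bool.eq_or_eq_not e u with rfl | rfl
    · rfl
    · rw [C.along, hEF]

theorem endColor_uncut (C : BoundaryColoring S K E F) {i k : Fin n} (h : (i, k) ∉ K.corridors)
    (u r s : Bool) : endColor S E F i k u r ↔ endColor S E F i k u s := by
  rw [C.endColor_iff, C.endColor_iff, partEnd_congr fun h' => absurd h' h]

theorem endColor_cut (C : BoundaryColoring S K E F) {i k : Fin n} (h : (i, k) ∈ K.corridors)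
    (r : Bool) : endColor S E F i k false r ↔ endColor S E F i k true r := by
  have cut_edge : endColor S E F i k r r ↔ endColor S E F i k (!r) r := by
    have start_eq : partEnd S K i k r r (!r) = .cut i k r r := by simp [partEnd, h]
    have end_eq : partEnd S K i k (!r) r (!r) = .cut i k (!r) r := by simp [partEnd, h]
    rw [C.endColor_iff, C.along, C.endColor_iff, start_eq, end_eq, ← C.cut,
      C.step _ _ (boundaryStep_cut h r), C.cut]
  cases r
  · exact cut_edge
  · exact cut_edge.symm

theorem colorFlow_cut (C : BoundaryColoring S K E F) {i k : Fin n} (h : (i, k) ∈ K.corridors) :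
    colorFlow S E F i k = 0 := by
  rw [colorFlow, endValue_eq_iff.2 (C.endColor_cut h false), CharTwo.add_self_eq_zero]

theorem colorFlow_eq (C : BoundaryColoring S K E F) {i : Fin n} {k : ℕ} (hk : k < n) (r : Bool) :
    colorFlow S E F i k = endValue S E F i k false r + endValue S E F i k true r := by
  lift k to Fin n using hk
  by_cases hc : (i, k) ∈ K.corridors
  · rw [C.colorFlow_cut hc, endValue_eq_iff.2 (C.endColor_cut hc r), CharTwo.add_self_eq_zero]
  · rw [colorFlow, endValue_eq_iff.2 (C.endColor_uncut hc false false r),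
      endValue_eq_iff.2 (C.endColor_uncut hc true false r)]

theorem colorFlow_zero (C : BoundaryColoring S K E F) (i : Fin n) : colorFlow S E F i 0 = 0 := by
  have colors : endColor S E F i 0 false false ↔ endColor S E F i 0 true false := by
    simpa [endColor, sidePoint] using C.leftEnd i
  rw [colorFlow, endValue_eq_iff.2 colors, CharTwo.add_self_eq_zero]

theorem colorFlow_last (A : CrossingTimes S X) (C : BoundaryColoring S K E F) (i : Fin n) :
    colorFlow S E F i (n - 1) = 0 := by
  have no_crossing : (S i)[n - 1]? = none := List.getElem?_eq_none_iff.2 (by rw [A.length])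
  have colors : endColor S E F i (n - 1) false true ↔ endColor S E F i (n - 1) true true := by
    simpa [endColor, sidePoint, no_crossing] using (C.rightEnd i).symm
  rw [C.colorFlow_eq (Nat.sub_lt i.pos one_pos) true, endValue_eq_iff.2 colors,
    CharTwo.add_self_eq_zero]

theorem endValue_add_endValue_cross (A : CrossingTimes S X) {a b : Fin n} (hab : a < b)
    (p q : Bool) :
    endValue S E F a (corridorAt S X a (X a b) + q.toNat) p (!q) +
      endValue S E F b (corridorAt S X b (X a b) + (!p).toNat) q p =
        change E F (.cross a p b q) := by
  have fst : endColor S E F a (corridorAt S X a (X a b) + q.toNat) p (!q) ↔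
      if p = !q then E (.cross a p b q) else F (.cross a p b q) := by
    rw [endColor, A.sidePoint_fst hab]
  have snd : endColor S E F b (corridorAt S X b (X a b) + (!p).toNat) q p ↔
      if q = p then E (.cross a p b q) else F (.cross a p b q) := by
    rw [endColor, A.sidePoint_snd hab]
  have one_add_one : (1 : ZMod 2) + 1 = 0 := CharTwo.add_self_eq_zero 1
  rw [endValue, endValue, change, propext fst, propext snd]
  clear fst snd
  cases p <;> cases q <;> split_ifs <;> grind

theorem colorFlow_cross (A : CrossingTimes S X) (C : BoundaryColoring S K E F)
    {a b : Fin n} (hab : a < b) :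
    colorFlow S E F a (corridorAt S X a (X a b) + 1) +
        colorFlow S E F b (corridorAt S X b (X a b) + 1) +
      (colorFlow S E F a (corridorAt S X a (X a b)) +
        colorFlow S E F b (corridorAt S X b (X a b))) =
      ∑ p, ∑ q, change E F (.cross a p b q) := by
  have flow_fst (q : Bool) := C.colorFlow_eq (i := a) (A.corridorAt_fst_lt hab q) (!q)
  have flow_snd (p : Bool) := C.colorFlow_eq (i := b) (A.corridorAt_snd_lt hab p) p
  have flow_fst_true := flow_fst true
  have flow_fst_false := flow_fst false
  have flow_snd_true := flow_snd true
  have flow_snd_false := flow_snd false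
  simp only [Bool.toNat_true, Bool.toNat_false, Bool.not_true, Bool.not_false, add_zero] at *
  simp only [Fintype.sum_bool, ← endValue_add_endValue_cross A hab, Bool.toNat_true,
    Bool.toNat_false, Bool.not_true, Bool.not_false, add_zero]
  rw [flow_fst_true, flow_fst_false, flow_snd_true, flow_snd_false]
  ring

theorem isFlow_colorFlow (A : CrossingTimes S X) (C : BoundaryColoring S K E F)
    (heven : ∀ a b, a < b → ∑ p, ∑ q, change E F (.cross a p b q) = 0) :
    CrossingTimes.IsFlow S X (colorFlow S E F) := by
  have flow_of_lt {a b : Fin n} (hab : a < b) :=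
    CharTwo.add_eq_zero.1 ((C.colorFlow_cross A hab).trans (heven a b hab))
  intro i j hij
  rcases lt_or_gt_of_ne hij with hlt | hlt
  · exact flow_of_lt hlt
  · have flow := flow_of_lt hlt
    rw [A.symm j i] at flow
    rw [add_comm, flow, add_comm]

theorem endColor_lower_iff_upper (A : CrossingTimes S X) (C : BoundaryColoring S K E F)
    (hK : K.OpenAllHoles S)
    (heven : ∀ a b, a < b → ∑ p, ∑ q, change E F (.cross a p b q) = 0) (i k : Fin n) (r : Bool) :
    endColor S E F i k false r ↔ endColor S E F i k true r := by
  have flow_eq_zero := A.flow_eq_zero (C.isFlow_colorFlow A heven) C.colorFlow_zero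
    (C.colorFlow_last A) hK (fun _ _ => C.colorFlow_cut) i k
  rw [C.colorFlow_eq k.2 r, CharTwo.add_eq_zero] at flow_eq_zero
  exact endValue_eq_iff.1 flow_eq_zero

end BoundaryColoring

/-! ## The boundary is a single cycle -/

theorem SameBoundary.symm {n : ℕ} {S : Fin n → List (Fin n)} {s t : Side n}
    (h : SameBoundary S s t) : SameBoundary S t s :=
  have : Std.Symm fun a b : Side n => ∃ x, IsEndOf S x a ∧ IsEndOf S x b :=
    ⟨fun _ _ ⟨x, ha, hb⟩ => ⟨x, hb, ha⟩⟩
  Relation.ReflTransGen.stdSymm.symm _ _ h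

namespace CutsReach

variable {n : ℕ} {S : Fin n → List (Fin n)} {l : List (Fin n × Fin n)} {O : Set (Side n)}

theorem mem_of_sameBoundary (hO : CutsReach S l O) {s t : Side n} (hs : s ∈ O)
    (hst : SameBoundary S s t) : t ∈ O := by
  induction hO with
  | start => exact fun ht => hs fun r hr => ht r (hst.symm.trans hr)
  | step _ O i k u _ _ _ ih => exact hs.imp ih fun hs => hs.trans hst

theorem mem_of_mem (hO : CutsReach S l O) {i k : Fin n} (h : (i, k) ∈ l) (u : Bool) :
    (i, k, u) ∈ O := by
  induction hO with
  | start => simp at h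
  | step _ O j m v _ hv _ ih =>
    rcases List.mem_cons.1 h with h | h
    · obtain ⟨rfl, rfl⟩ := Prod.mk.inj h
      rcases Bool.eq_or_eq_not u v with rfl | rfl
      · exact Or.inl hv
      · exact Or.inr Relation.ReflTransGen.refl
    · exact Or.inl (ih h)

end CutsReach

namespace CrossingTimes

variable {n : ℕ} {S : Fin n → List (Fin n)} {X : Fin n → Fin n → ℕ} {K : Cuts n} {R : Type*}
  [Ring R] [CharP R 2]

theorem exists_other_side (A : CrossingTimes S X) (s : Side n) (r : Bool) :
    ∃ (t : Side n) (r' : Bool),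
      sidePoint S t.1 t.2.1 t.2.2 r' = sidePoint S s.1 s.2.1 s.2.2 r ∧
        (t.2.2 == r') = !(s.2.2 == r) := by
  obtain ⟨j, l, v, r', hl, h⟩ := A.exists_sidePoint_eq (i := s.1) s.2.1.2 s.2.2 r
  exact ⟨(j, ⟨l, hl⟩, v), r', h⟩

open Classical in
/-- The common points of consecutive sides of a boundary cycle pair off the ends of its sides. -/
theorem sum_sameBoundary_eq_zero (A : CrossingTimes S X) (c : Point n → R) (s₀ : Side n) :
    ∑ s with SameBoundary S s₀ s,
      (c (sidePoint S s.1 s.2.1 s.2.2 true) + c (sidePoint S s.1 s.2.1 s.2.2 false)) = 0 := by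
  have sum_ends (s : Side n) : c (sidePoint S s.1 s.2.1 s.2.2 true) +
      c (sidePoint S s.1 s.2.1 s.2.2 false) = ∑ r, c (sidePoint S s.1 s.2.1 s.2.2 r) :=
    (Fintype.sum_bool fun r => c (sidePoint S s.1 s.2.1 s.2.2 r)).symm
  simp only [sum_ends]
  rw [← Finset.sum_product']
  have exists_other (x : Side n × Bool) := A.exists_other_side x.1 x.2
  choose t r point_eq orientation using exists_other
  refine Finset.sum_involution (fun x _ => (t x, r x)) (fun x _ => ?_) (fun x _ _ he => ?_)
    (fun x hx => ?_) fun x _ => ?_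
  · rw [point_eq, CharTwo.add_self_eq_zero]
  · have h := orientation x
    obtain ⟨ht, hr⟩ := Prod.mk.inj he
    rw [ht, hr] at h
    exact Bool.not_ne_self _ h.symm
  · simp only [Finset.mem_product, Finset.mem_filter, Finset.mem_univ, true_and, and_true] at hx ⊢
    exact hx.tail
      ⟨_, (isEndOf_iff S _ _).2 ⟨x.2, rfl⟩, (isEndOf_iff S _ _).2 ⟨_, (point_eq x).symm⟩⟩
  · obtain ⟨hi, hk, hu, hr⟩ := A.sidePoint_inj (t (t x, r x)).2.1.2 x.1.2.1.2
      ((point_eq (t x, r x)).trans (point_eq x)) (by rw [orientation, orientation, Bool.not_not])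
    exact Prod.ext (Prod.ext hi (Prod.ext (Fin.ext hk) hu)) hr

theorem eq_of_last_cut (A : CrossingTimes S X) {l : List (Fin n × Fin n)} {O : Set (Side n)}
    (hO : CutsReach S l O) {i k : Fin n} {u : Bool} (hmem : (i, k, u) ∈ O)
    (hnot : (i, k, !u) ∉ O) (c : Point n → R)
    (uncut : ∀ j m v, (j, m) ∉ (i, k) :: l →
      c (sidePoint S j m v true) = c (sidePoint S j m v false)) :
    c (sidePoint S i k (!u) true) = c (sidePoint S i k (!u) false) := by
  classical
  have sum_eq_zero := A.sum_sameBoundary_eq_zero c (i, k, !u)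
  rw [Finset.sum_eq_single (i, k, !u)] at sum_eq_zero
  · exact CharTwo.add_eq_zero.1 sum_eq_zero
  · rintro ⟨j, m, v⟩ ht hne
    have same : SameBoundary S (i, k, !u) (j, m, v) := (Finset.mem_filter.1 ht).2
    have notMem : (j, m, v) ∉ O := fun h => hnot (hO.mem_of_sameBoundary h same.symm)
    rw [uncut j m v, CharTwo.add_self_eq_zero]
    intro hcut
    rcases List.mem_cons.1 hcut with heq | hl
    · obtain ⟨rfl, rfl⟩ := Prod.mk.inj heq
      rcases Bool.eq_or_eq_not v u with rfl | rfl
      · exact notMem hmem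
      · exact hne rfl
    · exact notMem (hO.mem_of_mem hl v)
  · exact fun h => absurd (Finset.mem_filter.2 ⟨Finset.mem_univ _, Relation.ReflTransGen.refl⟩) h

theorem sidePoint_true_eq_false (A : CrossingTimes S X) {l : List (Fin n × Fin n)}
    {O : Set (Side n)} (hO : CutsReach S l O) (c : Point n → R)
    (opposite : ∀ i k : Fin n, ∀ u v r, c (sidePoint S i k u r) = c (sidePoint S i k v r))
    (uncut : ∀ i k u, (i, k) ∉ l → c (sidePoint S i k u true) = c (sidePoint S i k u false))
    (i k : Fin n) (u : Bool) : c (sidePoint S i k u true) = c (sidePoint S i k u false) := by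
  induction hO with
  | start => exact uncut i k u List.not_mem_nil
  | step l O j m v hO hmem hnot ih =>
    refine ih fun i k u hl => ?_
    by_cases heq : (i, k) = (j, m)
    · obtain ⟨rfl, rfl⟩ := Prod.mk.inj heq
      rw [opposite i k u (!v), opposite i k u (!v), A.eq_of_last_cut hO hmem hnot c uncut]
    · exact uncut i k u fun h => (List.mem_cons.1 h).elim heq hl

end CrossingTimes

namespace BoundaryColoring

variable {n : ℕ} {S : Fin n → List (Fin n)} {X : Fin n → Fin n → ℕ} {K : Cuts n}
  {E : Point n → Prop}

theorem sidePoint_iff_sidePoint (A : CrossingTimes S X) (C : BoundaryColoring S K E E)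
    (hK : K.OpenAllHoles S) {i : Fin n} {k : ℕ} (hk : k < n) (u r v s : Bool) :
    E (sidePoint S i k u r) ↔ E (sidePoint S i k v s) := by
  classical
  lift k to Fin n using hk
  let value (x : Point n) : ZMod 2 := if E x then 1 else 0
  have value_eq_iff (x y : Point n) : value x = value y ↔ (E x ↔ E y) := by
    by_cases hx : E x <;> by_cases hy : E y <;> simp [value, hx, hy]
  have opposite (i k : Fin n) (u v r : Bool) :
      value (sidePoint S i k u r) = value (sidePoint S i k v r) := by
    have colors := C.endColor_lower_iff_upper A hK (fun _ _ _ => by simp [change]) i k r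
    rw [endColor_self, endColor_self] at colors
    cases u <;> cases v <;> simp only [value, colors]
  have ends_eq := A.sidePoint_true_eq_false hK value opposite (fun i k u h => by
    rw [value_eq_iff, ← endColor_self (E := E), ← endColor_self (E := E), C.endColor_uncut h]) i k v
  rw [← value_eq_iff, opposite i k u v]
  cases r <;> cases s <;> simp only [ends_eq]

theorem cross_iff_cross (A : CrossingTimes S X) (C : BoundaryColoring S K E E)
    (hK : K.OpenAllHoles S) {a b : Fin n} (hab : a < b) (p q p' q' : Bool) :
    E (.cross a p b q) ↔ E (.cross a p' b q') := by
  rw [← A.sidePoint_fst hab p q,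
    C.sidePoint_iff_sidePoint A hK (A.corridorAt_fst_lt hab q) p _ p' (!q), A.sidePoint_fst hab,
    ← A.sidePoint_snd hab, ← A.sidePoint_snd hab,
    C.sidePoint_iff_sidePoint A hK (A.corridorAt_snd_lt hab p')]

theorem sidePoint_succ_iff (A : CrossingTimes S X) (C : BoundaryColoring S K E E)
    (hK : K.OpenAllHoles S) {i : Fin n} {m : ℕ} (hm : m + 1 < n) (u : Bool) :
    E (sidePoint S i (m + 1) u false) ↔ E (sidePoint S i m u true) := by
  have hlt : m < (S i).length := by rw [A.length]; omega
  have hj : (S i)[m]? = some (S i)[m] := List.getElem?_eq_getElem hlt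
  have hne : (S i)[m] ≠ i := (A.mem i _).1 (List.getElem_mem hlt)
  simp only [sidePoint, hj, crossPoint, if_true, Bool.false_eq_true, if_false]
  split_ifs with h
  · exact C.cross_iff_cross A hK h _ _ _ _
  · exact C.cross_iff_cross A hK (lt_of_le_of_ne (not_lt.1 h) hne) _ _ _ _

theorem sidePoint_iff_leftEnd (A : CrossingTimes S X) (C : BoundaryColoring S K E E)
    (hK : K.OpenAllHoles S) {i : Fin n} {k : ℕ} (hk : k < n) (u r : Bool) :
    E (sidePoint S i k u r) ↔ E (.leftEnd i) := by
  induction k generalizing u r with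
  | zero => exact C.sidePoint_iff_sidePoint A hK hk u r u false
  | succ m ih =>
    rw [C.sidePoint_iff_sidePoint A hK hk u r u false, C.sidePoint_succ_iff A hK hk,
      ih (Nat.lt_of_succ_lt hk)]

theorem leftEnd_iff_leftEnd (A : CrossingTimes S X) (C : BoundaryColoring S K E E)
    (hK : K.OpenAllHoles S) (a b : Fin n) : E (.leftEnd a) ↔ E (.leftEnd b) := by
  have iff_of_lt {a b : Fin n} (hab : a < b) : E (.leftEnd a) ↔ E (.leftEnd b) := by
    rw [← C.sidePoint_iff_leftEnd A hK (A.corridorAt_fst_lt hab true) true (!true),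
      A.sidePoint_fst hab, ← A.sidePoint_snd hab,
      C.sidePoint_iff_leftEnd A hK (A.corridorAt_snd_lt hab true)]
  rcases lt_trichotomy a b with h | rfl | h
  · exact iff_of_lt h
  · rfl
  · exact (iff_of_lt h).symm

theorem iff_of_isVertex (A : CrossingTimes S X) (C : BoundaryColoring S K E E)
    (hK : K.OpenAllHoles S) {x y : Point n} (hx : IsVertex S K x) (hy : IsVertex S K y) :
    E x ↔ E y := by
  have exists_leftEnd {z : Point n} (hz : IsVertex S K z) : ∃ i, E z ↔ E (.leftEnd i) := by
    obtain ⟨i, k, u, r, hz⟩ := isVertex_iff.1 hz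
    refine ⟨i, ?_⟩
    rw [C.iff_endColor hz Iff.rfl, endColor_self, C.sidePoint_iff_leftEnd A hK k.2]
  obtain ⟨i, hi⟩ := exists_leftEnd hx
  obtain ⟨j, hj⟩ := exists_leftEnd hy
  rw [hi, hj, C.leftEnd_iff_leftEnd A hK i j]

end BoundaryColoring

instance {n : ℕ} : Finite (Point n) := by
  let code : Point n → (Fin n ⊕ Fin n) ⊕ (Fin n × Bool × Fin n × Bool) ⊕
      (Fin n × Fin n × Bool) ⊕ (Fin n × Fin n × Bool × Bool) := fun x =>
    match x with
    | .leftEnd i => .inl (.inl i)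
    | .rightEnd i => .inl (.inr i)
    | .cross i u j v => .inr (.inl (i, u, j, v))
    | .mid i k u => .inr (.inr (.inl (i, k, u)))
    | .cut i k u r => .inr (.inr (.inr (i, k, u, r)))
  refine Finite.of_injective code ?_
  rintro (_ | _ | _ | _ | _) (_ | _ | _ | _ | _) h <;> simp_all [code]

instance {n : ℕ} (S : Fin n → List (Fin n)) (K : Cuts n) : Finite (PolygonVertex S K) :=
  inferInstanceAs (Finite {_x : Point n // _})

theorem apply_mem_periodicOrbit_iff {α : Type*} {f : α → α} (hf : Function.Injective f) {x : α}
    (hx : x ∈ Function.periodicPts f) {y : α} :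
    f y ∈ Function.periodicOrbit f x ↔ y ∈ Function.periodicOrbit f x := by
  rw [Function.mem_periodicOrbit_iff hx, Function.mem_periodicOrbit_iff hx]
  constructor
  · rintro ⟨_ | m, hm⟩
    · obtain ⟨_ | N, hN, periodic⟩ := hx
      · exact absurd hN (lt_irrefl 0)
      · exact ⟨N, hf (by rw [← Function.iterate_succ_apply' f N x, ← hm]; exact periodic)⟩
    · exact ⟨m, hf (by rw [← Function.iterate_succ_apply' f m x, hm])⟩
  · rintro ⟨m, rfl⟩
    exact ⟨m + 1, Function.iterate_succ_apply' f m x⟩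

namespace CrossingTimes

variable {n : ℕ} {S : Fin n → List (Fin n)} {X : Fin n → Fin n → ℕ} {K : Cuts n}

theorem exists_injective_successor (A : CrossingTimes S X) :
    ∃ f : PolygonVertex S K → PolygonVertex S K, Function.Injective f ∧
      ∀ x y, BoundaryStep S K x.1 y.1 ↔ f x = y := by
  have exists_step (x : PolygonVertex S K) :
      ∃ y : PolygonVertex S K, BoundaryStep S K x.1 y.1 := by
    obtain ⟨y, hy⟩ := A.exists_succ (K := K) x.2
    exact ⟨⟨y, hy.isVertex.2⟩, hy⟩
  choose f step using exists_step
  have step_iff (x y : PolygonVertex S K) : BoundaryStep S K x.1 y.1 ↔ f x = y :=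
    ⟨fun h => Subtype.ext (A.boundaryStep_unique (step x) h), fun h => h ▸ step x⟩
  refine ⟨f, Finite.injective_iff_surjective.2 fun x => ?_, step_iff⟩
  obtain ⟨y, hy⟩ := A.exists_pred (K := K) x.2
  exact ⟨⟨y, hy.isVertex.1⟩, (step_iff _ _).1 hy⟩

theorem exists_isBoundaryCycle (A : CrossingTimes S X) (hK : K.OpenAllHoles S) :
    ∃ P : Cycle (PolygonVertex S K), IsBoundaryCycle S K P := by
  rcases isEmpty_or_nonempty (PolygonVertex S K) with empty | ⟨⟨x₀⟩⟩
  · exact ⟨Cycle.nil, by simp, fun v => (empty.false v).elim, by simp⟩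
  obtain ⟨f, f_injective, step_iff⟩ := A.exists_injective_successor (K := K)
  have periodic : x₀ ∈ Function.periodicPts f := f_injective.mem_periodicPts x₀
  let E (p : Point n) : Prop := ∃ hp, (⟨p, hp⟩ : PolygonVertex S K) ∈ Function.periodicOrbit f x₀
  have step (x y : Point n) (hxy : BoundaryStep S K x y) : E x ↔ E y := by
    have hf : f ⟨x, hxy.isVertex.1⟩ = ⟨y, hxy.isVertex.2⟩ := (step_iff _ _).1 hxy
    have orbit_iff := apply_mem_periodicOrbit_iff f_injective periodic (y := ⟨x, hxy.isVertex.1⟩)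
    rw [hf] at orbit_iff
    exact ⟨fun ⟨_, h⟩ => ⟨_, orbit_iff.2 h⟩, fun ⟨_, h⟩ => ⟨_, orbit_iff.1 h⟩⟩
  have C : BoundaryColoring S K E E :=
    ⟨step, fun _ _ _ => Iff.rfl, fun _ _ _ _ => Iff.rfl, fun _ => Iff.rfl, fun _ => Iff.rfl⟩
  refine ⟨Function.periodicOrbit f x₀, Function.nodup_periodicOrbit, fun v => ?_, ?_⟩
  · exact ((C.iff_of_isVertex A hK x₀.2 v.2).1
      ⟨x₀.2, Function.self_mem_periodicOrbit periodic⟩).2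
  · rw [Function.periodicOrbit_chain]
    exact fun m _ => (step_iff _ _).2 (Function.iterate_succ_apply' f m x₀).symm

end CrossingTimes

/-! ## Pieces of channels -/

section Pieces

variable {n : ℕ} {S : Fin n → List (Fin n)} {X : Fin n → Fin n → ℕ} {K : Cuts n}

/-- `x` lies in the part `r` of the corridor `(i, k)`, on one of its two sides. -/
def OnPart (S : Fin n → List (Fin n)) (K : Cuts n) (i : Fin n) (k : ℕ) (r : Bool)
    (x : Point n) : Prop :=
  ∃ (k' : Fin n) (u : Bool), k'.val = k ∧ x ∈ sidePart S K i k' u r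

/-- The part `r` of the corridor `k` of a channel lies on the left of the cut across the
corridor `m`, if there is one. -/
def PartLeftOf (k : ℕ) (r : Bool) (m : ℕ) : Prop := k < m ∨ k = m ∧ r = false

/-- No cut across the channel `i` separates the parts `(k, r)` and `(l, s)`. -/
def Unseparated (K : Cuts n) (i : Fin n) (k : ℕ) (r : Bool) (l : ℕ) (s : Bool) : Prop :=
  ∀ m : Fin n, (i, m) ∈ K.corridors → (PartLeftOf k r m ↔ PartLeftOf l s m)

/-- Two points lie on the channel `i`, and no cut across it separates them. -/
def CommonPiece (S : Fin n → List (Fin n)) (K : Cuts n) (i : Fin n) (x y : Point n) : Prop :=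
  ∃ k r l s, OnPart S K i k r x ∧ OnPart S K i l s y ∧ Unseparated K i k r l s

/-- The corridor of `i` whose end `r` lies at the crossing with `j`. -/
def crossingCorridor (S : Fin n → List (Fin n)) (X : Fin n → Fin n → ℕ) (i j : Fin n)
    (r : Bool) : ℕ :=
  corridorAt S X i (X i j) + (!r).toNat

/-- The vertex `x` lies in the piece of the channel `i` that contains the crossing with `j`. -/
def InPiece (S : Fin n → List (Fin n)) (X : Fin n → Fin n → ℕ) (K : Cuts n) (i j : Fin n)
    (x : Point n) : Prop :=
  ∃ k r, OnPart S K i k r x ∧ Unseparated K i k r (crossingCorridor S X i j true) true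

theorem Unseparated.refl (i : Fin n) (k : ℕ) (r : Bool) : Unseparated K i k r k r :=
  fun _ _ => Iff.rfl

theorem Unseparated.symm {i : Fin n} {k l : ℕ} {r s : Bool} (h : Unseparated K i k r l s) :
    Unseparated K i l s k r :=
  fun m hm => (h m hm).symm

theorem Unseparated.trans {i : Fin n} {k l o : ℕ} {r s t : Bool} (h : Unseparated K i k r l s)
    (h' : Unseparated K i l s o t) : Unseparated K i k r o t :=
  fun m hm => (h m hm).trans (h' m hm)

theorem unseparated_succ (i : Fin n) (k : ℕ) : Unseparated K i k true (k + 1) false := by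
  intro m _
  simp only [PartLeftOf, Bool.true_eq_false, and_false, or_false, and_true]
  omega

theorem unseparated_of_forall_eq {i : Fin n} {k : ℕ} {r s : Bool}
    (h : ∀ m : Fin n, m.val = k → (i, m) ∈ K.corridors → r = s) : Unseparated K i k r k s := by
  intro m hm
  by_cases hkm : m.val = k
  · rw [h m hkm hm]
  · simp only [PartLeftOf, Ne.symm hkm, false_and, or_false]

theorem unseparated_crossingCorridor (i j : Fin n) (r s : Bool) :
    Unseparated K i (crossingCorridor S X i j r) r (crossingCorridor S X i j s) s := by
  have h := unseparated_succ (K := K) i (corridorAt S X i (X i j))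
  cases r <;> cases s
  · exact .refl _ _ _
  · exact h.symm
  · exact h
  · exact .refl _ _ _

theorem onPart_cases {i : Fin n} {k : ℕ} {r : Bool} {x : Point n} (h : OnPart S K i k r x) :
    (∃ k' u, k'.val = k ∧ x = .mid i k' u ∧ ((i, k') ∈ K.corridors → K.rightOfMid i k' u = !r)) ∨
    (∃ k' u, k'.val = k ∧ (i, k') ∈ K.corridors ∧ x = .cut i k' u r) ∨
    (∃ (k' : Fin n) (u e : Bool), k'.val = k ∧ x = sidePoint S i k' u e ∧
      ((i, k') ∈ K.corridors → r = e)) := by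
  obtain ⟨k', u, hk', hx⟩ := h
  rcases mem_sidePart_iff.1 hx with ⟨hmid, rfl⟩ | ⟨e, rfl⟩
  · exact Or.inl ⟨k', u, hk', rfl, hmid.2⟩
  · rcases partEnd_cases (S := S) (K := K) i k' u r e with ⟨hc, hr, hx⟩ | ⟨hr, hx⟩
    · exact Or.inr (Or.inl ⟨k', u, hk', hc, by rw [hx, hr]⟩)
    · exact Or.inr (Or.inr ⟨k', u, e, hk', hx, hr⟩)

theorem onChannel_iff {i : Fin n} {x : Point n} :
    OnChannel S K i x ↔ ∃ k r, OnPart S K i k r x := by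
  simp only [OnChannel, mem_sideParts_iff]
  constructor
  · rintro ⟨k, u, L, ⟨r, rfl⟩, hx⟩
    exact ⟨k, r, k, u, rfl, hx⟩
  · rintro ⟨k, r, k', u, -, hx⟩
    exact ⟨k', u, _, ⟨r, rfl⟩, hx⟩

theorem leftOfCut_iff_exists {i m : Fin n} {x : Point n} (hm : (i, m) ∈ K.corridors) :
    LeftOfCut S K i m x ↔ ∃ l s, OnPart S K i l s x ∧ PartLeftOf l s m := by
  simp only [LeftOfCut, mem_sideParts_iff]
  constructor
  · rintro (⟨k', u, hk, L, ⟨s, rfl⟩, hx⟩ | ⟨u, hx⟩)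
    · exact ⟨k', s, ⟨k', u, rfl, hx⟩, Or.inl hk⟩
    · exact ⟨m, false, ⟨m, u, rfl, by simpa [sidePart, hm] using hx⟩, Or.inr ⟨rfl, rfl⟩⟩
  · rintro ⟨l, s, ⟨k', u, rfl, hx⟩, hk | ⟨hk, rfl⟩⟩
    · exact Or.inl ⟨k', u, hk, _, ⟨s, rfl⟩, hx⟩
    · obtain rfl := Fin.ext hk
      exact Or.inr ⟨u, by simpa [sidePart, hm] using hx⟩

theorem BoundaryStep.exists_onPart {x y : Point n} (h : BoundaryStep S K x y) :
    ∃ i k r, OnPart S K i k r x ∧ OnPart S K i k r y := by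
  rcases h.cases with ⟨i, k, u, r, hr⟩ | ⟨i, k, r, hc, rfl, rfl⟩
  · exact ⟨i, k, r, ⟨k, u, rfl, hr.mem.1⟩, k, u, rfl, hr.mem.2⟩
  · exact ⟨i, k, r, ⟨k, r, rfl, cut_mem hc _ _⟩, k, !r, rfl, cut_mem hc _ _⟩

theorem BoundaryStep.exists_commonPiece {x y : Point n} (h : BoundaryStep S K x y) :
    ∃ i, CommonPiece S K i x y :=
  let ⟨i, k, r, hx, hy⟩ := h.exists_onPart
  ⟨i, k, r, k, r, hx, hy, .refl _ _ _⟩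

theorem crossPoint_comm {i j : Fin n} (h : i ≠ j) (u v : Bool) :
    crossPoint i u j v = crossPoint j v i u := by
  unfold crossPoint
  rcases lt_or_gt_of_ne h with h' | h' <;> simp [h', h'.not_gt]

theorem crossPoint_inj {i j : Fin n} {u v u' v' : Bool}
    (h : crossPoint i u j v = crossPoint i u' j v') : u = u' ∧ v = v' := by
  unfold crossPoint at h
  split_ifs at h
  · obtain ⟨-, rfl, -, rfl⟩ := Point.cross.inj h
    exact ⟨rfl, rfl⟩
  · obtain ⟨-, rfl, -, rfl⟩ := Point.cross.inj h
    exact ⟨rfl, rfl⟩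

theorem decide_lt_comm {α : Type*} [LinearOrder α] {i j : α} (h : i ≠ j) :
    decide (i < j) = !decide (j < i) := by
  rcases lt_or_gt_of_ne h with h' | h' <;> simp [h', h'.not_gt]

theorem inPiece_of_onPart {i j : Fin n} {r : Bool} {x : Point n}
    (h : OnPart S K i (crossingCorridor S X i j r) r x) : InPiece S X K i j x :=
  ⟨_, _, h, unseparated_crossingCorridor i j r true⟩

theorem commonPiece_of_inPiece {i j : Fin n} {x y : Point n} (hx : InPiece S X K i j x)
    (hy : InPiece S X K i j y) : CommonPiece S K i x y :=
  let ⟨k, r, hkx, hk⟩ := hx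
  let ⟨l, s, hly, hl⟩ := hy
  ⟨k, r, l, s, hkx, hly, hk.trans hl.symm⟩

namespace CrossingTimes

theorem sidePoint_same (A : CrossingTimes S X) {i : Fin n} {k l : ℕ} (hk : k < n) (hl : l < n)
    {u r v s : Bool} (h : sidePoint S i k u r = sidePoint S i l v s) : k = l ∧ r = s := by
  rcases A.sidePoint_cases (i := i) hk u r with
    ⟨hr, hk0, he⟩ | ⟨hr, hkn, he⟩ | ⟨b, q, hib, hr, hkb, he⟩ | ⟨a, p, hai, hr, hka, he⟩
  · obtain ⟨-, hl0, hs⟩ := A.sidePoint_eq_leftEnd hl (h.symm.trans he)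
    exact ⟨hk0.trans hl0.symm, hr.trans hs.symm⟩
  · obtain ⟨-, hln, hs⟩ := A.sidePoint_eq_rightEnd hl (h.symm.trans he)
    exact ⟨hkn.trans hln.symm, hr.trans hs.symm⟩
  · obtain ⟨-, ⟨-, -, hs, hlb⟩ | ⟨hib', -⟩⟩ := A.sidePoint_eq_cross hl (h.symm.trans he)
    · exact ⟨hkb.trans hlb.symm, hr.trans hs.symm⟩
    · exact absurd hib' hib.ne
  · obtain ⟨-, ⟨hai', -⟩ | ⟨-, -, hs, hla⟩⟩ := A.sidePoint_eq_cross hl (h.symm.trans he)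
    · exact absurd hai' hai.ne'
    · exact ⟨hka.trans hla.symm, hr.trans hs.symm⟩

theorem onPart_inj (A : CrossingTimes S X) {i : Fin n} {k l : ℕ} {r s : Bool} {x : Point n}
    (h : OnPart S K i k r x) (h' : OnPart S K i l s x) :
    k = l ∧ ∀ m : Fin n, m.val = k → (i, m) ∈ K.corridors → r = s := by
  rcases onPart_cases h with
    ⟨k', u, rfl, rfl, hr⟩ | ⟨k', u, rfl, -, rfl⟩ | ⟨k', u, e, rfl, rfl, hr⟩ <;>
    rcases onPart_cases h' with ⟨l', v, rfl, hx, hs⟩ | ⟨l', v, rfl, -, hx⟩ |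
      ⟨l', v, e', rfl, hx, hs⟩
  · obtain ⟨-, rfl, rfl⟩ := Point.mid.inj hx
    refine ⟨rfl, fun m hm hc => ?_⟩
    obtain rfl := Fin.ext hm
    exact Bool.not_inj ((hr hc).symm.trans (hs hc))
  · exact nomatch hx
  · exact absurd hx.symm (A.sidePoint_ne_mid l'.2 _ _ _)
  · exact nomatch hx
  · obtain ⟨-, rfl, rfl, rfl⟩ := Point.cut.inj hx
    exact ⟨rfl, fun _ _ _ => rfl⟩
  · exact absurd hx.symm (A.sidePoint_ne_cut l'.2 _ _ _ _)
  · exact absurd hx (A.sidePoint_ne_mid k'.2 _ _ _)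
  · exact absurd hx (A.sidePoint_ne_cut k'.2 _ _ _ _)
  · obtain ⟨hkl, he⟩ := A.sidePoint_same k'.2 l'.2 hx
    refine ⟨hkl, fun m hm hc => ?_⟩
    obtain rfl := Fin.ext hm
    obtain rfl := Fin.ext hkl
    exact (hr hc).trans (he.trans (hs hc).symm)

theorem unseparated_of_onPart (A : CrossingTimes S X) {i : Fin n} {k l : ℕ} {r s : Bool}
    {x : Point n} (h : OnPart S K i k r x) (h' : OnPart S K i l s x) :
    Unseparated K i k r l s := by
  obtain ⟨rfl, hrs⟩ := A.onPart_inj h h'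
  exact unseparated_of_forall_eq hrs

theorem leftOfCut_iff (A : CrossingTimes S X) {i m : Fin n} {k : ℕ} {r : Bool} {x : Point n}
    (hx : OnPart S K i k r x) (hm : (i, m) ∈ K.corridors) :
    LeftOfCut S K i m x ↔ PartLeftOf k r m := by
  rw [leftOfCut_iff_exists hm]
  constructor
  · rintro ⟨l, s, hls, hleft⟩
    exact (A.unseparated_of_onPart hls hx m hm).1 hleft
  · exact fun h => ⟨k, r, hx, h⟩

theorem internalVisibility_adj_iff (A : CrossingTimes S X) {x y : PolygonVertex S K} :
    (internalVisibility S K).Adj x y ↔ x ≠ y ∧ ∃ i, CommonPiece S K i x.1 y.1 := by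
  refine and_congr_right fun _ => exists_congr fun i => ?_
  rw [onChannel_iff, onChannel_iff]
  constructor
  · rintro ⟨⟨k, r, hx⟩, ⟨l, s, hy⟩, h⟩
    refine ⟨k, r, l, s, hx, hy, fun m hm => ?_⟩
    rw [← A.leftOfCut_iff hx hm, ← A.leftOfCut_iff hy hm]
    exact h m hm
  · rintro ⟨k, r, l, s, hx, hy, h⟩
    refine ⟨⟨k, r, hx⟩, ⟨l, s, hy⟩, fun m hm => ?_⟩
    rw [A.leftOfCut_iff hx hm, A.leftOfCut_iff hy hm]
    exact h m hm

theorem partStep_ne (A : CrossingTimes S X) {i k : Fin n} {u r : Bool} {x y : Point n}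
    (h : PartStep S K i k u r x y) : x ≠ y := by
  rcases h with ⟨-, rfl, rfl⟩ | ⟨-, rfl, rfl⟩ | ⟨-, rfl, rfl⟩
  · exact A.partEnd_ne_mid _ _ _ _
  · exact (A.partEnd_ne_mid _ _ _ _).symm
  · intro he
    rcases partEnd_cases (S := S) (K := K) i k u r u with ⟨-, hu, hx⟩ | ⟨-, hx⟩ <;>
      rcases partEnd_cases (S := S) (K := K) i k u r (!u) with ⟨-, hnu, hy⟩ | ⟨-, hy⟩ <;>
      rw [hx, hy] at he
    · exact Bool.not_ne_self u (Bool.not_inj (hnu.symm.trans hu))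
    · exact A.sidePoint_ne_cut k.2 _ _ _ _ he.symm
    · exact A.sidePoint_ne_cut k.2 _ _ _ _ he
    · exact Bool.not_ne_self u (A.sidePoint_same k.2 k.2 he).2.symm

theorem boundaryStep_ne (A : CrossingTimes S X) {x y : Point n} (h : BoundaryStep S K x y) :
    x ≠ y := by
  rcases h.cases with ⟨i, k, u, r, hr⟩ | ⟨i, k, r, -, rfl, rfl⟩
  · exact A.partStep_ne hr
  · intro he
    exact Bool.not_ne_self r (Point.cut.inj he).2.2.1.symm

theorem isHamiltonianCycle (A : CrossingTimes S X) {P : Cycle (PolygonVertex S K)}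
    (hP : IsBoundaryCycle S K P) : IsHamiltonianCycle (internalVisibility S K) P :=
  ⟨hP.1, hP.2.1, hP.2.2.imp fun _ _ h => A.internalVisibility_adj_iff.2
    ⟨fun he => A.boundaryStep_ne h (congrArg Subtype.val he), h.exists_commonPiece⟩⟩

theorem crossingCorridor_lt (A : CrossingTimes S X) {i j : Fin n} (h : i ≠ j) (r : Bool) :
    crossingCorridor S X i j r < n := by
  have hlt := A.corridorAt_lt h.symm
  have hle := (!r).toNat_le
  unfold crossingCorridor
  omega

theorem sidePoint_crossing (A : CrossingTimes S X) {i j : Fin n} (h : i ≠ j) (u r : Bool) :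
    sidePoint S i (crossingCorridor S X i j r) u r = crossPoint i u j (r == decide (j < i)) := by
  unfold crossingCorridor
  rcases lt_or_gt_of_ne h with h' | h'
  · have hside := A.sidePoint_fst h' u (!r)
    rw [Bool.not_not] at hside
    simp [hside, crossPoint, h', h'.not_gt]
  · have hside := A.sidePoint_snd h' r u
    rw [A.symm] at hside
    simp [hside, crossPoint, h', h'.not_gt]

theorem onPart_crossPoint (A : CrossingTimes S X) {i j : Fin n} (h : i ≠ j) (u r : Bool) :
    OnPart S K i (crossingCorridor S X i j r) r (crossPoint i u j (r == decide (j < i))) := by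
  refine ⟨⟨_, A.crossingCorridor_lt h r⟩, u, rfl, mem_sidePart_iff.2 (Or.inr ⟨r, ?_⟩)⟩
  rw [partEnd_self, ← A.sidePoint_crossing h]

theorem exists_onPart_crossPoint (A : CrossingTimes S X) {i j : Fin n} (h : i ≠ j) (u v : Bool) :
    ∃ r, OnPart S K i (crossingCorridor S X i j r) r (crossPoint i u j v) := by
  have honPart := A.onPart_crossPoint (K := K) h u (v == decide (j < i))
  rw [show ((v == decide (j < i)) == decide (j < i)) = v by
    cases v <;> cases decide (j < i) <;> rfl] at honPart
  exact ⟨_, honPart⟩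

theorem isVertex_crossPoint (A : CrossingTimes S X) {i j : Fin n} (h : i ≠ j) (u v : Bool) :
    IsVertex S K (crossPoint i u j v) := by
  obtain ⟨r, k, u', -, hx⟩ := A.exists_onPart_crossPoint (K := K) h u v
  exact isVertex_iff.2 ⟨i, k, u', r, hx⟩

theorem inPiece_crossPoint_fst (A : CrossingTimes S X) {i j : Fin n} (h : i ≠ j) (u v : Bool) :
    InPiece S X K i j (crossPoint i u j v) :=
  let ⟨_, hr⟩ := A.exists_onPart_crossPoint h u v
  inPiece_of_onPart hr

theorem inPiece_crossPoint_snd (A : CrossingTimes S X) {i j : Fin n} (h : i ≠ j) (u v : Bool) :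
    InPiece S X K j i (crossPoint i u j v) := by
  rw [crossPoint_comm h]
  exact A.inPiece_crossPoint_fst h.symm v u

theorem inPiece_of_commonPiece (A : CrossingTimes S X) {i j : Fin n} {x y : Point n}
    (hx : InPiece S X K i j x) (h : CommonPiece S K i x y) : InPiece S X K i j y := by
  obtain ⟨k, r, hkx, hk⟩ := hx
  obtain ⟨l, s, l', s', hlx, hly, hl⟩ := h
  exact ⟨l', s', hly, hl.symm.trans ((A.unseparated_of_onPart hlx hkx).trans hk)⟩

theorem eq_crossPoint_of_sidePoint_eq (A : CrossingTimes S X) {i j : Fin n} (hij : i ≠ j)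
    {k l : ℕ} (hk : k < n) (hl : l < n) {u r v s : Bool}
    (h : sidePoint S i k u r = sidePoint S j l v s) :
    ∃ q, sidePoint S i k u r = crossPoint i u j q := by
  rcases A.sidePoint_cases (i := i) hk u r with
    ⟨-, -, he⟩ | ⟨-, -, he⟩ | ⟨b, q, hib, -, -, he⟩ | ⟨a, p, hai, -, -, he⟩
  · exact absurd (A.sidePoint_eq_leftEnd hl (h.symm.trans he)).1.symm hij
  · exact absurd (A.sidePoint_eq_rightEnd hl (h.symm.trans he)).1.symm hij
  · obtain ⟨-, ⟨hji, -⟩ | ⟨rfl, -⟩⟩ := A.sidePoint_eq_cross hl (h.symm.trans he)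
    · exact absurd hji.symm hij
    · exact ⟨q, by simp [he, crossPoint, hib]⟩
  · obtain ⟨-, ⟨rfl, -⟩ | ⟨hji, -⟩⟩ := A.sidePoint_eq_cross hl (h.symm.trans he)
    · exact ⟨p, by simp [he, crossPoint, hai.not_gt]⟩
    · exact absurd hji.symm hij

theorem eq_crossPoint_of_onPart (A : CrossingTimes S X) {i j : Fin n} (hij : i ≠ j) {k l : ℕ}
    {r s : Bool} {x : Point n} (h : OnPart S K i k r x) (h' : OnPart S K j l s x) :
    ∃ u v, x = crossPoint i u j v := by
  rcases onPart_cases h with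
    ⟨k', u, rfl, rfl, -⟩ | ⟨k', u, rfl, -, rfl⟩ | ⟨k', u, e, rfl, rfl, -⟩ <;>
    rcases onPart_cases h' with ⟨l', v, rfl, hx, -⟩ | ⟨l', v, rfl, -, hx⟩ | ⟨l', v, e', rfl, hx, -⟩
  · exact absurd (Point.mid.inj hx).1 hij
  · exact nomatch hx
  · exact absurd hx.symm (A.sidePoint_ne_mid l'.2 _ _ _)
  · exact nomatch hx
  · exact absurd (Point.cut.inj hx).1 hij
  · exact absurd hx.symm (A.sidePoint_ne_cut l'.2 _ _ _ _)
  · exact absurd hx (A.sidePoint_ne_mid k'.2 _ _ _)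
  · exact absurd hx (A.sidePoint_ne_cut k'.2 _ _ _ _)
  · exact ⟨u, A.eq_crossPoint_of_sidePoint_eq hij k'.2 l'.2 hx⟩

end CrossingTimes

end Pieces

/-! ## Doors -/

theorem exists_succ_of_isChain {α : Type*} {R : α → α → Prop} {x y : α} {L : List α}
    (h : List.IsChain R (x :: (L ++ [y]))) : ∀ p ∈ x :: L, ∃ q ∈ L ++ [y], R p q := by
  induction L generalizing x with
  | nil =>
    rw [List.nil_append, List.isChain_cons_cons] at h
    simpa using h.1
  | cons z L ih =>
    rw [List.cons_append, List.isChain_cons_cons] at h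
    intro p hp
    rcases List.mem_cons.1 hp with rfl | hp
    · exact ⟨z, by simp, h.1⟩
    · obtain ⟨q, hq, hR⟩ := ih h.2 p hp
      exact ⟨q, List.mem_cons_of_mem _ hq, hR⟩

theorem exists_succ_of_cycle_chain {α : Type*} {R : α → α → Prop} {x y : α} {L M : List α}
    (h : Cycle.Chain R ((x :: L ++ y :: M : List α) : Cycle α)) :
    (∀ p ∈ x :: L, ∃ q ∈ L ++ [y], R p q) ∧ (∀ p ∈ y :: M, ∃ q ∈ M ++ [x], R p q) := by
  rw [List.cons_append, Cycle.chain_coe_cons] at h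
  constructor
  · rw [show x :: (L ++ y :: M ++ [x]) = (x :: (L ++ [y])) ++ (M ++ [x]) by simp] at h
    exact exists_succ_of_isChain (List.isChain_append.1 h).1
  · rw [show x :: (L ++ y :: M ++ [x]) = (x :: L) ++ (y :: (M ++ [x])) by simp] at h
    exact exists_succ_of_isChain (List.isChain_append.1 h).2.1

theorem disjoint_of_nodup_split {α : Type*} {x y : α} {L M : List α}
    (hnd : (x :: L ++ y :: M).Nodup) : (L ++ [y]).Disjoint (M ++ [x]) := by
  refine List.disjoint_of_nodup_append ((List.Perm.nodup_iff ?_).2 hnd)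
  have rotate : (L ++ [y] ++ (M ++ [x])).Perm (x :: (L ++ [y] ++ M)) := by
    rw [← List.append_assoc]
    exact List.perm_append_singleton _ _
  simpa using rotate

theorem mem_cons_iff_mem_append_of_cycle_chain {α : Type*} {R : α → α → Prop}
    (hR : Relator.RightUnique R) {x y p q : α} {L M : List α} (hnd : (x :: L ++ y :: M).Nodup)
    (hch : Cycle.Chain R ((x :: L ++ y :: M : List α) : Cycle α)) (hp : p ∈ x :: L ++ y :: M)
    (hpq : R p q) : p ∈ x :: L ↔ q ∈ L ++ [y] := by
  obtain ⟨succ_L, succ_M⟩ := exists_succ_of_cycle_chain hch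
  constructor
  · intro hpL
    obtain ⟨q', hq', hpq'⟩ := succ_L p hpL
    rwa [hR hpq hpq']
  · intro hqL
    refine (List.mem_append.1 hp).resolve_right fun hpM => ?_
    obtain ⟨q', hq', hpq'⟩ := succ_M p hpM
    exact disjoint_of_nodup_split hnd hqL (hR hpq hpq' ▸ hq')

section Doors

variable {n : ℕ} {S : Fin n → List (Fin n)} {X : Fin n → Fin n → ℕ} {K : Cuts n}

theorem Unseparated.of_le_of_lt {i : Fin n} {k l q : ℕ} {r s : Bool}
    (h : Unseparated K i k r l s) (hkq : k ≤ q) (hql : q < l) : Unseparated K i k r q true := by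
  intro m hm
  have hm := h m hm
  simp only [PartLeftOf, Bool.true_eq_false, and_false, or_false] at hm ⊢
  constructor
  · intro hk
    have := hm.1 hk
    omega
  · omega

theorem Unseparated.exists_change_of_le {i : Fin n} {κ : ℕ → Bool → Prop}
    (huncut : ∀ k : Fin n, (i, k) ∉ K.corridors → (κ k false ↔ κ k true)) {k l : ℕ} {r s : Bool}
    (hl : l < n) (hkl : k ≤ l) (h : Unseparated K i k r l s) (hne : ¬ (κ k r ↔ κ l s)) :
    ∃ q, k ≤ q ∧ q < l ∧ ¬ (κ q true ↔ κ (q + 1) false) := by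
  have iff_same : ∀ m < n, ∀ t t', Unseparated K i m t m t' → (κ m t ↔ κ m t') := by
    intro m hm t t' hun
    by_cases hc : (i, ⟨m, hm⟩) ∈ K.corridors
    · have := hun _ hc
      simp only [PartLeftOf, lt_irrefl, false_or, true_and] at this
      rw [Bool.eq_iff_iff.2 (by simpa using not_congr this : t = true ↔ t' = true)]
    · have := huncut ⟨m, hm⟩ hc
      cases t <;> cases t' <;> simp only [this]
  contrapose! hne
  induction l, hkl using Nat.le_induction generalizing s with
  | base => exact iff_same k hl r s h
  | succ l hkl ih =>
    have before := h.of_le_of_lt hkl l.lt_succ_self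
    have after : Unseparated K i (l + 1) false (l + 1) s :=
      (unseparated_succ i l).symm.trans (before.symm.trans h)
    have ih := ih (by omega) before fun q hkq hql => hne q hkq (hql.trans l.lt_succ_self)
    exact ih.trans ((hne l hkl l.lt_succ_self).trans (iff_same _ hl _ _ after))

theorem Unseparated.exists_change {i : Fin n} {κ : ℕ → Bool → Prop}
    (huncut : ∀ k : Fin n, (i, k) ∉ K.corridors → (κ k false ↔ κ k true)) {k l : ℕ} {r s : Bool}
    (hk : k < n) (hl : l < n) (h : Unseparated K i k r l s) (hne : ¬ (κ k r ↔ κ l s)) :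
    ∃ q, q + 1 < n ∧ Unseparated K i k r q true ∧ ¬ (κ q true ↔ κ (q + 1) false) := by
  rcases le_total k l with hkl | hlk
  · obtain ⟨q, hkq, hql, hq⟩ := h.exists_change_of_le huncut hl hkl hne
    exact ⟨q, by omega, h.of_le_of_lt hkq hql, hq⟩
  · obtain ⟨q, hlq, hqk, hq⟩ := h.symm.exists_change_of_le huncut hk hlk (mt Iff.symm hne)
    exact ⟨q, by omega, h.trans (h.symm.of_le_of_lt hlq hqk), hq⟩

theorem eq_or_eq_of_crossPoint_eq {a b i j : Fin n} {u v u' v' : Bool}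
    (h : crossPoint a u b v = crossPoint i u' j v') : a = i ∧ b = j ∨ a = j ∧ b = i := by
  unfold crossPoint at h
  split_ifs at h <;> obtain ⟨rfl, -, rfl, -⟩ := Point.cross.inj h <;> simp

/-- The corner on the side `u` of the door `(i, j, r)`, the end `r` of the corridor of the
channel `i` that leads to the crossing with the channel `j`. -/
def doorPoint (i j : Fin n) (r u : Bool) : Point n := crossPoint i u j (r == decide (j < i))

theorem exists_doorPoint_eq_cross (i j : Fin n) (r u : Bool) :
    ∃ a p b q, doorPoint i j r u = .cross a p b q := by
  unfold doorPoint crossPoint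
  split_ifs <;> exact ⟨_, _, _, _, rfl⟩

/-- The boundary, traversed from the first corner `doorPoint i j r r` of a door to the second, is
colored with one color, and the rest of it with the other. As in `BoundaryColoring`, `E x` is the
color of the boundary edge that leaves `x`, and `F x` the color of the edge that enters `x`. -/
structure DoorColoring (S : Fin n → List (Fin n)) (K : Cuts n) (i j : Fin n) (r : Bool)
    (E F : Point n → Prop) : Prop where
  step : ∀ x y, BoundaryStep S K x y → (E x ↔ F y)
  iff_of_ne : ∀ x, (∀ u, x ≠ doorPoint i j r u) → (E x ↔ F x)
  start : E (doorPoint i j r r) ∧ ¬ F (doorPoint i j r r)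
  finish : ¬ E (doorPoint i j r !r) ∧ F (doorPoint i j r !r)

/-- The color of the part `r` of the corridor `(i, k)`, read off its upper side. -/
def partColor (S : Fin n → List (Fin n)) (E F : Point n → Prop) (i : Fin n) (k : ℕ) (r : Bool) :
    Prop :=
  BoundaryColoring.endColor S E F i k true r

namespace CrossingTimes

theorem rightUnique_boundaryStep (A : CrossingTimes S X) :
    Relator.RightUnique fun x y : PolygonVertex S K => BoundaryStep S K x.1 y.1 :=
  fun _ _ _ h h' => Subtype.ext (A.boundaryStep_unique h h')

theorem exists_crossing (A : CrossingTimes S X) (i : Fin n) {q : ℕ} (hq : q + 1 < n) :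
    ∃ j, i ≠ j ∧ ∀ r, crossingCorridor S X i j r = q + (!r).toNat := by
  have hm : q < (S i).length := by rw [A.length]; omega
  have hj : (S i)[q]? = some (S i)[q] := List.getElem?_eq_getElem hm
  refine ⟨(S i)[q], ((A.mem i _).1 (List.mem_of_getElem? hj)).symm, fun r => ?_⟩
  rw [crossingCorridor, (A.corridorAt_getElem hj).1]

theorem endColor_crossing (A : CrossingTimes S X) (E F : Point n → Prop) {i j : Fin n}
    (h : i ≠ j) (u r : Bool) :
    BoundaryColoring.endColor S E F i (crossingCorridor S X i j r) u r ↔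
      if u = r then E (doorPoint i j r u) else F (doorPoint i j r u) := by
  rw [BoundaryColoring.endColor, A.sidePoint_crossing h, doorPoint]

end CrossingTimes

namespace DoorColoring

open BoundaryColoring

variable {i j : Fin n} {r : Bool} {E F : Point n → Prop}

theorem iff_of_ne_cross (D : DoorColoring S K i j r E F) {x : Point n}
    (hx : ∀ a p b q, x ≠ .cross a p b q) : E x ↔ F x := by
  refine D.iff_of_ne x fun u hu => ?_
  obtain ⟨a, p, b, q, hdoor⟩ := exists_doorPoint_eq_cross i j r u
  exact hx a p b q (hu.trans hdoor)

theorem boundaryColoring (D : DoorColoring S K i j r E F) : BoundaryColoring S K E F where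
  step := D.step
  mid _ _ _ := D.iff_of_ne_cross nofun
  cut _ _ _ _ := D.iff_of_ne_cross nofun
  leftEnd _ := D.iff_of_ne_cross nofun
  rightEnd _ := D.iff_of_ne_cross nofun

theorem change_crossPoint (D : DoorColoring S K i j r E F) (u v : Bool) :
    change E F (crossPoint i u j v) = if v = (r == decide (j < i)) then 1 else 0 := by
  unfold change
  split_ifs with hEF hv hv
  · subst hv
    rcases Bool.eq_or_eq_not u r with rfl | rfl
    · exact absurd (hEF.1 D.start.1) D.start.2
    · exact absurd (hEF.2 D.finish.2) D.finish.1
  · rfl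
  · rfl
  · exact absurd (D.iff_of_ne _ fun u' h => hv (crossPoint_inj h).2) hEF

theorem sum_change (D : DoorColoring S K i j r E F) (a b : Fin n) (hab : a < b) :
    ∑ p, ∑ q, change E F (.cross a p b q) = 0 := by
  have cross_eq : ∀ p q, Point.cross a p b q = crossPoint a p b q := by simp [crossPoint, hab]
  by_cases h : a = i ∧ b = j
  · obtain ⟨rfl, rfl⟩ := h
    simp only [cross_eq, D.change_crossPoint, Finset.sum_const, Finset.card_univ, Fintype.card_bool,
      CharTwo.two_nsmul]
  by_cases h' : a = j ∧ b = i
  · obtain ⟨rfl, rfl⟩ := h'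
    simp only [cross_eq, crossPoint_comm hab.ne, D.change_crossPoint, Finset.sum_const,
      Finset.card_univ, Fintype.card_bool, CharTwo.two_nsmul]
  · refine Finset.sum_eq_zero fun p _ => Finset.sum_eq_zero fun q _ => if_pos ?_
    refine D.iff_of_ne _ fun u hu => ?_
    rcases eq_or_eq_of_crossPoint_eq ((cross_eq p q).symm.trans hu) with hij | hij
    · exact h hij
    · exact h' hij

theorem endColor_iff_partColor (D : DoorColoring S K i j r E F) (A : CrossingTimes S X)
    (hK : K.OpenAllHoles S) {m : Fin n} {k : ℕ} (hk : k < n) (u s : Bool) :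
    endColor S E F m k u s ↔ partColor S E F m k s := by
  cases u
  · exact D.boundaryColoring.endColor_lower_iff_upper A hK D.sum_change m ⟨k, hk⟩ s
  · exact Iff.rfl

theorem iff_partColor (D : DoorColoring S K i j r E F) (A : CrossingTimes S X)
    (hK : K.OpenAllHoles S) {m : Fin n} {k : ℕ} {s : Bool} {x : Point n}
    (hx : OnPart S K m k s x) (hEF : E x ↔ F x) : E x ↔ partColor S E F m k s := by
  obtain ⟨k, u, rfl, hx⟩ := hx
  rw [← D.endColor_iff_partColor A hK k.2 u, ← D.boundaryColoring.iff_endColor hx hEF]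

theorem not_partColor_snd (D : DoorColoring S K i j r E F) (A : CrossingTimes S X)
    (hK : K.OpenAllHoles S) (hij : i ≠ j) (s : Bool) :
    ¬ partColor S E F j (crossingCorridor S X j i s) s := by
  rw [← D.endColor_iff_partColor A hK (A.crossingCorridor_lt hij.symm s) (r == decide (j < i)),
    A.endColor_crossing E F hij.symm]
  have corner : doorPoint j i s (r == decide (j < i)) = doorPoint i j r (s == decide (i < j)) :=
    crossPoint_comm hij.symm _ _
  rw [corner, decide_lt_comm hij]
  obtain ⟨-, not_F⟩ := D.start
  obtain ⟨not_E, -⟩ := D.finish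
  revert not_F not_E
  cases r <;> cases s <;> cases decide (j < i) <;> simp +contextual

theorem partColor_crossing (D : DoorColoring S K i j r E F) (A : CrossingTimes S X)
    (hK : K.OpenAllHoles S) {a b : Fin n} (hab : a ≠ b)
    (hEF : ∀ u v, E (crossPoint a u b v) ↔ F (crossPoint a u b v)) (s t : Bool) :
    partColor S E F a (crossingCorridor S X a b s) s ↔
      partColor S E F b (crossingCorridor S X b a t) t := by
  have corner_a : ∀ u, E (crossPoint a u b (s == decide (b < a))) ↔
      partColor S E F a (crossingCorridor S X a b s) s := fun u =>
    D.iff_partColor A hK (A.onPart_crossPoint hab u s) (hEF _ _)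
  have corner_b : ∀ v, E (crossPoint a (t == decide (a < b)) b v) ↔
      partColor S E F b (crossingCorridor S X b a t) t := fun v =>
    D.iff_partColor A hK (crossPoint_comm hab _ _ ▸ A.onPart_crossPoint hab.symm v t) (hEF _ _)
  rw [← corner_a (t == decide (a < b)), corner_b]

theorem eq_crossingCorridor_of_change (D : DoorColoring S K i j r E F) (A : CrossingTimes S X)
    (hK : K.OpenAllHoles S) (hij : i ≠ j) {m : Fin n} {q : ℕ} (hq : q + 1 < n)
    (hne : ¬ (partColor S E F m q true ↔ partColor S E F m (q + 1) false)) :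
    m = i ∧ q = crossingCorridor S X i j true := by
  obtain ⟨l, hml, hcorridor⟩ := A.exists_crossing m hq
  obtain rfl : crossingCorridor S X m l true = q := hcorridor true
  rw [← show crossingCorridor S X m l false = _ + 1 from hcorridor false] at hne
  by_cases hEF : ∀ u v, E (crossPoint m u l v) ↔ F (crossPoint m u l v)
  · exact absurd ((D.partColor_crossing A hK hml hEF true true).trans
      (D.partColor_crossing A hK hml hEF false true).symm) hne
  · obtain ⟨u, v, u', hcorner⟩ : ∃ u v u', crossPoint m u l v = doorPoint i j r u' := by
      by_contra! hc
      exact hEF fun u v => D.iff_of_ne _ (hc u v)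
    rcases eq_or_eq_of_crossPoint_eq hcorner with ⟨rfl, rfl⟩ | ⟨rfl, rfl⟩
    · exact ⟨rfl, rfl⟩
    · exact absurd (iff_of_false (D.not_partColor_snd A hK hij true)
        (D.not_partColor_snd A hK hij false)) hne

theorem eq_and_unseparated (D : DoorColoring S K i j r E F) (A : CrossingTimes S X)
    (hK : K.OpenAllHoles S) (hij : i ≠ j) {m : Fin n} {k l : ℕ} {s t : Bool} (hk : k < n)
    (hl : l < n) (h : Unseparated K m k s l t) (hks : partColor S E F m k s)
    (hlt : ¬ partColor S E F m l t) :
    m = i ∧ Unseparated K i k s (crossingCorridor S X i j true) true := by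
  obtain ⟨q, hq, hkq, hchange⟩ := h.exists_change
    (fun p hp => D.boundaryColoring.endColor_uncut hp true false true) hk hl
    fun hiff => hlt (hiff.1 hks)
  obtain ⟨rfl, rfl⟩ := D.eq_crossingCorridor_of_change A hK hij hq hchange
  exact ⟨rfl, hkq⟩

end DoorColoring

/-- The corners `x` and `y` of the door `(i, j, r)`, in the order of the boundary, divide the
boundary `P` into the pocket `L` behind the door and the rest `M`. -/
structure SplitsAtDoor (S : Fin n → List (Fin n)) (K : Cuts n) (P : Cycle (PolygonVertex S K))
    (i j : Fin n) (r : Bool) (x y : PolygonVertex S K) (L M : List (PolygonVertex S K)) :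
    Prop where
  ne : i ≠ j
  start_eq : x.1 = doorPoint i j r r
  finish_eq : y.1 = doorPoint i j r !r
  eq : P = (x :: L ++ y :: M : List (PolygonVertex S K))

namespace SplitsAtDoor

variable {P : Cycle (PolygonVertex S K)} {i j : Fin n} {r : Bool} {x y : PolygonVertex S K}
  {L M : List (PolygonVertex S K)}

theorem nodup (d : SplitsAtDoor S K P i j r x y L M) (hP : IsBoundaryCycle S K P) :
    (x :: L ++ y :: M).Nodup := by
  have hnd := hP.1
  rwa [d.eq, Cycle.nodup_coe_iff] at hnd

theorem mem (d : SplitsAtDoor S K P i j r x y L M) (hP : IsBoundaryCycle S K P)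
    (w : PolygonVertex S K) : w ∈ x :: L ++ y :: M := by
  have hw := hP.2.1 w
  rwa [d.eq, Cycle.mem_coe_iff] at hw

theorem exists_doorColoring (d : SplitsAtDoor S K P i j r x y L M) (A : CrossingTimes S X)
    (hP : IsBoundaryCycle S K P) :
    ∃ E F, DoorColoring S K i j r E F ∧ (∀ w ∈ L, E w.1 ∧ F w.1) ∧
      ∀ w ∈ M, ¬ E w.1 ∧ ¬ F w.1 := by
  have val_mem : ∀ (l : List (PolygonVertex S K)) (w : PolygonVertex S K),
      (∃ v ∈ l, v.1 = w.1) ↔ w ∈ l := fun l w =>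
    ⟨fun ⟨_, hv, h⟩ => Subtype.ext h ▸ hv, fun h => ⟨w, h, rfl⟩⟩
  have hch := hP.2.2
  rw [d.eq] at hch
  have leave_disjoint : (x :: L).Disjoint (y :: M) := List.disjoint_of_nodup_append (d.nodup hP)
  have enter_disjoint : (L ++ [y]).Disjoint (M ++ [x]) := disjoint_of_nodup_split (d.nodup hP)
  refine ⟨fun p => ∃ w ∈ x :: L, w.1 = p, fun p => ∃ w ∈ L ++ [y], w.1 = p,
    ⟨fun p q hpq => ?_, fun p hp => ?_, ?_, ?_⟩, fun w hw => ?_, fun w hw => ?_⟩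
  · obtain ⟨p, rfl⟩ : ∃ w : PolygonVertex S K, w.1 = p := ⟨⟨p, hpq.isVertex.1⟩, rfl⟩
    obtain ⟨q, rfl⟩ : ∃ w : PolygonVertex S K, w.1 = q := ⟨⟨q, hpq.isVertex.2⟩, rfl⟩
    rw [val_mem, val_mem]
    exact mem_cons_iff_mem_append_of_cycle_chain A.rightUnique_boundaryStep (d.nodup hP) hch
      (d.mem hP p) hpq
  · have start_ne : x.1 ≠ p := d.start_eq ▸ (hp r).symm
    have finish_ne : y.1 ≠ p := d.finish_eq ▸ (hp !r).symm
    simp [start_ne, finish_ne]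
  · rw [← d.start_eq, val_mem, val_mem]
    exact ⟨by simp, fun h => enter_disjoint h (by simp)⟩
  · rw [← d.finish_eq, val_mem, val_mem]
    exact ⟨fun h => leave_disjoint h (by simp), by simp⟩
  · simp only [val_mem]
    exact ⟨List.mem_cons_of_mem _ hw, List.mem_append_left _ hw⟩
  · simp only [val_mem]
    exact ⟨fun h => leave_disjoint h (List.mem_cons_of_mem _ hw),
      fun h => enter_disjoint h (List.mem_append_left _ hw)⟩

end SplitsAtDoor

end Doors

/-! ## Blocking vertices -/

section Blocking

variable {V : Type*}

theorem eq_of_cycle_cons_eq {a : V} {l l' : List V} (hnd : (a :: l).Nodup)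
    (h : ((a :: l : List V) : Cycle V) = (a :: l' : List V)) : l = l' := by
  obtain ⟨k, hk⟩ := Cycle.coe_eq_coe.1 h
  rw [List.rotate_eq_drop_append_take_mod] at hk
  have split := List.take_append_drop (k % (a :: l).length) (a :: l)
  generalize List.take _ _ = u, List.drop _ _ = v at hk split
  match u, v with
  | [], v =>
    rw [List.append_nil] at hk
    exact (List.cons.inj (split.symm.trans hk)).2
  | c :: u, [] =>
    rw [List.append_nil] at split
    exact (List.cons.inj (split.symm.trans hk)).2
  | c :: u, d :: v =>
    obtain ⟨rfl, rfl⟩ := List.cons.inj split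
    obtain ⟨rfl, -⟩ := List.cons.inj hk
    simp at hnd

theorem exists_cycle_eq_cons_of_mem {a : V} {P : Cycle V} (h : a ∈ P) :
    ∃ L, P = (a :: L : List V) := by
  induction P using Quotient.inductionOn' with
  | h l =>
    rw [Cycle.mk''_eq_coe, Cycle.mem_coe_iff] at h
    obtain ⟨l₁, l₂, rfl⟩ := List.append_of_mem h
    exact ⟨l₂ ++ l₁, Cycle.coe_eq_coe.2 List.isRotated_append⟩

theorem cycle_coe_append_comm (l l' : List V) :
    ((l ++ l' : List V) : Cycle V) = (l' ++ l : List V) :=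
  Cycle.coe_eq_coe.2 List.isRotated_append

theorem append_cons_eq_append_cons_cases {a b : V} {l₁ l₂ r₁ r₂ : List V}
    (h : l₁ ++ a :: r₁ = l₂ ++ b :: r₂) :
    (l₁ = l₂ ∧ a = b ∧ r₁ = r₂) ∨ (a ∈ l₂ ∧ b ∈ r₁) ∨ (b ∈ l₁ ∧ a ∈ r₂) := by
  rcases List.append_eq_append_iff.1 h with ⟨c, rfl, hc⟩ | ⟨c, rfl, hc⟩
  · cases c with
    | nil => exact Or.inl ⟨(List.append_nil _).symm, List.cons.inj hc⟩
    | cons d c =>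
      obtain ⟨rfl, rfl⟩ := List.cons.inj hc
      exact Or.inr (Or.inl (by simp))
  · cases c with
    | nil => exact Or.inl ⟨List.append_nil _, (List.cons.inj hc).imp Eq.symm Eq.symm⟩
    | cons d c =>
      obtain ⟨rfl, rfl⟩ := List.cons.inj hc
      exact Or.inr (Or.inr (by simp))

theorem exists_append_cons_of_last {p : V → Prop} {l : List V} (h : ∃ x ∈ l, p x) :
    ∃ A o B, l = A ++ o :: B ∧ p o ∧ ∀ y ∈ B, ¬ p y := by
  induction l with
  | nil => simp at h
  | cons a l ih =>
    by_cases hl : ∃ x ∈ l, p x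
    · obtain ⟨A, o, B, rfl, ho, hB⟩ := ih hl
      exact ⟨a :: A, o, B, rfl, ho, hB⟩
    · obtain ⟨x, hx, hpx⟩ := h
      rcases List.mem_cons.1 hx with rfl | hx
      · exact ⟨[], x, l, rfl, hpx, fun y hy hpy => hl ⟨y, hy, hpy⟩⟩
      · exact absurd ⟨x, hx, hpx⟩ hl

variable {G : SimpleGraph V} {P : Cycle V}

theorem isBlockingVertex_reverse {p q o : V} :
    IsBlockingVertex G P.reverse p q o ↔ IsBlockingVertex G P p q o := by
  unfold IsBlockingVertex
  rw [Cycle.reverse_reverse, or_comm]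

theorem exists_last_neighbor (hP : IsHamiltonianCycle G P) {a b : V} (hab : a ≠ b)
    (hnadj : ¬ G.Adj a b) :
    ∃ C o B R, P = (a :: (C ++ o :: (B ++ b :: R)) : List V) ∧ G.Adj a o ∧
      ∀ y ∈ B ++ [b], ¬ G.Adj a y := by
  obtain ⟨L, rfl⟩ := exists_cycle_eq_cons_of_mem (hP.2.1 a)
  obtain ⟨M, R, rfl⟩ := List.append_of_mem
    ((List.mem_cons.1 (Cycle.mem_coe_iff.1 (hP.2.1 b))).resolve_left hab.symm)
  have neighbor_before_b : ∃ x ∈ M, G.Adj a x := by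
    obtain ⟨q, hq, haq⟩ := (exists_succ_of_cycle_chain hP.2.2).1 a List.mem_cons_self
    rcases List.mem_append.1 hq with hq | hq
    · exact ⟨q, hq, haq⟩
    · exact absurd (List.mem_singleton.1 hq ▸ haq) hnadj
  obtain ⟨C, o, B, rfl, hao, hB⟩ := exists_append_cons_of_last neighbor_before_b
  refine ⟨C, o, B, R, by simp, hao, fun y hy => ?_⟩
  rcases List.mem_append.1 hy with hy | hy
  · exact hB y hy
  · rwa [List.mem_singleton.1 hy]

theorem BlocksAlong.eq_last_neighbor {a b x o : V} {A N R : List V} (hnd : P.Nodup)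
    (hP : P = (a :: (A ++ x :: (N ++ b :: R)) : List V)) (hax : G.Adj a x)
    (hN : ∀ s ∈ N, ¬ G.Adj a s) (hao : G.Adj a o) (h : BlocksAlong G P a b o) :
    o = x ∧ ∀ s ∈ a :: A, ∀ t ∈ N ++ [b], ¬ G.Adj s t := by
  obtain ⟨A', B, C, hP', hB⟩ := h
  rw [hP, Cycle.nodup_coe_iff] at hnd
  have lists_eq : A ++ x :: N ++ b :: R = A' ++ o :: B ++ b :: C := by
    simpa using eq_of_cycle_cons_eq hnd (hP.symm.trans hP')
  have notMem_b : b ∉ A ++ x :: N ∧ b ∉ R := by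
    have middle : (A ++ x :: N ++ b :: R).Nodup := by simpa using (List.nodup_cons.1 hnd).2
    exact not_or.1 (mt List.mem_append.2 (List.nodup_cons.1 (List.nodup_middle.1 middle)).1)
  have prefix_eq := ((List.append_cons_inj_of_notMem notMem_b.1 notMem_b.2).1 lists_eq).1
  rcases append_cons_eq_append_cons_cases prefix_eq with ⟨rfl, rfl, rfl⟩ | ⟨-, ho⟩ | ⟨-, hx⟩
  · exact ⟨rfl, hB⟩
  · exact absurd hao (hN o ho)
  · exact absurd hax (hB a List.mem_cons_self x (List.mem_append_left _ hx))

/-- A blocking vertex that `a` sees is the last vertex before `b` that `a` sees: in one direction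
this is `x`, and in the other it is `y`, which does not block since `z` sees `w` past it. -/
theorem blockingVertex_iff_eq (hnd : P.Nodup) {a b x y z w : V} {A N M T : List V}
    (hP : P = (a :: (A ++ x :: (N ++ b :: (M ++ y :: T))) : List V)) (hax : G.Adj a x)
    (hay : G.Adj a y) (hNA : ∀ s ∈ N ++ b :: M, ∀ t ∈ a :: A, ¬ G.Adj s t) (hz : z ∈ T)
    (hw : w ∈ b :: M) (hzw : G.Adj z w) (o : V) :
    (G.Adj a o ∧ IsBlockingVertex G P a b o) ↔ o = x := by
  constructor
  · rintro ⟨hao, h | h⟩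
    · exact (h.eq_last_neighbor hnd hP hax (fun s hs has =>
        hNA s (List.mem_append_left _ hs) a List.mem_cons_self has.symm) hao).1
    · have hPrev : P.reverse = (a :: (T.reverse ++ y :: (M.reverse ++
          b :: (N.reverse ++ x :: A.reverse))) : List V) := by
        rw [hP, Cycle.reverse_coe, List.reverse_cons, cycle_coe_append_comm]
        simp
      obtain ⟨-, hTM⟩ := h.eq_last_neighbor (Cycle.nodup_reverse_iff.2 hnd) hPrev hay
        (fun s hs has => hNA s (by simp [List.mem_reverse.1 hs]) a List.mem_cons_self has.symm) hao
      exact absurd hzw (hTM z (by simp [hz]) w (by simpa [or_comm] using hw))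
  · rintro rfl
    refine ⟨hax, Or.inl ⟨A, N, M ++ y :: T, hP, fun s hs t ht hst => hNA t ?_ s hs hst.symm⟩⟩
    rcases List.mem_append.1 ht with ht | ht
    · exact List.mem_append_left _ ht
    · simp [List.mem_singleton.1 ht]

end Blocking

section Pockets

variable {n : ℕ} {S : Fin n → List (Fin n)} {X : Fin n → Fin n → ℕ} {K : Cuts n}

theorem OnPart.lt {i : Fin n} {k : ℕ} {r : Bool} {x : Point n} (h : OnPart S K i k r x) :
    k < n := by
  obtain ⟨k, -, rfl, -⟩ := h
  exact k.2

theorem doorPoint_not_self {i j : Fin n} (hij : i ≠ j) (r : Bool) :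
    doorPoint i j r (!r) = doorPoint j i (r == decide (j < i)) (r == decide (j < i)) := by
  unfold doorPoint
  rw [crossPoint_comm hij.symm, decide_lt_comm hij]
  cases r <;> cases decide (j < i) <;> rfl

theorem doorPoint_ne_next {i j : Fin n} (hij : i ≠ j) (r u : Bool) :
    doorPoint j i (r == decide (j < i)) (!(r == decide (j < i))) ≠ doorPoint i j r u := by
  unfold doorPoint
  rw [crossPoint_comm hij.symm]
  exact fun h => Bool.not_ne_self _ (crossPoint_inj h).2

theorem doorPoint_not_ne (i j : Fin n) (r u u' : Bool) :
    doorPoint i j (!r) u ≠ doorPoint i j r u' := fun h => by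
  have ends := (crossPoint_inj h).2
  revert ends
  cases r <;> cases decide (j < i) <;> simp

theorem crossPoint_eq_doorPoint {i j : Fin n} (hij : i ≠ j) (u v : Bool) :
    crossPoint i u j v = doorPoint i j u u ∨ crossPoint i u j v = doorPoint j i v v := by
  unfold doorPoint
  rw [crossPoint_comm hij.symm, decide_lt_comm hij]
  cases u <;> cases v <;> cases decide (j < i) <;> simp

namespace CrossingTimes

theorem adj_of_inPiece (A : CrossingTimes S X) {i j : Fin n} {x y : PolygonVertex S K}
    (hne : x ≠ y) (hx : InPiece S X K i j x.1) (hy : InPiece S X K i j y.1) :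
    (internalVisibility S K).Adj x y :=
  A.internalVisibility_adj_iff.2 ⟨hne, i, commonPiece_of_inPiece hx hy⟩

theorem inPiece_doorPoint_fst (A : CrossingTimes S X) {i j : Fin n} (hij : i ≠ j) (r u : Bool) :
    InPiece S X K i j (doorPoint i j r u) :=
  A.inPiece_crossPoint_fst hij _ _

theorem inPiece_doorPoint_snd (A : CrossingTimes S X) {i j : Fin n} (hij : i ≠ j) (r u : Bool) :
    InPiece S X K j i (doorPoint i j r u) :=
  A.inPiece_crossPoint_snd hij _ _

theorem inPiece_of_step_doorPoint (A : CrossingTimes S X) {i j : Fin n} (hij : i ≠ j) {r : Bool}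
    {w : Point n} (h : BoundaryStep S K (doorPoint i j r r) w) : InPiece S X K i j w := by
  obtain ⟨z, hz⟩ := exists_partStep_of_start (S := S) (K := K) i
    ⟨_, A.crossingCorridor_lt hij r⟩ r r
  have leaves_door := hz.boundaryStep
  rw [partEnd_self, A.sidePoint_crossing hij] at leaves_door
  rw [A.boundaryStep_unique h leaves_door]
  exact inPiece_of_onPart (r := r) ⟨_, _, rfl, hz.mem.2⟩

theorem exists_door_of_not_adj_succ (A : CrossingTimes S X) {a o y : PolygonVertex S K}
    (hao : (internalVisibility S K).Adj a o) (hoy : BoundaryStep S K o.1 y.1) (hya : y ≠ a)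
    (hay : ¬ (internalVisibility S K).Adj a y) :
    ∃ i j r, i ≠ j ∧ o.1 = doorPoint i j r r ∧ InPiece S X K j i a.1 ∧
      ¬ InPiece S X K i j a.1 := by
  obtain ⟨-, j, hoa⟩ := A.internalVisibility_adj_iff.1 hao.symm
  obtain ⟨i, hoy_i⟩ := hoy.exists_commonPiece
  have not_common : ¬ CommonPiece S K j a.1 y.1 := fun h =>
    hay (A.internalVisibility_adj_iff.2 ⟨hya.symm, j, h⟩)
  obtain ⟨k, s, l, t, hok, hal, hkl⟩ := hoa
  obtain ⟨k', s', l', t', hok', hyl', hkl'⟩ := hoy_i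
  have hij : i ≠ j := by
    rintro rfl
    exact not_common ⟨l, t, l', t', hal, hyl',
      hkl.symm.trans ((A.unseparated_of_onPart hok hok').trans hkl')⟩
  obtain ⟨u, v, ho⟩ := A.eq_crossPoint_of_onPart hij hok' hok
  have haj : InPiece S X K j i a.1 :=
    A.inPiece_of_commonPiece (ho ▸ A.inPiece_crossPoint_snd hij u v) ⟨k, s, l, t, hok, hal, hkl⟩
  have hyi : InPiece S X K i j y.1 :=
    A.inPiece_of_commonPiece (ho ▸ A.inPiece_crossPoint_fst hij u v)
      ⟨k', s', l', t', hok', hyl', hkl'⟩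
  have hai : ¬ InPiece S X K i j a.1 := fun h => hay (A.adj_of_inPiece hya.symm h hyi)
  rcases crossPoint_eq_doorPoint hij u v with hu | hv
  · exact ⟨i, j, u, hij, ho.trans hu, haj, hai⟩
  · have hyj : InPiece S X K j i y.1 :=
      A.inPiece_of_step_doorPoint hij.symm (ho.trans hv ▸ hoy)
    exact absurd (A.adj_of_inPiece hya.symm haj hyj) hay

end CrossingTimes

namespace SplitsAtDoor

variable {P : Cycle (PolygonVertex S K)} {i j : Fin n} {r : Bool} {x y : PolygonVertex S K}
  {L M : List (PolygonVertex S K)}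

theorem inPiece_of_adj (d : SplitsAtDoor S K P i j r x y L M) (A : CrossingTimes S X)
    (hK : K.OpenAllHoles S) (hP : IsBoundaryCycle S K P) {v w : PolygonVertex S K} (hv : v ∈ L)
    (hw : w ∈ M) (h : (internalVisibility S K).Adj v w) :
    InPiece S X K i j v.1 ∧ InPiece S X K i j w.1 := by
  obtain ⟨E, F, D, inside, outside⟩ := d.exists_doorColoring A hP
  obtain ⟨-, m, k, s, l, t, hvk, hwl, hkl⟩ := A.internalVisibility_adj_iff.1 h
  have hks := (D.iff_partColor A hK hvk (iff_of_true (inside v hv).1 (inside v hv).2)).1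
    (inside v hv).1
  have hlt := mt (D.iff_partColor A hK hwl (iff_of_false (outside w hw).1 (outside w hw).2)).2
    (outside w hw).1
  obtain ⟨rfl, hdoor⟩ := D.eq_and_unseparated A hK d.ne hvk.lt hwl.lt hkl hks hlt
  exact ⟨⟨k, s, hvk, hdoor⟩, l, t, hwl, hkl.symm.trans hdoor⟩

theorem not_inPiece_of_mem (d : SplitsAtDoor S K P i j r x y L M) (A : CrossingTimes S X)
    (hK : K.OpenAllHoles S) (hP : IsBoundaryCycle S K P) {v : PolygonVertex S K} (hv : v ∈ L) :
    ¬ InPiece S X K j i v.1 := by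
  obtain ⟨E, F, D, inside, -⟩ := d.exists_doorColoring A hP
  rintro ⟨k, s, hvk, hdoor⟩
  have hks := (D.iff_partColor A hK hvk (iff_of_true (inside v hv).1 (inside v hv).2)).1
    (inside v hv).1
  exact d.ne.symm (D.eq_and_unseparated A hK d.ne hvk.lt (A.crossingCorridor_lt d.ne.symm true)
    hdoor hks (D.not_partColor_snd A hK d.ne true)).1

theorem mem_right_of_inPiece (d : SplitsAtDoor S K P i j r x y L M) (A : CrossingTimes S X)
    (hK : K.OpenAllHoles S) (hP : IsBoundaryCycle S K P) {w : PolygonVertex S K}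
    (hw : InPiece S X K j i w.1) (hx : w ≠ x) (hy : w ≠ y) : w ∈ M := by
  have hmem := d.mem hP w
  simp only [List.cons_append, List.mem_cons, List.mem_append] at hmem
  rcases hmem with h | h | h | h
  · exact absurd h hx
  · exact absurd hw (d.not_inPiece_of_mem A hK hP h)
  · exact absurd h hy
  · exact h

theorem inPiece_head {w : PolygonVertex S K} (d : SplitsAtDoor S K P i j r x y (w :: L) M)
    (A : CrossingTimes S X) (hP : IsBoundaryCycle S K P) : InPiece S X K i j w.1 := by
  have hch := hP.2.2
  rw [d.eq, List.cons_append, List.cons_append, Cycle.chain_coe_cons, List.cons_append,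
    List.isChain_cons_cons] at hch
  exact A.inPiece_of_step_doorPoint d.ne (d.start_eq ▸ hch.1)

theorem inPiece_getLast {w : PolygonVertex S K} (d : SplitsAtDoor S K P i j r x y (L ++ [w]) M)
    (A : CrossingTimes S X) (hP : IsBoundaryCycle S K P) : InPiece S X K i j w.1 := by
  obtain ⟨z, hz⟩ := exists_partStep_of_end (S := S) (K := K) i
    ⟨_, A.crossingCorridor_lt d.ne r⟩ (!r) r
  have enters_door : BoundaryStep S K z y.1 := by
    have step := hz.boundaryStep
    rwa [Bool.not_not, partEnd_self, A.sidePoint_crossing d.ne, ← doorPoint, ← d.finish_eq] at step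
  obtain ⟨z, rfl⟩ : ∃ v : PolygonVertex S K, v.1 = z := ⟨⟨z, enters_door.isVertex.1⟩, rfl⟩
  suffices z = w from this ▸ inPiece_of_onPart (r := r) ⟨_, _, rfl, hz.mem.1⟩
  have mem_iff := fun (L' M' : List (PolygonVertex S K)) (y' : PolygonVertex S K)
      (h : P = (x :: L' ++ y' :: M' : List _)) =>
    mem_cons_iff_mem_append_of_cycle_chain A.rightUnique_boundaryStep
      (Cycle.nodup_coe_iff.1 (h ▸ hP.1)) (h ▸ hP.2.2) (Cycle.mem_coe_iff.1 (h ▸ hP.2.1 z))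
      enters_door
  have z_mem : z ∈ x :: (L ++ [w]) := (mem_iff _ _ _ d.eq).2 (by simp)
  have z_notMem : z ∉ x :: L := by
    refine mt (mem_iff L (y :: M) w (by simp [d.eq])).1 fun h => ?_
    exact List.disjoint_of_nodup_append (d.nodup hP) (List.mem_cons_of_mem _ h) List.mem_cons_self
  rw [← List.cons_append] at z_mem
  exact List.mem_singleton.1 ((List.mem_append.1 z_mem).resolve_left z_notMem)

theorem exists_inPiece_suffix {b : PolygonVertex S K} {N₁ N₂ : List (PolygonVertex S K)}
    (d : SplitsAtDoor S K P i j r x y (N₁ ++ b :: N₂) M) (A : CrossingTimes S X)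
    (hP : IsBoundaryCycle S K P) : ∃ w ∈ b :: N₂, InPiece S X K i j w.1 := by
  rw [← List.dropLast_append_getLast (List.cons_ne_nil b N₂), ← List.append_assoc] at d
  exact ⟨_, List.getLast_mem (List.cons_ne_nil b N₂), d.inPiece_getLast A hP⟩

theorem exists_inPiece_initial {b : PolygonVertex S K} {N₁ N₂ : List (PolygonVertex S K)}
    (d : SplitsAtDoor S K P i j r x y (N₁ ++ b :: N₂) M) (A : CrossingTimes S X)
    (hP : IsBoundaryCycle S K P) : ∃ w ∈ b :: N₁, InPiece S X K i j w.1 := by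
  cases N₁ with
  | nil => exact ⟨b, List.mem_cons_self, d.inPiece_head A hP⟩
  | cons c N₁ => exact ⟨c, by simp, d.inPiece_head A hP⟩

theorem next {v : Bool} {z : PolygonVertex S K} {W R : List (PolygonVertex S K)}
    (d : SplitsAtDoor S K P i j r x y L (W ++ z :: R)) (hv : v = (r == decide (j < i)))
    (hz : z.1 = doorPoint j i v !v) : SplitsAtDoor S K P j i v y z W (R ++ x :: L) where
  ne := d.ne.symm
  start_eq := by rw [d.finish_eq, doorPoint_not_self d.ne, hv]
  finish_eq := hz
  eq := by
    rw [d.eq, cycle_coe_append_comm]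
    simp

theorem exists_next_corner (d : SplitsAtDoor S K P i j r x y L M) (A : CrossingTimes S X)
    (hK : K.OpenAllHoles S) (hP : IsBoundaryCycle S K P) {v : Bool}
    (hv : v = (r == decide (j < i))) : ∃ z ∈ M, z.1 = doorPoint j i v !v := by
  refine ⟨⟨_, A.isVertex_crossPoint d.ne.symm _ _⟩, ?_, rfl⟩
  have ne_corner : ∀ u, doorPoint j i v (!v) ≠ doorPoint i j r u :=
    hv ▸ doorPoint_ne_next d.ne r
  exact d.mem_right_of_inPiece A hK hP (A.inPiece_doorPoint_fst d.ne.symm v !v)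
    (fun h => ne_corner r (d.start_eq ▸ congrArg Subtype.val h))
    (fun h => ne_corner (!r) (d.finish_eq ▸ congrArg Subtype.val h))

end SplitsAtDoor

/-- The doors `(i, j, r)`, `(j, i, v)`, `(i, j, !r)` and `(j, i, !v)` around the crossing of the
channels `i` and `j`, met by the boundary `P` in this order at the corners `x₁`, `x₂`, `x₃`, `x₄`,
where `v` is the end of the corridor of `j` that makes the second door start at `x₂`. The list `Lₖ`
is the pocket that starts behind `xₖ`. -/
structure FourPockets (S : Fin n → List (Fin n)) (K : Cuts n) (P : Cycle (PolygonVertex S K))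
    (i j : Fin n) (r v : Bool) (x₁ x₂ x₃ x₄ : PolygonVertex S K)
    (L₁ L₂ L₃ L₄ : List (PolygonVertex S K)) : Prop where
  door₁ : SplitsAtDoor S K P i j r x₁ x₂ L₁ (L₂ ++ x₃ :: (L₃ ++ x₄ :: L₄))
  door₂ : SplitsAtDoor S K P j i v x₂ x₃ L₂ (L₃ ++ x₄ :: (L₄ ++ x₁ :: L₁))
  door₃ : SplitsAtDoor S K P i j (!r) x₃ x₄ L₃ (L₄ ++ x₁ :: (L₁ ++ x₂ :: L₂))
  door₄ : SplitsAtDoor S K P j i (!v) x₄ x₁ L₄ (L₁ ++ x₂ :: (L₂ ++ x₃ :: L₃))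

namespace CrossingTimes

variable {P : Cycle (PolygonVertex S K)}

theorem exists_splitsAtDoor (A : CrossingTimes S X) (hP : IsBoundaryCycle S K P) {i j : Fin n}
    (hij : i ≠ j) {r : Bool} {x : PolygonVertex S K} (hx : x.1 = doorPoint i j r r) :
    ∃ y L M, SplitsAtDoor S K P i j r x y L M := by
  obtain ⟨R, hR⟩ := exists_cycle_eq_cons_of_mem (hP.2.1 x)
  let y : PolygonVertex S K := ⟨doorPoint i j r !r, A.isVertex_crossPoint hij _ _⟩
  have hyx : y ≠ x := fun h => Bool.not_ne_self r (crossPoint_inj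
    ((congrArg Subtype.val h).trans hx)).1
  have hyR : y ∈ R := (List.mem_cons.1 (Cycle.mem_coe_iff.1 (hR ▸ hP.2.1 y))).resolve_left hyx
  obtain ⟨L, M, rfl⟩ := List.append_of_mem hyR
  exact ⟨y, L, M, hij, hx, rfl, hR⟩

theorem exists_fourPockets (A : CrossingTimes S X) (hK : K.OpenAllHoles S)
    (hP : IsBoundaryCycle S K P) {i j : Fin n} (hij : i ≠ j) {r : Bool}
    {x₁ : PolygonVertex S K} (hx₁ : x₁.1 = doorPoint i j r r) :
    ∃ v x₂ x₃ x₄ L₁ L₂ L₃ L₄, FourPockets S K P i j r v x₁ x₂ x₃ x₄ L₁ L₂ L₃ L₄ := by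
  obtain ⟨x₂, L₁, M, door₁⟩ := A.exists_splitsAtDoor hP hij hx₁
  obtain ⟨v, hv⟩ : ∃ v, v = (r == decide (j < i)) := ⟨_, rfl⟩
  have hr : (!r) = (v == decide (i < j)) := by
    rw [hv, decide_lt_comm hij]
    cases r <;> cases decide (j < i) <;> rfl
  have hv' : (!v) = ((!r) == decide (j < i)) := by
    rw [hv]
    cases r <;> cases decide (j < i) <;> rfl
  have hr' : r = ((!v) == decide (i < j)) := by
    rw [hv, decide_lt_comm hij]
    cases r <;> cases decide (j < i) <;> rfl
  obtain ⟨x₃, hx₃, x₃_eq⟩ := door₁.exists_next_corner A hK hP hv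
  obtain ⟨L₂, R, rfl⟩ := List.append_of_mem hx₃
  have door₂ := door₁.next hv x₃_eq
  obtain ⟨x₄, hx₄, x₄_eq⟩ := door₂.exists_next_corner A hK hP hr
  have x₄_mem_R : x₄ ∈ R := by
    refine (List.mem_append.1 hx₄).resolve_right fun h => ?_
    rcases List.mem_cons.1 h with rfl | h
    · exact doorPoint_not_ne i j r _ _ (x₄_eq.symm.trans hx₁)
    · exact door₁.not_inPiece_of_mem A hK hP h (x₄_eq ▸ A.inPiece_doorPoint_snd hij _ _)
  obtain ⟨L₃, L₄, rfl⟩ := List.append_of_mem x₄_mem_R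
  rw [List.append_assoc, List.cons_append] at door₂
  have door₃ := door₂.next hr x₄_eq
  rw [List.append_assoc, List.cons_append] at door₃
  have x₁_eq : x₁.1 = doorPoint j i (!v) !!v := by
    rw [hx₁, doorPoint_not_self hij.symm, ← hr']
  have door₄ := door₃.next hv' x₁_eq
  rw [List.append_assoc, List.cons_append] at door₄
  exact ⟨v, x₂, x₃, x₄, L₁, L₂, L₃, L₄, door₁, door₂, door₃, door₄⟩

end CrossingTimes

namespace FourPockets

variable {P : Cycle (PolygonVertex S K)} {i j : Fin n} {r v : Bool}
  {x₁ x₂ x₃ x₄ : PolygonVertex S K} {L₁ L₂ L₃ L₄ : List (PolygonVertex S K)}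

theorem inPiece_corners (F : FourPockets S K P i j r v x₁ x₂ x₃ x₄ L₁ L₂ L₃ L₄)
    (A : CrossingTimes S X) :
    ∀ x ∈ [x₁, x₂, x₃, x₄], InPiece S X K i j x.1 ∧ InPiece S X K j i x.1 := by
  have corner : ∀ {x : PolygonVertex S K} {r u}, x.1 = doorPoint i j r u →
      InPiece S X K i j x.1 ∧ InPiece S X K j i x.1 := fun h =>
    h ▸ ⟨A.inPiece_doorPoint_fst F.door₁.ne _ _, A.inPiece_doorPoint_snd F.door₁.ne _ _⟩
  simp only [List.forall_mem_cons, List.not_mem_nil, false_imp_iff, implies_true, and_true]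
  exact ⟨corner F.door₁.start_eq, corner F.door₁.finish_eq, corner F.door₃.start_eq,
    corner F.door₃.finish_eq⟩

theorem mem_of_inPiece (F : FourPockets S K P i j r v x₁ x₂ x₃ x₄ L₁ L₂ L₃ L₄)
    (A : CrossingTimes S X) (hK : K.OpenAllHoles S) (hP : IsBoundaryCycle S K P)
    {a : PolygonVertex S K} (haj : InPiece S X K j i a.1) (hai : ¬ InPiece S X K i j a.1) :
    a ∈ L₄ ∨ a ∈ L₂ := by
  have ne_corner : ∀ x ∈ [x₁, x₂, x₃, x₄], a ≠ x := fun x hx h =>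
    hai (h ▸ (F.inPiece_corners A x hx).1)
  have notMem₁ : a ∉ L₁ := fun h => F.door₁.not_inPiece_of_mem A hK hP h haj
  have notMem₃ : a ∉ L₃ := fun h => F.door₃.not_inPiece_of_mem A hK hP h haj
  have hmem := F.door₁.mem hP a
  simp only [List.forall_mem_cons] at ne_corner
  simp only [List.cons_append, List.mem_cons, List.mem_append] at hmem
  tauto

/-- No vertex blocks in the other direction, since `x₃` sees past `x₂` into the first pocket. -/
theorem blockingVertex_iff_of_mem_fourth (F : FourPockets S K P i j r v x₁ x₂ x₃ x₄ L₁ L₂ L₃ L₄)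
    (A : CrossingTimes S X) (hK : K.OpenAllHoles S) (hP : IsBoundaryCycle S K P)
    {a b : PolygonVertex S K} (ha : a ∈ L₄) (hb : b ∈ L₁)
    (haj : InPiece S X K j i a.1) (hai : ¬ InPiece S X K i j a.1) (o : PolygonVertex S K) :
    ((internalVisibility S K).Adj a o ∧ IsBlockingVertex (internalVisibility S K) P a b o) ↔
      o = x₁ := by
  have corners := F.inPiece_corners A
  have a_sees : ∀ x ∈ [x₁, x₂, x₃, x₄], (internalVisibility S K).Adj a x := fun x hx =>
    A.adj_of_inPiece (fun h => hai (h ▸ (corners x hx).1)) haj (corners x hx).2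
  have not_adj : ∀ s ∈ L₁, ∀ t ∈ L₄, ¬ (internalVisibility S K).Adj s t := fun s hs t ht hst =>
    F.door₄.not_inPiece_of_mem A hK hP ht
      (F.door₁.inPiece_of_adj A hK hP hs (by simp [ht]) hst).2
  have x₃_notMem : x₃ ∉ L₁ := fun h =>
    List.disjoint_of_nodup_append (F.door₁.nodup hP) (List.mem_cons_of_mem _ h) (by simp)
  obtain ⟨N₁, N₂, rfl⟩ := List.append_of_mem hb
  obtain ⟨E₁, E₂, rfl⟩ := List.append_of_mem ha
  obtain ⟨w, hw, hwi⟩ := F.door₁.exists_inPiece_suffix A hP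
  refine blockingVertex_iff_eq (A := E₂) (N := N₁) (M := N₂) (z := x₃) (w := w)
    (T := L₂ ++ x₃ :: L₃ ++ x₄ :: E₁) hP.1 ?_ (a_sees x₁ (by simp)) (a_sees x₂ (by simp))
    (fun s hs t ht => not_adj s hs t (List.mem_append_right _ ht)) (by simp) hw
    (A.adj_of_inPiece (fun h => x₃_notMem (h ▸ List.mem_append_right _ hw))
      (corners x₃ (by simp)).1 hwi) o
  rw [F.door₄.eq, List.cons_append, List.append_assoc, ← List.cons_append, cycle_coe_append_comm]
  simp

theorem blockingVertex_iff_of_mem_second (F : FourPockets S K P i j r v x₁ x₂ x₃ x₄ L₁ L₂ L₃ L₄)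
    (A : CrossingTimes S X) (hK : K.OpenAllHoles S) (hP : IsBoundaryCycle S K P)
    {a b : PolygonVertex S K} (ha : a ∈ L₂) (hb : b ∈ L₁)
    (haj : InPiece S X K j i a.1) (hai : ¬ InPiece S X K i j a.1) (o : PolygonVertex S K) :
    ((internalVisibility S K).Adj a o ∧ IsBlockingVertex (internalVisibility S K) P a b o) ↔
      o = x₂ := by
  have corners := F.inPiece_corners A
  have a_sees : ∀ x ∈ [x₁, x₂, x₃, x₄], (internalVisibility S K).Adj a x := fun x hx =>
    A.adj_of_inPiece (fun h => hai (h ▸ (corners x hx).1)) haj (corners x hx).2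
  have not_adj : ∀ s ∈ L₁, ∀ t ∈ L₂, ¬ (internalVisibility S K).Adj s t := fun s hs t ht hst =>
    F.door₂.not_inPiece_of_mem A hK hP ht
      (F.door₁.inPiece_of_adj A hK hP hs (List.mem_append_left _ ht) hst).2
  have x₄_notMem : x₄ ∉ L₁ := fun h =>
    List.disjoint_of_nodup_append (F.door₁.nodup hP) (List.mem_cons_of_mem _ h) (by simp)
  obtain ⟨N₁, N₂, rfl⟩ := List.append_of_mem hb
  obtain ⟨W₁, W₂, rfl⟩ := List.append_of_mem ha
  obtain ⟨w, hw, hwi⟩ := F.door₁.exists_inPiece_initial A hP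
  have hw' : w ∈ N₁ ++ b :: N₂ := by
    rcases List.mem_cons.1 hw with rfl | hw <;> simp [*]
  rw [← isBlockingVertex_reverse (P := P)]
  refine blockingVertex_iff_eq (A := W₁.reverse) (N := N₂.reverse) (M := N₁.reverse) (z := x₄)
    (w := w) (T := L₄.reverse ++ x₄ :: L₃.reverse ++ x₃ :: W₂.reverse)
    (Cycle.nodup_reverse_iff.2 hP.1) ?_ (a_sees x₂ (by simp)) (a_sees x₁ (by simp))
    (fun s hs t ht => not_adj s ?_ t ?_) (by simp) ?_
    (A.adj_of_inPiece (fun h => x₄_notMem (h ▸ hw')) (corners x₄ (by simp)).1 hwi) o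
  · have hPa : P = (W₂ ++ x₃ :: (L₃ ++ x₄ :: (L₄ ++ x₁ :: (N₁ ++ b :: N₂))) ++
        (x₂ :: W₁ ++ [a]) : List _) := by
      rw [F.door₂.eq, cycle_coe_append_comm _ (x₂ :: W₁ ++ [a])]
      simp
    rw [hPa, Cycle.reverse_coe]
    simp
  · simpa [or_comm, or_left_comm, or_assoc] using hs
  · simp only [List.mem_cons, List.mem_reverse, List.mem_append] at ht ⊢
    tauto
  · simpa using hw

end FourPockets

namespace CrossingTimes

variable {P : Cycle (PolygonVertex S K)}

theorem exists_blockingVertex_iff_eq (A : CrossingTimes S X) (hK : K.OpenAllHoles S)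
    (hP : IsBoundaryCycle S K P) {a b : PolygonVertex S K} (hab : a ≠ b)
    (hnadj : ¬ (internalVisibility S K).Adj a b) :
    ∃ x, ∀ o, ((internalVisibility S K).Adj a o ∧
      IsBlockingVertex (internalVisibility S K) P a b o) ↔ o = x := by
  obtain ⟨C, o, B, R, hPa, hao, hB⟩ := exists_last_neighbor (A.isHamiltonianCycle hP) hab hnadj
  have hPo : P = (o :: B ++ b :: (R ++ a :: C) : List _) := by
    rw [hPa, ← List.cons_append, cycle_coe_append_comm]
    simp
  obtain ⟨y, hy, hoy⟩ := (exists_succ_of_cycle_chain (hPo ▸ hP.2.2)).1 o List.mem_cons_self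
  have hya : y ≠ a := by
    rintro rfl
    exact disjoint_of_nodup_split (Cycle.nodup_coe_iff.1 (hPo ▸ hP.1)) hy (by simp)
  obtain ⟨i, j, r, hij, ho, haj, hai⟩ := A.exists_door_of_not_adj_succ hao hoy hya (hB y hy)
  obtain ⟨v, x₂, x₃, x₄, L₁, L₂, L₃, L₄, F⟩ := A.exists_fourPockets hK hP hij ho
  have hb : b ∈ L₁ := by
    have x₂_notMem : x₂ ∉ B ++ [b] := fun h => hB x₂ h <|
      have hx₂ := F.inPiece_corners A x₂ (by simp)
      A.adj_of_inPiece (fun h => hai (h ▸ hx₂.1)) haj hx₂.2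
    have lists_eq := eq_of_cycle_cons_eq (F.door₁.nodup hP) (F.door₁.eq.symm.trans hPo)
    rcases append_cons_eq_append_cons_cases lists_eq with ⟨-, rfl, -⟩ | ⟨h, -⟩ | ⟨h, -⟩
    · exact absurd (by simp) x₂_notMem
    · exact absurd (List.mem_append_left _ h) x₂_notMem
    · exact h
  rcases F.mem_of_inPiece A hK hP haj hai with ha | ha
  · exact ⟨o, F.blockingVertex_iff_of_mem_fourth A hK hP ha hb haj hai⟩
  · exact ⟨x₂, F.blockingVertex_iff_of_mem_second A hK hP ha hb haj hai⟩

theorem existsUnique_blockingVertexAssignment (A : CrossingTimes S X) (hK : K.OpenAllHoles S)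
    (hP : IsBoundaryCycle S K P) :
    ∃! β : InvisiblePair (internalVisibility S K) → PolygonVertex S K,
      IsBlockingVertexAssignment (internalVisibility S K) P β := by
  have h := fun p : InvisiblePair (internalVisibility S K) =>
    A.exists_blockingVertex_iff_eq hK hP p.2.1 p.2.2
  choose β hβ using h
  exact ⟨β, fun p => (hβ p _).2 rfl, fun γ hγ => funext fun p => (hβ p _).1 (hγ p)⟩

end CrossingTimes

end Pockets

/-! ## Reasoning about programs -/

namespace RamProgram

/-- Started in the state `s`, the program `p` halts after at most `T` steps in a state that
satisfies `post`. -/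
def Does (p : RamProgram) (T : ℕ) (s : RamState) (post : RamState → Prop) : Prop :=
  ∃ t s', t ≤ T ∧ p.Runs s t s' ∧ post s'

section Rules

variable {p q : RamProgram} {s s' : RamState} {T T' : ℕ} {mid post : RamState → Prop}

theorem Does.of_runs {t : ℕ} (h : p.Runs s t s') (hpost : post s') : Does p t s post :=
  ⟨t, s', le_rfl, h, hpost⟩

theorem Does.of_le (h : Does p T s post) (hT : T ≤ T') : Does p T' s post := by
  obtain ⟨t, s', ht, hrun, hpost⟩ := h
  exact ⟨t, s', ht.trans hT, hrun, hpost⟩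

theorem Does.imp (h : Does p T s mid) (hpost : ∀ s', mid s' → post s') : Does p T s post := by
  obtain ⟨t, s', ht, hrun, hmid⟩ := h
  exact ⟨t, s', ht, hrun, hpost _ hmid⟩

theorem Does.seq (h : Does p T s mid) (h' : ∀ s', mid s' → Does q T' s' post) :
    Does (.seq p q) (T + T') s post := by
  obtain ⟨t, s', ht, hrun, hmid⟩ := h
  obtain ⟨t', s'', ht', hrun', hpost⟩ := h' s' hmid
  exact ⟨t + t', s'', Nat.add_le_add ht ht', .seq _ _ _ _ _ _ _ hrun hrun', hpost⟩

theorem Does.step (h : p.Runs s 1 s') (h' : Does q T s' post) : Does (.seq p q) (T + 1) s post := by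
  obtain ⟨t, s'', ht, hrun, hpost⟩ := h'
  exact ⟨1 + t, s'', by omega, .seq _ _ _ _ _ _ _ h hrun, hpost⟩

theorem Does.ifPos {r : ℕ} (h : s.reg r ≠ 0 → Does p T s post)
    (h' : s.reg r = 0 → Does q T s post) : Does (.ifPos r p q) (T + 1) s post := by
  by_cases hr : s.reg r = 0
  · obtain ⟨t, s', ht, hrun, hpost⟩ := h' hr
    exact ⟨t + 1, s', by omega, .ifFalse _ _ _ _ _ _ hr hrun, hpost⟩
  · obtain ⟨t, s', ht, hrun, hpost⟩ := h hr
    exact ⟨t + 1, s', by omega, .ifTrue _ _ _ _ _ _ hr hrun, hpost⟩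

/-- `if reg r ≠ 0 then p`. In the other case the assignment `reg r := 0` changes nothing. -/
def whenPos (r : ℕ) (p : RamProgram) : RamProgram := .ifPos r p (.const r 0)

theorem Does.whenPos {r : ℕ} (hT : 1 ≤ T) (h : s.reg r ≠ 0 → Does p T s post)
    (h' : s.reg r = 0 → post s) : Does (whenPos r p) (T + 1) s post := by
  refine .ifPos h fun hr => Does.of_le (.of_runs (.const ..) ?_) hT
  rw [← hr, Function.update_eq_self]
  exact h' hr

theorem Does.whilePos {r M : ℕ} (Inv : ℕ → RamState → Prop)
    (hbody : ∀ m < M, ∀ s, s.reg r = m + 1 → Inv (m + 1) s →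
      Does p T s fun s' => s'.reg r = m ∧ Inv m s')
    (hr : s.reg r = M) (hs : Inv M s) : Does (.whilePos r p) (M * (T + 1) + 1) s (Inv 0) := by
  induction M generalizing s with
  | zero => exact ⟨1, s, by omega, .whileStop _ _ _ hr, hs⟩
  | succ M ih =>
    obtain ⟨t, s', ht, hrun, hr', hs'⟩ := hbody M M.lt_succ_self s hr hs
    obtain ⟨t', s'', ht', hrun', hpost⟩ :=
      ih (fun m hm => hbody m (hm.trans M.lt_succ_self)) hr' hs'
    refine ⟨t + t' + 1, s'', ?_, .whileStep _ _ _ _ _ _ _ (by omega) hrun hrun', hpost⟩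
    rw [add_mul, one_mul]
    omega

/-- `for reg v from reg b - 1 down to 0 do p`, where the register `1` holds `1`. -/
def countDown (v b : ℕ) (p : RamProgram) : RamProgram :=
  .seq (.const v 0) (.seq (.add v v b) (.whilePos v (.seq (.sub v v 1) p)))

/-- The running time of `countDown` for `x` rounds of time `t` each. It is needed both as a number
and as a polynomial. -/
def loopTime {R : Type*} [Semiring R] (x t : R) : R := x * (t + 2) + 3

theorem Does.countDown {v b M : ℕ} (Inv : ℕ → RamState → Prop) (hbv : b ≠ v) (hb : s.reg b = M)
    (hone : ∀ m s, Inv m s → s.reg 1 = 1)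
    (hupdate : ∀ m s x, Inv m s → Inv m { s with reg := Function.update s.reg v x })
    (hs : Inv M s)
    (hbody : ∀ m < M, ∀ s, s.reg v = m → Inv (m + 1) s →
      Does p T s fun s' => s'.reg v = m ∧ Inv m s') :
    Does (countDown v b p) (loopTime M T) s (Inv 0) := by
  refine .step (.const ..) (.step (.add ..) (.whilePos Inv (fun m hm s' hv hInv => ?_) ?_ ?_))
  · refine .step (.sub ..) (hbody m hm _ ?_ (hupdate _ _ _ hInv))
    simp [hv, hone _ _ hInv]
  · simp [Function.update_of_ne hbv, hb]
  · exact hupdate _ _ _ (hupdate _ _ _ hs)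

end Rules

section Computes

variable {s s' s'' : RamState} {e x N : ℕ}

/-- The registers `0`, …, `e - 1` agree. -/
def SameBelow (e : ℕ) (s s' : RamState) : Prop := ∀ r < e, s'.reg r = s.reg r

theorem SameBelow.reg (h : SameBelow e s s') (r : ℕ) (hr : r < e := by omega) :
    s'.reg r = s.reg r :=
  h r hr

theorem SameBelow.trans {d : ℕ} (h : SameBelow d s s') (h' : SameBelow e s' s'')
    (hed : d ≤ e := by omega) : SameBelow d s s'' :=
  fun r hr => (h' r (hr.trans_le hed)).trans (h r hr)

theorem SameBelow.update {r : ℕ} (h : SameBelow e s s') (hr : e ≤ r := by omega) :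
    SameBelow e s { s' with reg := Function.update s'.reg r x } :=
  fun r' hr' => (Function.update_of_ne (hr'.trans_le hr).ne _ _).trans (h r' hr')

theorem SameBelow.refl : SameBelow e s s := fun _ _ => rfl

/-- The value `x` has been written into the register `e`, and at most the registers from `e` on have
changed. -/
structure Computes (e x : ℕ) (s s' : RamState) : Prop where
  mem : s'.mem = s.mem
  below : SameBelow e s s'
  result : s'.reg e = x

/-- `reg e := reg e + reg u * reg 0`, where the register `1` holds `1`. -/
def addProduct (u e : ℕ) : RamProgram :=
  .seq (.const (e + 1) 0) (.seq (.add (e + 1) (e + 1) u)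
    (.whilePos (e + 1) (.seq (.add e e 0) (.sub (e + 1) (e + 1) 1))))

theorem Does.addProduct {u : ℕ} (hu : u < e) (he : 1 < e) (hone : s.reg 1 = 1) (hN : s.reg u ≤ N) :
    Does (addProduct u e) (3 * N + 3) s (Computes e (s.reg e + s.reg u * s.reg 0) s) := by
  let Inv (m : ℕ) (s' : RamState) : Prop := s'.mem = s.mem ∧ SameBelow e s s' ∧
    s'.reg e + m * s.reg 0 = s.reg e + s.reg u * s.reg 0
  refine Does.of_le (T := s.reg u * (2 + 1) + 1 + 1 + 1) ?_ (by omega)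
  refine Does.imp (mid := Inv 0) (.step (.const ..) (.step (.add ..)
    (.whilePos Inv (fun m _ s' hm hInv => ?_) ?_ ⟨rfl, SameBelow.refl.update.update, ?_⟩))) ?_
  · obtain ⟨hmem, hbelow, hsum⟩ := hInv
    refine .step (.add ..) (.of_runs (.sub ..) ⟨?_, hmem, hbelow.update.update, ?_⟩)
    · simp [Function.update_of_ne he.ne, hm, hbelow.reg 1, hone]
    · simp only [ne_eq, Nat.left_eq_add, one_ne_zero, not_false_eq_true, Function.update_of_ne,
        Function.update_self, hbelow.reg 0, ← hsum]
      ring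
  · simp [Function.update_of_ne (show u ≠ e + 1 by omega)]
  · simp
  · rintro s' ⟨hmem, hbelow, hsum⟩
    exact ⟨hmem, hbelow, by simpa using hsum⟩

/-- `reg e := reg a + reg v + reg u * reg 0`, where the register `1` holds `1`. -/
def address (a u v e : ℕ) : RamProgram := .seq (.add e a v) (addProduct u e)

theorem Does.address {a u v : ℕ} (hu : u < e) (he : 1 < e) (hone : s.reg 1 = 1)
    (hN : s.reg u ≤ N) :
    Does (address a u v e) (3 * N + 4) s
      (Computes e (s.reg a + s.reg v + s.reg u * s.reg 0) s) := by
  refine .step (.add ..) ((Does.addProduct hu he ?_ ?_).imp fun s' h => ⟨h.mem, ?_, ?_⟩)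
  · simpa [Function.update_of_ne he.ne] using hone
  · simpa [Function.update_of_ne hu.ne] using hN
  · exact SameBelow.refl.update.trans h.below
  · rw [h.result]
    simp [Function.update_of_ne hu.ne, Function.update_of_ne (show 0 ≠ e by omega)]

/-- The entry of the cyclic list in the cells `0`, …, `N - 1` at the position `t < 2 * N`. -/
def cyclicEntry (N : ℕ) (m : ℕ → ℕ) (t : ℕ) : ℕ := m (if t < N then t else t - N)

theorem cyclicEntry_lt {m : ℕ → ℕ} (hm : ∀ p < N, m p < N) {t : ℕ} (ht : t < 2 * N) :
    cyclicEntry N m t < N := by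
  unfold cyclicEntry
  refine hm _ ?_
  split_ifs <;> omega

/-- Subtract `reg 0` from `reg e` unless `reg e` is smaller, where the register `1` holds `1`. -/
def wrapAround (e : ℕ) : RamProgram :=
  .seq (.add (e + 1) e 1) (.seq (.sub (e + 1) (e + 1) 0) (whenPos (e + 1) (.sub e e 0)))

theorem Does.wrapAround (he : 1 < e) (hone : s.reg 1 = 1) :
    Does (wrapAround e) 4 s
      (Computes e (if s.reg e < s.reg 0 then s.reg e else s.reg e - s.reg 0) s) := by
  have test (r : ℕ) : r + 1 - s.reg 0 = 0 ↔ r < s.reg 0 := by omega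
  refine .step (.add ..) (.step (.sub ..) (.whenPos le_rfl (fun h => .of_runs (.sub ..) ?_)
    fun h => ?_))
  · refine ⟨rfl, SameBelow.refl.update.update.update, ?_⟩
    simp only [Function.update_self, hone, ne_eq, test,
      Function.update_of_ne (show 0 ≠ e + 1 by omega)] at h
    simp [if_neg h]
  · refine ⟨rfl, SameBelow.refl.update.update, ?_⟩
    simp only [Function.update_self, hone, test,
      Function.update_of_ne (show 0 ≠ e + 1 by omega)] at h
    simp [if_pos h]

/-- `reg e` becomes the entry of the cyclic list at the position `reg i + reg j`. -/
def lookup (i j e : ℕ) : RamProgram := .seq (.add e i j) (.seq (wrapAround e) (.load e e))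

theorem Does.lookup {i j : ℕ} (he : 1 < e) (hone : s.reg 1 = 1) (hN : s.reg 0 = N) :
    Does (lookup i j e) 6 s (Computes e (cyclicEntry N s.mem (s.reg i + s.reg j)) s) := by
  subst hN
  refine .step (.add ..) (.seq (Does.wrapAround he ?_) fun s' h =>
    .of_runs (.load ..) ⟨h.mem, (SameBelow.refl.update.trans h.below).update, ?_⟩)
  · simpa [Function.update_of_ne he.ne] using hone
  · simp [h.mem, h.result, cyclicEntry, Function.update_of_ne (show 0 ≠ e by omega)]

end Computes

end RamProgram

/-! ## The program -/

namespace RamProgram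

section Check

variable {p : RamProgram} {s s' : RamState} {N T : ℕ}

/-- The entry `(a, b)` of the adjacency matrix in the memory is not zero. -/
def Sees (N : ℕ) (m : ℕ → ℕ) (a b : ℕ) : Prop := m (N + b + a * N) ≠ 0

/-- Run `p` if `reg a` sees `reg b`. -/
def ifSees (a b : ℕ) (p : RamProgram) : RamProgram :=
  .seq (address 0 a b 13) (.seq (.load 13 13) (whenPos 13 p))

theorem Does.ifSees {a b : ℕ} {post : RamState → Prop} (hT : 1 ≤ T) (ha : a < 13)
    (hN : s.reg 0 = N) (hone : s.reg 1 = 1) (haN : s.reg a < N)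
    (hpos : ∀ s', s'.mem = s.mem → SameBelow 13 s s' → Sees N s.mem (s.reg a) (s.reg b) →
      Does p T s' post)
    (hneg : ∀ s', s'.mem = s.mem → SameBelow 13 s s' → ¬ Sees N s.mem (s.reg a) (s.reg b) →
      post s') :
    Does (ifSees a b p) (3 * N + T + 6) s post := by
  refine Does.of_le (T := 3 * N + 4 + (T + 1 + 1)) (.seq (.address ha (by simp) hone haN.le)
    fun s' h => .step (.load ..) (.whenPos hT (fun h' => hpos _ h.mem h.below.update ?_)
      fun h' => hneg _ h.mem h.below.update ?_)) (by omega)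
  · simpa [Sees, h.result, h.mem, hN] using h'
  · simpa [Sees, h.result, h.mem, hN] using h'

/-- The flag in the register `f` has been cleared unless `φ` holds, and otherwise at most the
registers from `e` on have changed. -/
structure ClearsUnless (f e : ℕ) (φ : Prop) (s s' : RamState) : Prop where
  mem : s'.mem = s.mem
  below : ∀ r < e, r ≠ f → s'.reg r = s.reg r
  flag : s'.reg f ≠ 0 ↔ s.reg f ≠ 0 ∧ φ

theorem ClearsUnless.of_not {f e : ℕ} {φ : Prop} (h : ¬ φ) (hmem : s'.mem = s.mem)
    (hbelow : SameBelow e s s') :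
    ClearsUnless f e φ s { s' with reg := Function.update s'.reg f 0 } where
  mem := hmem
  below r hr hrf := (Function.update_of_ne hrf _ _).trans (hbelow r hr)
  flag := by simp [h]

theorem ClearsUnless.of_true {f e : ℕ} {φ : Prop} (h : φ) (hf : f < e) (hmem : s'.mem = s.mem)
    (hbelow : SameBelow e s s') : ClearsUnless f e φ s s' where
  mem := hmem
  below r hr _ := hbelow r hr
  flag := by simp [h, hbelow.reg f hf]

theorem ClearsUnless.update {f e r x : ℕ} {φ : Prop} (h : ClearsUnless f e φ s s') (hf : f < r)
    (hr : e ≤ r) : ClearsUnless f e φ s { s' with reg := Function.update s'.reg r x } where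
  mem := h.mem
  below r' hr' hrf := (Function.update_of_ne (hr'.trans_le hr).ne _ _).trans (h.below r' hr' hrf)
  flag := by simpa [Function.update_of_ne hf.ne] using h.flag

theorem Does.countDown_clearsUnless {f v b M : ℕ} {φ : ℕ → Prop} (hf : f < v) (hf_one : 1 ≠ f)
    (hv : 1 < v) (hbv : b ≠ v) (hb : s.reg b = M) (hone : s.reg 1 = 1)
    (hbody : ∀ j < M, ∀ s', s'.mem = s.mem → (∀ r < v, r ≠ f → s'.reg r = s.reg r) →
      s'.reg v = j → Does p T s' (ClearsUnless f (v + 1) (φ j) s')) :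
    Does (RamProgram.countDown v b p) (loopTime M T) s (ClearsUnless f v (∀ j < M, φ j) s) := by
  refine (Does.countDown (fun m => ClearsUnless f v (∀ j < M, m ≤ j → φ j) s) hbv hb
    (fun m s' h => (h.below 1 hv hf_one).trans hone) (fun m s' x h => h.update hf le_rfl) ?_
    fun m hm s' hreg h => ?_).imp fun s' h => ?_
  · exact ClearsUnless.of_true (fun j hj hj' => absurd hj hj'.not_gt) hf rfl SameBelow.refl
  · refine (hbody m hm s' h.mem h.below hreg).imp fun s'' h' => ⟨?_, ?_, fun r hr hrf => ?_, ?_⟩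
    · rw [h'.below v v.lt_succ_self hf.ne', hreg]
    · rw [h'.mem, h.mem]
    · rw [h'.below r (hr.trans v.lt_succ_self) hrf, h.below r hr hrf]
    · rw [h'.flag, h.flag, and_assoc]
      refine and_congr_right fun _ => ⟨fun ⟨hlater, hnow⟩ j hj hmj => ?_, fun hall =>
        ⟨fun j hj hmj => hall j hj (by omega), hall m hm le_rfl⟩⟩
      obtain rfl | hmj := hmj.eq_or_lt
      exacts [hnow, hlater j hj hmj]
  · simpa using h

/-- Clear the flag in register `6` if the entries of the cyclic list at the positions
`reg 3 + reg 8` and `reg 3 + reg 4 + reg 9 + 1` see each other. -/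
def checkPair : RamProgram :=
  .seq (lookup 3 8 10) (.seq (.add 11 4 9) (.seq (.add 11 11 1) (.seq (lookup 3 11 12)
    (ifSees 10 12 (.const 6 0)))))

theorem Does.checkPair (hN : s.reg 0 = N) (hone : s.reg 1 = 1) (hm : ∀ p < N, s.mem p < N)
    (hx : s.reg 3 + s.reg 8 < 2 * N) :
    Does checkPair (3 * N + 21) s
      (ClearsUnless 6 10 (¬ Sees N s.mem (cyclicEntry N s.mem (s.reg 3 + s.reg 8))
        (cyclicEntry N s.mem (s.reg 3 + (s.reg 4 + s.reg 9 + 1)))) s) := by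
  refine Does.of_le (T := 6 + (6 + (3 * N + 1 + 6) + 1 + 1)) (.seq (.lookup (by simp) hone hN)
    fun s₁ h₁ => .step (.add ..) (.step (.add ..) (.seq (.lookup (N := N) (by simp) ?_ ?_)
      fun s₂ h₂ => ?_))) (by omega)
  · simp [h₁.below.reg 1, hone]
  · simp [h₁.below.reg 0, hN]
  have below : SameBelow 10 s s₂ := h₁.below.update.update.trans h₂.below
  have mem : s₂.mem = s.mem := h₂.mem.trans h₁.mem
  have reg10 : s₂.reg 10 = cyclicEntry N s.mem (s.reg 3 + s.reg 8) := by
    simp [h₂.below.reg 10, h₁.result]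
  have reg12 : s₂.reg 12 = cyclicEntry N s.mem (s.reg 3 + (s.reg 4 + s.reg 9 + 1)) := by
    simp [h₂.result, h₁.mem, h₁.below.reg 1, h₁.below.reg 3, h₁.below.reg 4, h₁.below.reg 9, hone]
  rw [← reg10, ← reg12, ← mem]
  refine .ifSees le_rfl (by simp) ((below.reg 0).trans hN) ((below.reg 1).trans hone) ?_
    (fun s' hmem h hs => .of_runs (.const ..) (.of_not (not_not.2 hs) ?_ ?_))
    fun s' hmem h hs => .of_true hs (by simp) ?_ ?_
  · exact reg10 ▸ cyclicEntry_lt hm hx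
  all_goals first | exact hmem.trans mem | exact below.trans h

/-- Clear the flag in register `6` if, for some `y < reg 7`, the entries of the cyclic list at the
positions `reg 3 + reg 8` and `reg 3 + reg 4 + y + 1` see each other. -/
def checkRow : RamProgram := countDown 9 7 checkPair

theorem Does.checkRow (hN : s.reg 0 = N) (hone : s.reg 1 = 1) (hm : ∀ p < N, s.mem p < N)
    (hx : s.reg 3 + s.reg 8 < 2 * N) :
    Does checkRow (loopTime (s.reg 7) (3 * N + 21)) s
      (ClearsUnless 6 9 (∀ y < s.reg 7, ¬ Sees N s.mem (cyclicEntry N s.mem (s.reg 3 + s.reg 8))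
        (cyclicEntry N s.mem (s.reg 3 + (s.reg 4 + y + 1)))) s) := by
  refine Does.countDown_clearsUnless (by simp) (by simp) (by simp) (by simp) rfl hone
    fun y _ s' mem reg reg9 => ?_
  have reg0 := reg 0 (by simp) (by simp)
  have reg1 := reg 1 (by simp) (by simp)
  have reg3 := reg 3 (by simp) (by simp)
  have reg4 := reg 4 (by simp) (by simp)
  have reg8 := reg 8 (by simp) (by simp)
  have pair := Does.checkPair (reg0.trans hN) (reg1.trans hone) (mem ▸ hm) (reg3 ▸ reg8 ▸ hx)
  rwa [mem, reg3, reg4, reg8, reg9] at pair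

/-- No entry of the cyclic list at a position `i + x` with `x < k` sees an entry at a position from
`i + k + 1` to `i + l`. -/
def Blocked (N : ℕ) (m : ℕ → ℕ) (i k l : ℕ) : Prop :=
  k < l ∧ ∀ x < k, ∀ y < l - k,
    ¬ Sees N m (cyclicEntry N m (i + x)) (cyclicEntry N m (i + (k + y + 1)))

/-- Set the flag in register `6` if the positions `reg 3`, `reg 4` and `reg 5` are `Blocked`, and
clear it otherwise. -/
def check : RamProgram := .seq (.sub 6 5 4) (.seq (.sub 7 5 4) (countDown 8 4 checkRow))

theorem loopTime_mono {M : ℕ} (h : M ≤ N) : loopTime M T ≤ loopTime N T := by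
  unfold loopTime
  gcongr

theorem Does.check (hN : s.reg 0 = N) (hone : s.reg 1 = 1) (hm : ∀ p < N, s.mem p < N)
    (h3 : s.reg 3 < N) (h4 : s.reg 4 < N) (h5 : s.reg 5 < N) :
    Does check (loopTime N (loopTime N (3 * N + 21)) + 1 + 1) s fun s' => s'.mem = s.mem ∧
      SameBelow 6 s s' ∧ (s'.reg 6 ≠ 0 ↔ Blocked N s.mem (s.reg 3) (s.reg 4) (s.reg 5)) := by
  refine .step (.sub ..) (.step (.sub ..) (Does.of_le (T := loopTime (s.reg 4) _)
    (Does.imp (.countDown_clearsUnless (φ := fun x => ∀ y < s.reg 5 - s.reg 4,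
        ¬ Sees N s.mem (cyclicEntry N s.mem (s.reg 3 + x))
          (cyclicEntry N s.mem (s.reg 3 + (s.reg 4 + y + 1))))
      (show 6 < 8 by simp) (by simp) (by simp) (by simp) (by simp) (by simpa)
      fun x hx s' mem reg reg8 => ?_) fun s' h => ?_) (loopTime_mono h4.le)))
  · have reg0 := reg 0 (by simp) (by simp)
    have reg1 := reg 1 (by simp) (by simp)
    have reg3 := reg 3 (by simp) (by simp)
    have reg4 := reg 4 (by simp) (by simp)
    have reg7 := reg 7 (by simp) (by simp)
    simp only [ne_eq, Nat.reduceEqDiff, not_false_eq_true, Function.update_of_ne,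
      Function.update_self] at mem reg0 reg1 reg3 reg4 reg7
    have row := Does.checkRow (s := s') (N := N) (reg0.trans hN) (reg1.trans hone) (mem ▸ hm)
      (by omega)
    rw [mem, reg3, reg4, reg7, reg8] at row
    exact row.of_le (loopTime_mono (by omega))
  · refine ⟨h.mem, fun r hr => ?_, ?_⟩
    · rw [h.below r (by omega) hr.ne]
      simp [Function.update_of_ne hr.ne, Function.update_of_ne (show r ≠ 7 by omega)]
    · rw [h.flag]
      simp [Blocked, Nat.sub_ne_zero_iff_lt]

end Check

section Record

variable {p : RamProgram} {s s' : RamState} {N T : ℕ} {m : ℕ → ℕ} {D D' : ℕ → ℕ → Prop}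

/-- If `reg a` sees `reg 11`, write `reg 11` into the cell `(reg a, reg b)` of the output. -/
def recordOne (a b : ℕ) : RamProgram := ifSees a 11 (.seq (address 2 a b 14) (.store 14 11))

open Classical in
theorem Does.recordOne {a b : ℕ} (ha : a < 13) (hb : b < 13) (hN : s.reg 0 = N)
    (hone : s.reg 1 = 1) (haN : s.reg a < N) :
    Does (recordOne a b) (6 * N + 11) s fun s' => SameBelow 13 s s' ∧
      s'.mem = if Sees N s.mem (s.reg a) (s.reg 11) then
        Function.update s.mem (s.reg 2 + s.reg b + s.reg a * N) (s.reg 11) else s.mem := by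
  refine Does.of_le (T := 3 * N + (3 * N + 4 + 1) + 6) (.ifSees (by omega) ha hN hone haN
    (fun s₁ mem h hs => .seq (.address (N := N) (by omega) (by simp) ((h.reg 1).trans hone) ?_)
      fun s₂ h₂ => .of_runs (.store ..) ⟨h.trans h₂.below, ?_⟩)
    fun s' mem h hs => ⟨h, by rw [if_neg hs, mem]⟩) (by omega)
  · exact (h.reg a).trans_le haN.le
  · rw [if_pos hs, h₂.result, h₂.mem, mem, h₂.below.reg 11, h.reg 11, h.reg 2, h.reg a, h.reg b,
      h.reg 0, hN]

/-- For the triple of positions `(i, k, l)`, the value `o` may be written into the cell `(a, b)`. -/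
def MayWrite (N : ℕ) (m : ℕ → ℕ) (i k l a b o : ℕ) : Prop :=
  Blocked N m i k l ∧ o = cyclicEntry N m (i + k) ∧ Sees N m a o ∧
    ((a = m i ∧ b = cyclicEntry N m (i + l)) ∨ (a = cyclicEntry N m (i + l) ∧ b = m i))

/-- The value `o` may be written into the cell `(a, b)`, for some triple of positions. -/
def Valid (N : ℕ) (m : ℕ → ℕ) (a b o : ℕ) : Prop :=
  ∃ i < N, ∃ k < N, ∃ l < N, MayWrite N m i k l a b o

/-- The state of the machine, with the initial memory `m`, when the cells `(a, b)` of the output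
with `D a b` have been filled. -/
structure Progress (N : ℕ) (m : ℕ → ℕ) (D : ℕ → ℕ → Prop) (s : RamState) : Prop where
  reg_zero : s.reg 0 = N
  reg_one : s.reg 1 = 1
  reg_two : s.reg 2 = N + N * N
  input : ∀ x < N + N * N, s.mem x = m x
  output : ∀ a < N, ∀ b < N, D a b → Valid N m a b (s.mem (N + N * N + b + a * N))

theorem eq_and_eq_of_add_mul_eq_add_mul {a b a' b' : ℕ} (hb : b < N) (hb' : b' < N)
    (h : b + a * N = b' + a' * N) : a = a' ∧ b = b' := by
  have quotients := congrArg (· / N) h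
  have remainders := congrArg (· % N) h
  simp only [Nat.add_mul_mod_self_right, Nat.mod_eq_of_lt hb, Nat.mod_eq_of_lt hb',
    Nat.add_mul_div_right _ _ (Nat.zero_lt_of_lt hb), Nat.div_eq_of_lt hb, Nat.div_eq_of_lt hb',
    zero_add] at quotients remainders
  exact ⟨quotients, remainders⟩

theorem Progress.congr (h : Progress N m D s) (hmem : s'.mem = s.mem) (hreg : SameBelow 3 s s') :
    Progress N m D s' where
  reg_zero := (hreg.reg 0).trans h.reg_zero
  reg_one := (hreg.reg 1).trans h.reg_one
  reg_two := (hreg.reg 2).trans h.reg_two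
  input := hmem ▸ h.input
  output := hmem ▸ h.output

theorem Progress.mono (h : Progress N m D s) (hD : ∀ a b, D' a b → D a b) :
    Progress N m D' s where
  __ := h
  output a ha b hb hab := h.output a ha b hb (hD a b hab)

theorem Progress.sees_iff (h : Progress N m D s) {a b : ℕ} (ha : a < N) (hb : b < N) :
    Sees N s.mem a b ↔ Sees N m a b := by
  have := Nat.mul_le_mul_right N (show a + 1 ≤ N from ha)
  rw [add_mul, one_mul] at this
  rw [Sees, h.input _ (by omega), Sees]

theorem Progress.cyclicEntry_eq (h : Progress N m D s) {t : ℕ} (ht : t < 2 * N) :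
    cyclicEntry N s.mem t = cyclicEntry N m t := by
  refine h.input _ ?_
  split_ifs <;> omega

theorem Progress.blocked_iff (h : Progress N m D s) (hm : ∀ p < N, m p < N) {i k l : ℕ}
    (hi : i < N) (hl : l < N) : Blocked N s.mem i k l ↔ Blocked N m i k l := by
  refine and_congr_right fun hkl => forall₂_congr fun x hx => forall₂_congr fun y hy =>
    not_congr ?_
  rw [h.cyclicEntry_eq (by omega), h.cyclicEntry_eq (by omega)]
  exact h.sees_iff (cyclicEntry_lt hm (by omega)) (cyclicEntry_lt hm (by omega))

theorem Progress.write (h : Progress N m D s) {a b o : ℕ} (hb : b < N) (hv : Valid N m a b o)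
    (hmem : s'.mem = Function.update s.mem (N + N * N + b + a * N) o) (hreg : SameBelow 3 s s') :
    Progress N m (fun x y => D x y ∨ (x = a ∧ y = b)) s' where
  reg_zero := (hreg.reg 0).trans h.reg_zero
  reg_one := (hreg.reg 1).trans h.reg_one
  reg_two := (hreg.reg 2).trans h.reg_two
  input x hx := by rw [hmem, Function.update_of_ne (by omega), h.input x hx]
  output x hx y hy hD := by
    by_cases hcell : N + N * N + y + x * N = N + N * N + b + a * N
    · obtain ⟨rfl, rfl⟩ := eq_and_eq_of_add_mul_eq_add_mul (a := x) (a' := a) hy hb (by omega)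
      rwa [hmem, Function.update_self]
    · rw [hmem, Function.update_of_ne hcell]
      refine h.output x hx y hy (hD.resolve_right ?_)
      rintro ⟨rfl, rfl⟩
      exact hcell rfl

theorem Progress.recordOne (h : Progress N m D s) {a b : ℕ} (ha : a < 13) (hb : b < 13)
    (haN : s.reg a < N) (hbN : s.reg b < N) (hoN : s.reg 11 < N)
    (hv : Sees N m (s.reg a) (s.reg 11) → Valid N m (s.reg a) (s.reg b) (s.reg 11)) :
    Does (recordOne a b) (6 * N + 11) s fun s' => SameBelow 13 s s' ∧
      Progress N m (fun x y => D x y ∨ (x = s.reg a ∧ y = s.reg b ∧ Sees N m x (s.reg 11))) s' := by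
  refine (Does.recordOne ha hb h.reg_zero h.reg_one haN).imp fun s' ⟨hreg, hmem⟩ => ⟨hreg, ?_⟩
  have hreg' : SameBelow 3 s s' := fun r hr => hreg.reg r
  rw [h.reg_two] at hmem
  split_ifs at hmem with hs <;> rw [h.sees_iff haN hoN] at hs
  · exact (h.write hbN (hv hs) hmem hreg').mono fun x y => Or.imp_right fun hxy => ⟨hxy.1, hxy.2.1⟩
  · refine (h.congr hmem hreg').mono fun x y hD => hD.resolve_right ?_
    rintro ⟨rfl, -, hs'⟩
    exact hs hs'

/-- Load the entries of the cyclic list at the positions `reg 3`, `reg 3 + reg 4` and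
`reg 3 + reg 5` into the registers `10`, `11` and `12`. -/
def fetch : RamProgram := .seq (.load 10 3) (.seq (lookup 3 4 11) (lookup 3 5 12))

theorem Does.fetch (hN : s.reg 0 = N) (hone : s.reg 1 = 1) :
    Does fetch 13 s fun s' => s'.mem = s.mem ∧ SameBelow 10 s s' ∧
      s'.reg 10 = s.mem (s.reg 3) ∧ s'.reg 11 = cyclicEntry N s.mem (s.reg 3 + s.reg 4) ∧
      s'.reg 12 = cyclicEntry N s.mem (s.reg 3 + s.reg 5) := by
  refine .step (.load ..) (.seq (.lookup (N := N) (by simp) (by simpa) (by simpa)) fun s₁ h₁ =>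
    .imp (.lookup (N := N) (by simp) ?_ ?_) fun s₂ h₂ =>
      ⟨h₂.mem.trans h₁.mem, (SameBelow.refl.update.trans h₁.below).trans h₂.below, ?_, ?_, ?_⟩)
  · simpa [h₁.below.reg 1]
  · simpa [h₁.below.reg 0]
  · simp [h₂.below.reg 10, h₁.below.reg 10]
  · simp [h₂.below.reg 11, h₁.result]
  · simp [h₂.result, h₁.mem, h₁.below.reg 3, h₁.below.reg 5]

/-- Write the blocking vertex that has been found into the output. -/
def record : RamProgram := .seq fetch (.seq (recordOne 10 12) (recordOne 12 10))

theorem Progress.record (h : Progress N m D s) (hm : ∀ p < N, m p < N)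
    (h3 : s.reg 3 < N) (h4 : s.reg 4 < N) (h5 : s.reg 5 < N)
    (hB : Blocked N m (s.reg 3) (s.reg 4) (s.reg 5)) :
    Does record (12 * N + 35) s fun s' => SameBelow 6 s s' ∧
      Progress N m
        (fun x y => D x y ∨ ∃ o, MayWrite N m (s.reg 3) (s.reg 4) (s.reg 5) x y o) s' := by
  refine Does.of_le (T := 13 + (6 * N + 11 + (6 * N + 11))) (.seq (.fetch h.reg_zero h.reg_one)
    fun s₁ ⟨mem₁, same₁, reg10, reg11, reg12⟩ => ?_) (by omega)
  rw [h.input _ (by omega)] at reg10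
  rw [h.cyclicEntry_eq (by omega)] at reg11 reg12
  have lt10 : s₁.reg 10 < N := reg10 ▸ hm _ h3
  have lt11 : s₁.reg 11 < N := reg11 ▸ cyclicEntry_lt hm (by omega)
  have lt12 : s₁.reg 12 < N := reg12 ▸ cyclicEntry_lt hm (by omega)
  have may_write_iff {a b o : ℕ} : MayWrite N m (s.reg 3) (s.reg 4) (s.reg 5) a b o ↔
      o = s₁.reg 11 ∧ Sees N m a o ∧
        ((a = s₁.reg 10 ∧ b = s₁.reg 12) ∨ (a = s₁.reg 12 ∧ b = s₁.reg 10)) := by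
    rw [reg10, reg11, reg12, MayWrite, and_iff_right hB]
  have valid {a b o : ℕ} (ho : MayWrite N m (s.reg 3) (s.reg 4) (s.reg 5) a b o) :
      Valid N m a b o := ⟨_, h3, _, h4, _, h5, ho⟩
  refine .seq (Progress.recordOne (h.congr mem₁ fun r hr => same₁.reg r) (by simp) (by simp) lt10
    lt12 lt11 fun hs => valid (may_write_iff.2 ⟨rfl, hs, .inl ⟨rfl, rfl⟩⟩))
    fun s₂ ⟨same₂, h₂⟩ => ?_
  rw [← same₂.reg 10, ← same₂.reg 11, ← same₂.reg 12] at *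
  refine .imp (Progress.recordOne h₂ (by simp) (by simp) lt12 lt10 lt11
    fun hs => valid (may_write_iff.2 ⟨rfl, hs, .inr ⟨rfl, rfl⟩⟩)) fun s₃ ⟨same₃, h₃⟩ =>
      ⟨fun r hr => ((same₃.reg r).trans (same₂.reg r)).trans (same₁.reg r), h₃.mono ?_⟩
  rintro x y (hD | ⟨o, ho⟩)
  · exact .inl (.inl hD)
  · obtain ⟨rfl, hs, hxy | hxy⟩ := may_write_iff.1 ho
    · exact .inl (.inr ⟨hxy.1, hxy.2, hs⟩)
    · exact .inr ⟨hxy.1, hxy.2, hs⟩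

/-- The treatment of one triple of positions. -/
def treat : RamProgram := .seq check (whenPos 6 record)

/-- The running time of `treat`. -/
def treatTime {R : Type*} [Semiring R] (x : R) : R :=
  loopTime x (loopTime x (3 * x + 21)) + 1 + 1 + (12 * x + 35 + 1)

theorem Progress.treat (h : Progress N m D s) (hm : ∀ p < N, m p < N)
    (h3 : s.reg 3 < N) (h4 : s.reg 4 < N) (h5 : s.reg 5 < N) :
    Does RamProgram.treat (treatTime N) s fun s' => SameBelow 6 s s' ∧
      Progress N m
        (fun x y => D x y ∨ ∃ o, MayWrite N m (s.reg 3) (s.reg 4) (s.reg 5) x y o) s' := by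
  refine .seq (.check h.reg_zero h.reg_one (fun p hp => ?_) h3 h4 h5)
    fun s₁ ⟨mem, same, flag⟩ => ?_
  · rw [h.input p (by omega)]
    exact hm p hp
  have h₁ : Progress N m D s₁ := h.congr mem fun r hr => same.reg r
  rw [h.blocked_iff hm h3 h5] at flag
  refine .whenPos (by omega) (fun hflag => ?_) fun hflag => ⟨same, h₁.mono fun x y => ?_⟩
  · rw [← same.reg 3, ← same.reg 4, ← same.reg 5] at *
    exact (h₁.record hm h3 h4 h5 (flag.1 hflag)).imp fun s' h' => ⟨same.trans h'.1, h'.2⟩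
  · rintro (hD | ⟨o, hB, -⟩)
    · exact hD
    · exact absurd hflag (flag.2 hB)

theorem Progress.countDown {v : ℕ} (hv : 3 ≤ v) (E : ℕ → ℕ → ℕ → Prop) (h : Progress N m D s)
    (hbody : ∀ j < N, ∀ D s', Progress N m D s' → SameBelow v s s' → s'.reg v = j →
      Does p T s' fun s'' => SameBelow (v + 1) s' s'' ∧
        Progress N m (fun x y => D x y ∨ E j x y) s'') :
    Does (countDown v 0 p) (loopTime N T) s fun s' => SameBelow v s s' ∧
      Progress N m (fun x y => D x y ∨ ∃ j < N, E j x y) s' := by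
  refine (Does.countDown (fun j s' => SameBelow v s s' ∧
    Progress N m (fun x y => D x y ∨ ∃ i < N, j ≤ i ∧ E i x y) s') (by omega) h.reg_zero
    (fun j s' h' => h'.2.reg_one) (fun j s' x h' => ⟨h'.1.update, h'.2.congr rfl ?_⟩)
    ⟨SameBelow.refl, h.mono ?_⟩ fun j hj s' hreg h' => ?_).imp fun s' h' => ?_
  · exact SameBelow.refl.update
  · rintro x y (hD | ⟨j, hj, hj', -⟩)
    · exact hD
    · omega
  · refine (hbody j hj _ s' h'.2 h'.1 hreg).imp fun s'' h'' =>
      ⟨(h''.1.reg v).trans hreg, h'.1.trans h''.1, h''.2.mono ?_⟩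
    rintro x y (hD | ⟨i, hi, hi', hE⟩)
    · exact .inl (.inl hD)
    · obtain rfl | hi' := hi'.eq_or_lt
      exacts [.inr hE, .inl (.inr ⟨i, hi, hi', hE⟩)]
  · simpa using h'

/-- Write `N + N * N` into register `2` and treat all triples of positions. -/
def blockingProgram : RamProgram :=
  .seq (.const 1 1) (.seq (address 0 0 3 2) (countDown 3 0 (countDown 4 0 (countDown 5 0 treat))))

open Polynomial in
/-- A bound for the running time of `blockingProgram`. -/
noncomputable def timeBound : ℕ[X] :=
  3 * X + 4 + loopTime X (loopTime X (loopTime X (treatTime X))) + 1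

theorem Progress.treat_all (h : Progress N m D s) (hm : ∀ p < N, m p < N) :
    Does (RamProgram.countDown 3 0 (RamProgram.countDown 4 0
      (RamProgram.countDown 5 0 RamProgram.treat)))
      (loopTime N (loopTime N (loopTime N (treatTime N)))) s
      (Progress N m fun x y => D x y ∨ ∃ o, Valid N m x y o) := by
  refine (h.countDown le_rfl
    (fun i x y => ∃ k < N, ∃ l < N, ∃ o, MayWrite N m i k l x y o) fun i hi D₃ s₃ h₃ _ reg3 =>
    h₃.countDown (by simp)
      (fun k x y => ∃ l < N, ∃ o, MayWrite N m i k l x y o) fun k hk D₄ s₄ h₄ same₄ reg4 =>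
      h₄.countDown (by simp)
        (fun l x y => ∃ o, MayWrite N m i k l x y o) fun l hl D₅ s₅ h₅ same₅ reg5 => ?_).imp
    fun s' h' => h'.2.mono ?_
  · obtain rfl : s₅.reg 3 = i := (same₅.reg 3).trans ((same₄.reg 3).trans reg3)
    obtain rfl : s₅.reg 4 = k := (same₅.reg 4).trans reg4
    subst reg5
    exact h₅.treat hm hi hk hl
  · rintro x y (hD | ⟨o, i, hi, k, hk, l, hl, ho⟩)
    exacts [.inl hD, .inr ⟨i, hi, k, hk, l, hl, o, ho⟩]

theorem Does.blockingProgram (hN : s.reg 0 = N) (h3 : s.reg 3 = 0) (hm : ∀ p < N, s.mem p < N) :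
    Does blockingProgram (timeBound.eval N) s fun s' => ∀ a < N, ∀ b < N,
      (∃ o, Valid N s.mem a b o) → Valid N s.mem a b (s'.mem (N + N * N + b + a * N)) := by
  have eval : timeBound.eval N =
      3 * N + 4 + loopTime N (loopTime N (loopTime N (treatTime N))) + 1 := by
    simp [timeBound, loopTime, treatTime]
  rw [eval]
  refine .step (.const ..) (.seq (.address (N := N) (by simp) (by simp) (by simp) (by simp [hN]))
    fun s' h => ?_)
  have start : Progress N s.mem (fun _ _ => False) s' := by
    refine ⟨?_, ?_, ?_, fun x _ => by rw [h.mem], fun _ _ _ _ => False.elim⟩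
    · simp [h.below.reg 0, hN]
    · simp [h.below.reg 1]
    · simp [h.result, hN, h3]
  exact (start.treat_all hm).imp fun s'' h'' a ha b hb hab => h''.output a ha b hb (.inr hab)

end Record

end RamProgram

/-! ## The program on the initial state -/

section Splitting

variable {α : Type*} {L : List α}

theorem forall_mem_take_drop_iff {d m : ℕ} {Q : α → Prop} :
    (∀ u ∈ (L.drop d).take m, Q u) ↔ ∀ x < m, ∀ u, L[d + x]? = some u → Q u := by
  simp only [List.mem_iff_getElem?, List.getElem?_take, List.getElem?_drop]
  constructor
  · intro h x hx u hu
    exact h u ⟨x, by rwa [if_pos hx]⟩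
  · rintro h u ⟨x, hx⟩
    split_ifs at hx with hxm
    exact h x hxm u hx

theorem eq_take_append_cons_drop {k : ℕ} {o : α} (h : L[k]? = some o) :
    L = L.take k ++ o :: L.drop (k + 1) := by
  obtain ⟨hk, rfl⟩ := List.getElem?_eq_some_iff.1 h
  rw [← List.drop_eq_getElem_cons, List.take_append_drop]

theorem exists_append_cons_iff {p o q : α} {R : List α → List α → Prop} :
    (∃ A B C : List α, L = p :: A ++ o :: (B ++ q :: C) ∧ R (p :: A) (B ++ [q])) ↔
      ∃ k l, 0 < k ∧ k < l ∧ L[0]? = some p ∧ L[k]? = some o ∧ L[l]? = some q ∧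
        R (L.take k) ((L.drop (k + 1)).take (l - k)) := by
  constructor
  · rintro ⟨A, B, C, rfl, h⟩
    refine ⟨A.length + 1, A.length + 1 + (B.length + 1), by simp, by simp, by simp, by simp, ?_, ?_⟩
    · rw [List.getElem?_append_right (by simp)]
      simp
    · rw [List.take_left' (by simp), show p :: A ++ o :: (B ++ q :: C) =
        (p :: A ++ [o]) ++ ((B ++ [q]) ++ C) by simp, List.drop_left' (by simp),
        List.take_left' (by simp)]
      exact h
  · rintro ⟨k, l, hk, hkl, hp, ho, hq, h⟩
    obtain ⟨A, hA⟩ : ∃ A, L.take k = p :: A := by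
      rw [← List.getElem?_take_of_lt hk, ← List.head?_eq_getElem?] at hp
      exact ⟨_, List.eq_cons_of_mem_head? hp⟩
    have hq' : (L.drop (k + 1))[l - k - 1]? = some q := by
      rwa [List.getElem?_drop, show k + 1 + (l - k - 1) = l by omega]
    refine ⟨A, (L.drop (k + 1)).take (l - k - 1), (L.drop (k + 1)).drop (l - k - 1 + 1), ?_, ?_⟩
    · rw [← hA, ← eq_take_append_cons_drop hq', ← eq_take_append_cons_drop ho]
    · rwa [← hA, ← Option.toList_some, ← hq', ← List.take_add_one,
        show l - k - 1 + 1 = l - k by omega]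

end Splitting

section Blocking

variable {V : Type*} {G : SimpleGraph V}

theorem blocksAlong_coe_iff {c : List V} {p q o : V} :
    BlocksAlong G (c : Cycle V) p q o ↔ ∃ i < c.length, ∃ k l, 0 < k ∧ k < l ∧
      (c.rotate i)[0]? = some p ∧ (c.rotate i)[k]? = some o ∧ (c.rotate i)[l]? = some q ∧
        ∀ x < k, ∀ u, (c.rotate i)[x]? = some u →
          ∀ y < l - k, ∀ v, (c.rotate i)[k + y + 1]? = some v → ¬ G.Adj u v := by
  have split_iff (L : List V) := exists_append_cons_iff (L := L) (p := p) (o := o) (q := q)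
    (R := fun E F => ∀ x ∈ E, ∀ y ∈ F, ¬ G.Adj x y)
  have take_iff {L : List V} {k : ℕ} {Q : V → Prop} :
      (∀ u ∈ L.take k, Q u) ↔ ∀ x < k, ∀ u, L[x]? = some u → Q u := by
    simpa using forall_mem_take_drop_iff (L := L) (d := 0) (m := k) (Q := Q)
  simp only [take_iff, forall_mem_take_drop_iff, Nat.add_right_comm _ 1] at split_iff
  simp only [← split_iff]
  constructor
  · rintro ⟨A, B, C, hc, h⟩
    obtain ⟨i, hi⟩ := Cycle.coe_eq_coe.1 hc
    have length_pos : 0 < c.length := by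
      rw [← List.length_rotate c i, hi]
      simp
    exact ⟨i % c.length, Nat.mod_lt _ length_pos, A, B, C, by rw [List.rotate_mod, hi], h⟩
  · rintro ⟨i, -, A, B, C, hi, h⟩
    exact ⟨A, B, C, Cycle.coe_eq_coe.2 ⟨i, hi⟩, h⟩

theorem BlocksAlong.reverse {P : Cycle V} {p q o : V} (h : BlocksAlong G P p q o) :
    BlocksAlong G P.reverse q p o := by
  obtain ⟨A, B, C, rfl, h⟩ := h
  refine ⟨B.reverse, A.reverse, C.reverse, ?_, fun x hx y hy hxy => h y ?_ x ?_ hxy.symm⟩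
  · rw [Cycle.reverse_coe]
    simpa using cycle_coe_append_comm C.reverse (q :: B.reverse ++ o :: (A.reverse ++ [p]))
  · simpa [or_comm] using hy
  · simpa [or_comm] using hx

theorem isBlockingVertex_iff {P : Cycle V} {p q o : V} :
    IsBlockingVertex G P p q o ↔ BlocksAlong G P p q o ∨ BlocksAlong G P q p o :=
  or_congr_right ⟨fun h => by simpa using h.reverse, .reverse⟩

theorem IsHamiltonianCycle.length_eq_natCard {P : Cycle V} (h : IsHamiltonianCycle G P) :
    P.length = Nat.card V := by
  induction P using Quotient.inductionOn with
  | h l =>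
    obtain ⟨f, hf⟩ := List.Nodup.getBijectionOfForallMemList l h.1 h.2.1
    simpa using Nat.card_eq_of_bijective f hf

end Blocking

section Input

variable {N : ℕ} {G : SimpleGraph (Fin N)} {c : List (Fin N)}

theorem inputState_mem_of_lt (hc : c.length = N) {p : ℕ} (hp : p < N) :
    (inputState G c).mem p = (c.get ⟨p, hp.trans_eq hc.symm⟩).val := by
  simp [inputState, hp, hc]

theorem inputState_mem_lt (hc : c.length = N) (p : ℕ) (hp : p < N) :
    (inputState G c).mem p < N :=
  (inputState_mem_of_lt hc hp).trans_lt (Fin.is_lt _)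

theorem sees_inputState_iff (a b : Fin N) :
    RamProgram.Sees N (inputState G c).mem a b ↔ G.Adj a b := by
  have sub_eq : N + b.val + a.val * N - N = b.val + a.val * N := by omega
  have quotient : (b.val + a.val * N) / N = a.val := by
    rw [Nat.add_mul_div_right _ _ a.pos, Nat.div_eq_of_lt b.2, zero_add]
  have remainder : (b.val + a.val * N) % N = b.val := by
    rw [Nat.add_mul_mod_self_right, Nat.mod_eq_of_lt b.2]
  simp [RamProgram.Sees, inputState, show ¬ N + b.val + a.val * N < N by omega, sub_eq, quotient,
    remainder, Fin.val_inj]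

theorem getElem?_rotate_eq_some_iff (hc : c.length = N) {i t : ℕ} (hi : i < N) (ht : t < N)
    {v : Fin N} :
    (c.rotate i)[t]? = some v ↔
      RamProgram.cyclicEntry N (inputState G c).mem (i + t) = v.val := by
  have wrap : (if i + t < N then i + t else i + t - N) = (t + i) % N := by
    split_ifs with h
    · rw [add_comm, Nat.mod_eq_of_lt (by omega)]
    · rw [add_comm, Nat.mod_eq_sub_mod (by omega), Nat.mod_eq_of_lt (by omega)]
  have hlt : (t + i) % N < N := Nat.mod_lt _ (by omega)
  rw [RamProgram.cyclicEntry, wrap, inputState_mem_of_lt hc hlt, Fin.val_inj,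
    List.getElem?_rotate (by omega), List.getElem?_eq_some_iff]
  simp [hc, hlt]

theorem RamProgram.cyclicEntry_of_lt {m : ℕ → ℕ} {t : ℕ} (ht : t < N) :
    cyclicEntry N m t = m t := by
  rw [cyclicEntry, if_pos ht]

theorem blocksAlong_iff_blocked (hc : c.length = N) {p q o : Fin N} :
    BlocksAlong G (c : Cycle (Fin N)) p q o ↔ ∃ i < N, ∃ k < N, ∃ l < N, 0 < k ∧
      RamProgram.Blocked N (inputState G c).mem i k l ∧ p.val = (inputState G c).mem i ∧
        o.val = RamProgram.cyclicEntry N (inputState G c).mem (i + k) ∧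
        q.val = RamProgram.cyclicEntry N (inputState G c).mem (i + l) := by
  rw [blocksAlong_coe_iff, hc]
  refine exists_congr fun i => and_congr_right fun hi => ?_
  have entry {t : ℕ} (ht : t < N) {v : Fin N} := getElem?_rotate_eq_some_iff (G := G) hc hi ht
    (v := v)
  have first {v : Fin N} : (c.rotate i)[0]? = some v ↔ (inputState G c).mem i = v.val := by
    rw [entry (by omega), Nat.add_zero, RamProgram.cyclicEntry_of_lt hi]
  have exists_entry {t : ℕ} (ht : t < N) :
      ∃ u : Fin N, RamProgram.cyclicEntry N (inputState G c).mem (i + t) = u.val :=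
    ⟨⟨_, RamProgram.cyclicEntry_lt (inputState_mem_lt hc) (by omega)⟩, rfl⟩
  constructor
  · rintro ⟨k, l, hk, hkl, hp, ho, hq, h⟩
    have hl : l < N := by simpa [hc] using (List.getElem?_eq_some_iff.1 hq).1
    refine ⟨k, by omega, l, hl, hk, ⟨hkl, fun x hx y hy => ?_⟩, (first.1 hp).symm,
      ((entry (by omega)).1 ho).symm, ((entry hl).1 hq).symm⟩
    obtain ⟨u, hu⟩ := exists_entry (t := x) (by omega)
    obtain ⟨v, hv⟩ := exists_entry (t := k + y + 1) (by omega)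
    rw [hu, hv, sees_inputState_iff]
    exact h x hx u ((entry (by omega)).2 hu) y hy v ((entry (by omega)).2 hv)
  · rintro ⟨k, hk, l, hl, hk_pos, ⟨hkl, h⟩, hp, ho, hq⟩
    refine ⟨k, l, hk_pos, hkl, first.2 hp.symm, (entry hk).2 ho.symm, (entry hl).2 hq.symm,
      fun x hx u hu y hy v hv => ?_⟩
    have not_sees := h x hx y hy
    rwa [(entry (by omega)).1 hu, (entry (by omega)).1 hv, sees_inputState_iff] at not_sees

theorem valid_inputState_iff (hc : c.length = N) {a b : Fin N} (hab : ¬ G.Adj a b) (o : Fin N) :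
    RamProgram.Valid N (inputState G c).mem a b o ↔
      G.Adj a o ∧ IsBlockingVertex G (c : Cycle (Fin N)) a b o := by
  rw [isBlockingVertex_iff, blocksAlong_iff_blocked hc, blocksAlong_iff_blocked hc]
  constructor
  · rintro ⟨i, hi, k, hk, l, hl, hB, ho, hao, h⟩
    rw [sees_inputState_iff] at hao
    have hk_pos : 0 < k := by
      refine Nat.pos_of_ne_zero fun hk_zero => ?_
      rw [hk_zero, Nat.add_zero, RamProgram.cyclicEntry_of_lt hi] at ho
      rcases h with ⟨h, -⟩ | ⟨-, h⟩ <;> rw [← ho, Fin.val_inj] at h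
      exacts [hao.ne h, hab (h ▸ hao)]
    exact ⟨hao, h.imp (fun ⟨ha, hb⟩ => ⟨i, hi, k, hk, l, hl, hk_pos, hB, ha, ho, hb⟩)
      fun ⟨ha, hb⟩ => ⟨i, hi, k, hk, l, hl, hk_pos, hB, hb, ho, ha⟩⟩
  · rintro ⟨hao, ⟨i, hi, k, hk, l, hl, -, hB, ha, ho, hb⟩ |
      ⟨i, hi, k, hk, l, hl, -, hB, hb, ho, ha⟩⟩
    exacts [⟨i, hi, k, hk, l, hl, hB, ho, (sees_inputState_iff a o).2 hao, .inl ⟨ha, hb⟩⟩,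
      ⟨i, hi, k, hk, l, hl, hB, ho, (sees_inputState_iff a o).2 hao, .inr ⟨ha, hb⟩⟩]

theorem blockingProgram_spec (hc : c.length = N) :
    ∃ (t : ℕ) (s : RamState), t ≤ RamProgram.timeBound.eval N ∧
      RamProgram.blockingProgram.Runs (inputState G c) t s ∧ ∀ p : InvisiblePair G,
        (∃ o : Fin N, G.Adj p.1.1 o ∧ IsBlockingVertex G (c : Cycle (Fin N)) p.1.1 p.1.2 o) →
        ∃ o : Fin N, G.Adj p.1.1 o ∧ IsBlockingVertex G (c : Cycle (Fin N)) p.1.1 p.1.2 o ∧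
          s.mem (outputCell p.1.1 p.1.2) = o.val := by
  obtain ⟨t, s, ht, runs, hs⟩ := RamProgram.Does.blockingProgram (s := inputState G c) (N := N)
    (by simp [inputState]) (by simp [inputState]) (inputState_mem_lt hc)
  refine ⟨t, s, ht, runs, ?_⟩
  rintro ⟨⟨a, b⟩, hp⟩ ⟨o, ho⟩
  have valid := hs a a.2 b b.2 ⟨o, (valid_inputState_iff hc hp.2 o).2 ho⟩
  have lt : s.mem (N + N * N + b + a * N) < N := by
    obtain ⟨i, hi, k, hk, l, -, -, written_eq, -⟩ := valid
    exact written_eq ▸ RamProgram.cyclicEntry_lt (inputState_mem_lt hc) (by omega)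
  obtain ⟨adj, blocks⟩ := (valid_inputState_iff hc hp.2 ⟨_, lt⟩).1 valid
  refine ⟨⟨_, lt⟩, adj, blocks, congrArg s.mem ?_⟩
  rw [outputCell, add_comm (a.val * N), ← add_assoc]

end Input

/-! ## Isomorphic graphs -/

section Iso

variable {V W : Type*} {G : SimpleGraph V} {H : SimpleGraph W} {P : Cycle V}

theorem cycle_map_symm_map (φ : V ≃ W) : (P.map φ).map φ.symm = P := by
  induction P using Quotient.inductionOn with
  | h l => simp [Cycle.map_coe]

theorem cycle_length_map (f : V → W) : (P.map f).length = P.length := by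
  induction P using Quotient.inductionOn with
  | h l => simp [Cycle.map_coe]

theorem BlocksAlong.map (φ : G ≃g H) {p q o : V} (h : BlocksAlong G P p q o) :
    BlocksAlong H (P.map φ) (φ p) (φ q) (φ o) := by
  obtain ⟨A, B, C, rfl, h⟩ := h
  refine ⟨A.map φ, B.map φ, C.map φ, by simp, ?_⟩
  rw [← List.map_cons, show B.map φ ++ [φ q] = (B ++ [q]).map φ by simp]
  simpa only [List.forall_mem_map, φ.map_adj_iff] using h

theorem IsBlockingVertex.map (φ : G ≃g H) {p q o : V} (h : IsBlockingVertex G P p q o) :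
    IsBlockingVertex H (P.map φ) (φ p) (φ q) (φ o) := by
  rw [isBlockingVertex_iff] at h ⊢
  exact h.imp (BlocksAlong.map φ) (BlocksAlong.map φ)

theorem isBlockingVertex_map_iff (φ : G ≃g H) {p q o : V} :
    IsBlockingVertex H (P.map φ) (φ p) (φ q) (φ o) ↔ IsBlockingVertex G P p q o := by
  refine ⟨fun h => ?_, .map φ⟩
  have back := h.map φ.symm
  simp only [RelIso.symm_apply_apply] at back
  rwa [show (P.map φ).map φ.symm = P from cycle_map_symm_map φ.toEquiv] at back

end Iso

theorem blockingProgram_outputs_assignment {V : Type*} {H : SimpleGraph V} {P : Cycle V}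
    {β : InvisiblePair H → V} (hβ : IsBlockingVertexAssignment H P β)
    (unique : ∀ γ, IsBlockingVertexAssignment H P γ → γ = β) {N : ℕ} {G : SimpleGraph (Fin N)}
    {c : List (Fin N)} (hc : c.length = N) (φ : H ≃g G) (hP : P.map φ = (c : Cycle (Fin N))) :
    ∃ (t : ℕ) (s : RamState), t ≤ RamProgram.timeBound.eval N ∧
      RamProgram.blockingProgram.Runs (inputState G c) t s ∧
      ∀ p : InvisiblePair H, s.mem (outputCell (φ p.1.1) (φ p.1.2)) = (φ (β p)).val := by
  obtain ⟨t, s, ht, runs, hs⟩ := blockingProgram_spec (G := G) hc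
  have output (p : InvisiblePair H) : ∃ o, (H.Adj p.1.1 o ∧ IsBlockingVertex H P p.1.1 p.1.2 o) ∧
      s.mem (outputCell (φ p.1.1) (φ p.1.2)) = (φ o).val := by
    obtain ⟨o, adj, blocks, ho⟩ :=
      hs ⟨(φ p.1.1, φ p.1.2), φ.injective.ne p.2.1, fun h => p.2.2 (φ.map_adj_iff.1 h)⟩
        ⟨φ (β p), φ.map_adj_iff.2 (hβ p).1, hP ▸ (hβ p).2.map φ⟩
    obtain ⟨o, rfl⟩ := φ.surjective o
    rw [← hP] at blocks
    exact ⟨o, ⟨φ.map_adj_iff.1 adj, (isBlockingVertex_map_iff φ).1 blocks⟩, ho⟩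
  choose γ hγ γ_eq using output
  obtain rfl := unique γ hγ
  exact ⟨t, s, ht, runs, γ_eq⟩

theorem theorem5_general :
    (∀ (n : ℕ) (S : Fin n → List (Fin n)) (K : Cuts n),
      IsPseudolineArrangement S → K.OpenAllHoles S →
        (∃ P : Cycle (PolygonVertex S K), IsBoundaryCycle S K P) ∧
        ∀ P : Cycle (PolygonVertex S K), IsBoundaryCycle S K P →
          IsHamiltonianCycle (internalVisibility S K) P ∧
          ∃! β : InvisiblePair (internalVisibility S K) → PolygonVertex S K,
            IsBlockingVertexAssignment (internalVisibility S K) P β) ∧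
    ∃ (Q : RamProgram) (f : Polynomial ℕ),
      (∀ (n : ℕ) (S : Fin n → List (Fin n)) (K : Cuts n),
        IsPseudolineArrangement S → K.OpenAllHoles S →
        ∀ P : Cycle (PolygonVertex S K), IsBoundaryCycle S K P →
        ∀ β : InvisiblePair (internalVisibility S K) → PolygonVertex S K,
          IsBlockingVertexAssignment (internalVisibility S K) P β →
        ∀ (N : ℕ) (G : SimpleGraph (Fin N)) (φ : internalVisibility S K ≃g G) (c : List (Fin N)),
          P.map φ = (c : Cycle (Fin N)) →
          ∃ (t : ℕ) (s : RamState), t ≤ f.eval N ∧ Q.Runs (inputState G c) t s ∧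
            ∀ p : InvisiblePair (internalVisibility S K),
              s.mem (outputCell (φ p.1.1) (φ p.1.2)) = (φ (β p)).val) ∧
      (∀ (N : ℕ) (G : SimpleGraph (Fin N)) (c : List (Fin N)),
        c.length = N →
          ∃ (t : ℕ) (s : RamState), t ≤ f.eval N ∧ Q.Runs (inputState G c) t s ∧
            ∀ p : InvisiblePair G,
              (∃ o : Fin N, G.Adj p.1.1 o ∧ IsBlockingVertex G (c : Cycle (Fin N)) p.1.1 p.1.2 o) →
              ∃ o : Fin N, G.Adj p.1.1 o ∧ IsBlockingVertex G (c : Cycle (Fin N)) p.1.1 p.1.2 o ∧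
                s.mem (outputCell p.1.1 p.1.2) = o.val) := by
  refine ⟨fun n S K hS hK => ?_, RamProgram.blockingProgram, RamProgram.timeBound,
    fun n S K hS hK P hP β hβ N G φ c hc => ?_, fun N G c hc => blockingProgram_spec hc⟩ <;>
    obtain ⟨X, A⟩ := hS.exists_crossingTimes
  · exact ⟨A.exists_isBoundaryCycle hK, fun P hP =>
      ⟨A.isHamiltonianCycle hP, A.existsUnique_blockingVertexAssignment hK hP⟩⟩
  · have length_eq : c.length = N := by
      rw [← Cycle.length_coe, ← hc, cycle_length_map,
        (A.isHamiltonianCycle hP).length_eq_natCard, Nat.card_congr φ.toEquiv, Nat.card_fin]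
    exact blockingProgram_outputs_assignment hβ (fun γ hγ =>
      (A.existsUnique_blockingVertexAssignment hK hP).unique hγ hβ) length_eq φ hc

theorem theorem5 :
    (∀ (n : ℕ) (S : Fin n → List (Fin n)) (K : Cuts n),
      IsPseudolineArrangement S → K.OpenAllHoles S →
        (∃ P : Cycle (PolygonVertex S K), IsBoundaryCycle S K P) ∧
        ∀ P : Cycle (PolygonVertex S K), IsBoundaryCycle S K P →
          IsHamiltonianCycle (internalVisibility S K) P ∧
          ∃! β : InvisiblePair (internalVisibility S K) → PolygonVertex S K,
            IsBlockingVertexAssignment (internalVisibility S K) P β) ∧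
    ∃ (Q : RamProgram) (f : Polynomial ℕ),
      (∀ (n : ℕ) (S : Fin n → List (Fin n)) (K : Cuts n),
        IsPseudolineArrangement S → K.OpenAllHoles S →
        ∀ P : Cycle (PolygonVertex S K), IsBoundaryCycle S K P →
        ∀ β : InvisiblePair (internalVisibility S K) → PolygonVertex S K,
          IsBlockingVertexAssignment (internalVisibility S K) P β →
        ∀ (N : ℕ) (G : SimpleGraph (Fin N)) (φ : internalVisibility S K ≃g G) (c : List (Fin N)),
          P.map φ = (c : Cycle (Fin N)) →
          ∃ (t : ℕ) (s : RamState), t ≤ f.eval N ∧ Q.Runs (inputState G c) t s ∧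
            ∀ p : InvisiblePair (internalVisibility S K),
              s.mem (outputCell (φ p.1.1) (φ p.1.2)) = (φ (β p)).val) ∧
      (∀ (N : ℕ) (G : SimpleGraph (Fin N)) (c : List (Fin N)),
        IsHamiltonianCycle G (c : Cycle (Fin N)) →
          ∃ (t : ℕ) (s : RamState), t ≤ f.eval N ∧ Q.Runs (inputState G c) t s ∧
            ∀ p : InvisiblePair G,
              (∃ o : Fin N, G.Adj p.1.1 o ∧ IsBlockingVertex G (c : Cycle (Fin N)) p.1.1 p.1.2 o) →
              ∃ o : Fin N, G.Adj p.1.1 o ∧ IsBlockingVertex G (c : Cycle (Fin N)) p.1.1 p.1.2 o ∧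
                s.mem (outputCell p.1.1 p.1.2) = o.val) := by
  obtain ⟨polygons, Q, f, outputs, computes⟩ := theorem5_general
  exact ⟨polygons, Q, f, outputs, fun N G c hc =>
    computes N G c (by simpa using hc.length_eq_natCard)⟩
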